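/- **Notation.** Let $z,z'\in\mathbb{C}$ with $zz'\notin\{0,-1,-2,\dots\}$ and let $\xi\in[0,1)$. Write $(x)_n=x(x+1)\cdots(x+n-1)$. For a partition $\lambda$ of $n$ put $$\mathcal{M}_n(\lambda)=\frac{n!}{(zz')_n}\prod_{\square\in\lambda}\frac{(z+c(\square))(z'+c(\square))}{h(\square)^2},$$ where $c(\square)$ is the content (column minus row) and $h(\square)$ the hook length of the square $\square$, and let $$\mathcal{M}=(1-\xi)^{zz'}\sum_{n\ge0}\xi^n\,\frac{(zz')_n}{n!}\,\mathcal{M}_n,$$ a complex measure on the set of all partitions. Put $\mathfrak{S}(\lambda)=\{\lambda_i-i+\tfrac12 : i\ge1\}\subset\mathbb{Z}+\tfrac12$, and for a finite set $X\subset\mathbb{Z}+\frac12$ let $\rho(X)=\mathcal{M}(\{\lambda: X\subset\mathfrak{S}(\lambda)\})$. The infinite wedge module has the orthonormal basis $\delta_S=v_{s_1}\wedge v_{s_2}\wedge\cdots$, where $S=\{s_1>s_2>\cdots\}$ runs over the subsets of $\mathbb{Z}+\frac12$ with finitely many positive elements that contain all but finitely many of the negative half-integers. The vacuum is $\delta_\emptyset=\delta_{\{-1/2,-3/2,\dots\}}$.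 Let $\psi_k$ be the exterior multiplication by $v_k$ and $\psi^*_k$ its adjoint, and set $$U=\sum_{k\in\mathbb{Z}+\frac12}\left(z+k+\tfrac12\right)\psi_{k+1}\psi^*_k,\qquad D=\sum_{k\in\mathbb{Z}+\frac12}\left(z'+k+\tfrac12\right)\psi_k\psi^*_{k+1},$$ $$G=\exp\left(\frac{\sqrt\xi}{\xi-1}\,U\right)\exp\left(\sqrt\xi\,D\right),\qquad \Psi_k=G\psi_kG^{-1},\qquad \Psi^*_k=G\psi^*_kG^{-1}.$$ Here $G$ and $G^{-1}$ are understood as formal power series in $q=\sqrt\xi$ whose coefficients are operators on the infinite wedge module. For $i,j\in\mathbb{Z}+\frac12$ let $$K(i,j)=\left(\Psi_i\Psi^*_j\,\delta_\emptyset,\delta_\emptyset\right)$$ be the value at $q=\sqrt\xi$ of the resulting power series in $q$. **Theorem.** The series $\sum_\lambda\mathcal{M}(\lambda)$ over all partitions converges absolutely, the power series that defines $K(i,j)$ converges at $q=\sqrt\xi$ for all $i,j\in\mathbb{Z}+\frac12$, and for every finite set $X=\{x_1,\dots,x_s\}\subset\mathbb{Z}+\frac12$ $$\rho(X)=\det\left[K(x_i,x_j)\right]_{1\le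 i,j\le s}.$$ -/

import Mathlib

open scoped Nat

noncomputable section

namespace ZMeasure

/-! Throughout, the half-integer `k = n + 1/2` is represented by the integer `n`.  So `-1/2` is
represented by `-1`, the positive half-integers are the `n ≥ 0` and the negative ones the
`n < 0`, and `z + k + 1/2` reads `z + n + 1`. -/

/-! ### Partitions and the z-measures -/

/-- The content (column minus row) of the square in row `s.1` and column `s.2`. -/
def content (s : ℕ × ℕ) : ℤ := (s.2 : ℤ) - (s.1 : ℤ)

/-- The hook length of the square `s` of `lam`: arm plus leg plus one. -/
def hookLength (lam : YoungDiagram) (s : ℕ × ℕ) : ℤ :=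
  ((lam.rowLen s.1 : ℤ) - (s.2 : ℤ) - 1) + ((lam.colLen s.2 : ℤ) - (s.1 : ℤ) - 1) + 1

/-- The z-measure `𝓜_n` on partitions of `n = |lam|`:
`n! / (z z')_n * ∏ (z + c(□)) (z' + c(□)) / h(□)²`. -/
def levelWeight (z z' : ℂ) (lam : YoungDiagram) : ℂ :=
  (lam.card ! : ℂ) / (ascPochhammer ℂ lam.card).eval (z * z') *
    ∏ s ∈ lam.cells,
      (z + (content s : ℂ)) * (z' + (content s : ℂ)) / ((hookLength lam s : ℂ)) ^ 2

/-- The weight of `lam` for the mixed measure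
`𝓜 = (1 - ξ)^{z z'} ∑ₙ ξⁿ (z z')_n / n! 𝓜_n`; only `n = |lam|` contributes. -/
def mixedWeight (z z' : ℂ) (ξ : ℝ) (lam : YoungDiagram) : ℂ :=
  ((1 - ξ : ℝ) : ℂ) ^ (z * z') *
    ((ξ : ℂ) ^ lam.card * (ascPochhammer ℂ lam.card).eval (z * z') / (lam.card ! : ℂ) *
      levelWeight z z' lam)

/-- The mixed measure `𝓜(A)` of a set `A` of partitions. -/
def mixedMeasure (z z' : ℂ) (ξ : ℝ) (A : Set YoungDiagram) : ℂ :=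
  ∑' lam : A, mixedWeight z z' ξ lam

/-- `𝔖(lam) = {lam_i - i + 1/2 : i ≥ 1}`.  Rows are numbered from `0` here, so that
`lam_{i+1} - (i+1) + 1/2` is represented by `lam.rowLen i - i - 1`. -/
def frakS (lam : YoungDiagram) : Set ℤ :=
  Set.range fun i : ℕ => (lam.rowLen i : ℤ) - (i : ℤ) - 1

/-- The correlation function `ρ(X) = 𝓜({lam : X ⊆ 𝔖(lam)})`. -/
def correlation (z z' : ℂ) (ξ : ℝ) (X : Finset ℤ) : ℂ :=
  mixedMeasure z z' ξ {lam | (X : Set ℤ) ⊆ frakS lam}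

/-! ### The infinite wedge module -/

/-- The subsets `S` of `ℤ + 1/2` for which `S₊` (positive elements of `S`) and `S₋` (negative
half-integers not in `S`) are both finite. -/
@[ext]
structure Maya where
  carrier : Set ℤ
  finite_pos : {n : ℤ | 0 ≤ n ∧ n ∈ carrier}.Finite
  finite_neg : {n : ℤ | n < 0 ∧ n ∉ carrier}.Finite

namespace Maya

/-- `𝔖(∅) = {-1/2, -3/2, …}`. -/
def empty : Maya where
  carrier := {n | n < 0}
  finite_pos := Set.Finite.subset Set.finite_empty fun _ hn => absurd hn.2 (not_lt.mpr hn.1)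
  finite_neg := Set.Finite.subset Set.finite_empty fun _ hn => absurd hn.1 hn.2

/-- `S ∪ {k}`. -/
def insert (k : ℤ) (S : Maya) : Maya where
  carrier := Insert.insert k S.carrier
  finite_pos := (S.finite_pos.insert k).subset fun n hn => by
    rcases hn.2 with h | h
    · exact Or.inl h
    · exact Or.inr ⟨hn.1, h⟩
  finite_neg := S.finite_neg.subset fun n hn => ⟨hn.1, fun h => hn.2 (Or.inr h)⟩

/-- `S \ {k}`. -/
def erase (k : ℤ) (S : Maya) : Maya where
  carrier := S.carrier \ {k}
  finite_pos := S.finite_pos.subset fun n hn => ⟨hn.1, hn.2.1⟩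
  finite_neg := (S.finite_neg.insert k).subset fun n hn => by
    by_cases h : n = k
    · exact Or.inl h
    · exact Or.inr ⟨hn.1, fun h' => hn.2 ⟨h', h⟩⟩

/-- The number of elements of `S` that are larger than `k` (a finite number). -/
def numAbove (k : ℤ) (S : Maya) : ℕ := {n : ℤ | n ∈ S.carrier ∧ k < n}.ncard

theorem finite_above (k : ℤ) (S : Maya) : {n : ℤ | n ∈ S.carrier ∧ k < n}.Finite := by
  refine (S.finite_pos.union (Set.finite_Ioo k 0)).subset fun n hn => ?_
  rcases le_or_gt 0 n with h | h
  · exact Or.inl ⟨h, hn.1⟩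
  · exact Or.inr ⟨hn.2, h⟩

end Maya

/-- The infinite wedge module, with basis `δ_S = v_{s₁} ∧ v_{s₂} ∧ …`, where
`S = {s₁ > s₂ > …}`. -/
abbrev Wedge : Type := Maya →₀ ℂ

/-- The basis vector `δ_S`. -/
def delta (S : Maya) : Wedge := Finsupp.single S 1

/-- The vacuum `δ_∅`. -/
def vacuum : Wedge := delta Maya.empty

/-- The inner product for which `(δ_S)` is orthonormal (linear in the first argument). -/
def wedgeInner (f g : Wedge) : ℂ := f.sum fun S c => c * (starRingEnd ℂ) (g S)

open Classical in
/-- `ψ_k f = v_k ∧ f`: on `δ_S` it is `0` if `k ∈ S`, and otherwise `v_k` has to be moved past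
the factors with larger index. -/
def psi (k : ℤ) : Module.End ℂ Wedge :=
  Finsupp.linearCombination ℂ fun S : Maya =>
    if k ∈ S.carrier then 0 else (-1 : ℂ) ^ S.numAbove k • delta (S.insert k)

open Classical in
/-- `ψ*_k`: if `k = s_i` it removes the factor `v_{s_i}` with the sign `(-1)^{i+1}`, where `i - 1`
is the number of elements of `S` above `k`; it is `0` on `δ_S` if `k ∉ S`. -/
def psiStar (k : ℤ) : Module.End ℂ Wedge :=
  Finsupp.linearCombination ℂ fun S : Maya =>
    if k ∈ S.carrier then (-1 : ℂ) ^ S.numAbove k • delta (S.erase k) else 0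

/-- `U = ∑_k (z + k + 1/2) ψ_{k+1} ψ*_k`, a finite sum on every `δ_S`. -/
def opU (z : ℂ) : Module.End ℂ Wedge :=
  Finsupp.linearCombination ℂ fun S : Maya =>
    ∑ᶠ n : ℤ, (z + (n : ℂ) + 1) • psi (n + 1) (psiStar n (delta S))

/-- `D = ∑_k (z' + k + 1/2) ψ_k ψ*_{k+1}`, a finite sum on every `δ_S`. -/
def opD (z' : ℂ) : Module.End ℂ Wedge :=
  Finsupp.linearCombination ℂ fun S : Maya =>
    ∑ᶠ n : ℤ, (z' + (n : ℂ) + 1) • psi n (psiStar (n + 1) (delta S))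

/-- The sum that defines `opU` is finite. -/
theorem opU_finite (z : ℂ) (S : Maya) : (Function.support fun n : ℤ =>
    (z + (n : ℂ) + 1) • psi (n + 1) (psiStar n (delta S))).Finite := by
  have hfin : (({n : ℤ | 0 ≤ n ∧ n ∈ S.carrier} ∪
      (fun n : ℤ => n + 1) ⁻¹' {n : ℤ | n < 0 ∧ n ∉ S.carrier}) ∪ {-1}).Finite :=
    (S.finite_pos.union (S.finite_neg.preimage ((add_left_injective (1 : ℤ)).injOn))).union
      (Set.finite_singleton _)
  refine hfin.subset fun n hn => ?_
  by_contra hcon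
  simp only [Set.mem_union, Set.mem_ofPred_eq, Set.mem_preimage, Set.mem_singleton_iff,
    not_or, not_and, not_not] at hcon
  apply hn
  by_cases h1 : n ∈ S.carrier
  · have h2 : n + 1 ∈ S.carrier := by
      have hneg : ¬ 0 ≤ n := fun h => hcon.1.1 h h1
      exact hcon.1.2 (by have := hcon.2; omega)
    have h3 : n + 1 ∈ (S.erase n).carrier := ⟨h2, by simp⟩
    simp [psi, psiStar, delta, h1, h3]
  · simp [psiStar, delta, h1]

/-- The sum that defines `opD` is finite. -/
theorem opD_finite (z' : ℂ) (S : Maya) : (Function.support fun n : ℤ =>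
    (z' + (n : ℂ) + 1) • psi n (psiStar (n + 1) (delta S))).Finite := by
  have hfin : (((fun n : ℤ => n + 1) ⁻¹' {n : ℤ | 0 ≤ n ∧ n ∈ S.carrier} ∪
      {n : ℤ | n < 0 ∧ n ∉ S.carrier})).Finite :=
    (S.finite_pos.preimage ((add_left_injective (1 : ℤ)).injOn)).union S.finite_neg
  refine hfin.subset fun n hn => ?_
  by_contra hcon
  simp only [Set.mem_union, Set.mem_ofPred_eq, Set.mem_preimage,
    not_or, not_and, not_not] at hcon
  apply hn
  by_cases h1 : n + 1 ∈ S.carrier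
  · have h2 : n ∈ S.carrier := by
      have hneg : ¬ 0 ≤ n + 1 := fun h => hcon.1 h h1
      exact hcon.2 (by omega)
    have h3 : n ∈ (S.erase (n + 1)).carrier := ⟨h2, by simp⟩
    simp [psi, psiStar, delta, h1, h3]
  · simp [psiStar, delta, h1]

/-! ### The operator `G` and the kernel

With `q = √ξ` as a formal variable, `G` is an invertible element of the ring of formal power
series in `q` whose coefficients are operators on the infinite wedge module: for each power of
`q` only finitely many terms of the exponential series contribute.  The matrix element that
defines the kernel is thus a power series in `q`, and its value at `q = √ξ` is the kernel. -/

/-- Power series in `q` with coefficients in the operators on the infinite wedge module. -/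
abbrev OpSeries : Type := PowerSeries (Module.End ℂ Wedge)

/-- The operator series `a(q) T`. -/
def scaleOp (a : PowerSeries ℂ) (T : Module.End ℂ Wedge) : OpSeries :=
  PowerSeries.mk fun n => PowerSeries.coeff n a • T

/-- The exponential `∑_m F^m / m!` of an operator series without constant term: the coefficient
of `q^n` in `F^m` vanishes for `m > n`. -/
def expSeries (F : OpSeries) : OpSeries :=
  PowerSeries.mk fun n =>
    ∑ m ∈ Finset.range (n + 1), ((m ! : ℂ)⁻¹) • PowerSeries.coeff n (F ^ m)

/-- `G = exp(q / (q² - 1) U) exp(q D)`, where `q = √ξ`. -/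
def opG (z z' : ℂ) : OpSeries :=
  expSeries (scaleOp (PowerSeries.X * (PowerSeries.X ^ 2 - 1)⁻¹) (opU z)) *
    expSeries (scaleOp PowerSeries.X (opD z'))

theorem constantCoeff_expSeries (F : OpSeries) :
    PowerSeries.constantCoeff (expSeries F) = 1 := by
  rw [← PowerSeries.coeff_zero_eq_constantCoeff_apply]
  simp [expSeries]

theorem isUnit_mul_of_constantCoeff {R : Type*} [Ring R] (A B : PowerSeries R)
    (hA : PowerSeries.constantCoeff A = 1) (hB : PowerSeries.constantCoeff B = 1) :
    IsUnit (A * B) := by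
  rw [PowerSeries.isUnit_iff_constantCoeff, map_mul, hA, hB, mul_one]
  exact isUnit_one

theorem isUnit_opSeries_mul (A B : OpSeries)
    (hA : PowerSeries.constantCoeff A = 1) (hB : PowerSeries.constantCoeff B = 1) :
    IsUnit (A * B) := isUnit_mul_of_constantCoeff A B hA hB

/-- `G` is invertible, so that `Ring.inverse (opG z z')` below is its two-sided inverse. -/
theorem isUnit_opG (z z' : ℂ) : IsUnit (opG z z') :=
  isUnit_opSeries_mul _ _ (constantCoeff_expSeries _) (constantCoeff_expSeries _)

/-- `Ψ_k = G ψ_k G⁻¹`. -/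
def Psi (z z' : ℂ) (k : ℤ) : OpSeries :=
  opG z z' * PowerSeries.C (psi k) * Ring.inverse (opG z z')

/-- `Ψ*_k = G ψ*_k G⁻¹`. -/
def PsiStar (z z' : ℂ) (k : ℤ) : OpSeries :=
  opG z z' * PowerSeries.C (psiStar k) * Ring.inverse (opG z z')

/-- The matrix element `(A δ_∅, δ_∅)`, a power series in `q`. -/
def vacuumExpectation (A : OpSeries) : PowerSeries ℂ :=
  PowerSeries.mk fun n => wedgeInner (PowerSeries.coeff n A vacuum) vacuum

/-- `K(i,j) = (Ψ_i Ψ*_j δ_∅, δ_∅)` as a power series in `q = √ξ`. -/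
def kernelSeries (z z' : ℂ) (i j : ℤ) : PowerSeries ℂ :=
  vacuumExpectation (Psi z z' i * PsiStar z z' j)

/-- `K(i,j)`: the value of the power series at `q = √ξ`. -/
def kernel (z z' : ℂ) (ξ : ℝ) (i j : ℤ) : ℂ :=
  ∑' n : ℕ, PowerSeries.coeff n (kernelSeries z z' i j) * ((√ξ : ℝ) : ℂ) ^ n

end ZMeasure

end

noncomputable section

namespace ZMeasure

/-! ### The canonical anticommutation relations -/

namespace Maya

/-! Write v for the vacuum and q = √ξ. The point process is a matrix element in the infinite wedge.
`U` adds a box to a diagram with the factor z + content, and `D` removes one with the corresponding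
factor in z'. By the hook recursion `sum_inv_hookProd`, U^k v / k! is the sum over |λ| = k of ∏ (z +
c) / h times δ_λ (`opU_pow_vacuum`). `D` is the transpose of `U` with z' in place of z, so up to the
factor (1 - ξ)^{zz'} the correlation ρ(X) is (e^{qD} T e^{qU} v, v), where T = ψ_{x₁} ⋯ ψ_{x_s}
ψ*_{x_s} ⋯ ψ*_{x₁} projects onto the configurations containing X.

To bring this into a form to which Wick's theorem applies, note that `U`, `D` and [D, U] span an
sl(2) in which v is a lowest weight vector: D v = 0 and [D, U] v = zz' v. Hence D^m U^{m+k} v is an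
explicit multiple of U^k v, and summing gives e^{qD} e^{qU} v = (1 - q²)^{-zz'} exp(q/(1 - q²) U) v.
Equivalently G⁻¹ v = (1 - q²)^{zz'} e^{qU} v (`opGInv_vacuumEq`). The left factor exp(q/(q² - 1) U)
of G does not change vacuum coefficients, because the image of `U` has none. So (G T G⁻¹ v, v) = (1
- q²)^{zz'} (e^{qD} T e^{qU} v, v), which is `vacuumExpectation_conj_opG`. Conjugation by G keeps
the linear spans of the ψ_k and of the ψ*_k, because `U` and `D` are quadratic in the fermions;
Wick's theorem (`vacuumExpectation_wick`) turns the left side into the determinant of the two-point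
functions.

All this holds for formal power series in q. For convergence at q = √ξ, taking z' to be the
conjugate of z turns ∑ ∏ (z + c)(z' + c) / h² = (zz')_n / n! into a sum of squared norms, so the
weights times q^{|λ|} are square summable; every series needed is dominated by two such sums
(`summable_pairTerm`). Evaluation is a ring homomorphism on absolutely convergent series, hence
commutes with the determinant. -/

@[simp]
theorem mem_insert {k n : ℤ} {S : Maya} : n ∈ (S.insert k).carrier ↔ n = k ∨ n ∈ S.carrier :=
  Iff.rfl

@[simp]
theorem mem_erase {k n : ℤ} {S : Maya} : n ∈ (S.erase k).carrier ↔ n ∈ S.carrier ∧ n ≠ k :=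
  Iff.rfl

@[simp]
theorem mem_empty {n : ℤ} : n ∈ Maya.empty.carrier ↔ n < 0 :=
  Iff.rfl

theorem ext_iff_mem {S T : Maya} : S = T ↔ ∀ n, n ∈ S.carrier ↔ n ∈ T.carrier := by
  rw [Maya.ext_iff, Set.ext_iff]

theorem insert_erase {k : ℤ} {S : Maya} (h : k ∈ S.carrier) : (S.erase k).insert k = S := by
  rw [ext_iff_mem]; intro n; simp; grind

theorem erase_insert {k : ℤ} {S : Maya} (h : k ∉ S.carrier) : (S.insert k).erase k = S := by
  rw [ext_iff_mem]; intro n; simp; grind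

theorem insert_comm (j k : ℤ) (S : Maya) : (S.insert j).insert k = (S.insert k).insert j := by
  rw [ext_iff_mem]; intro n; simp; grind

theorem erase_comm (j k : ℤ) (S : Maya) : (S.erase j).erase k = (S.erase k).erase j := by
  rw [ext_iff_mem]; intro n; simp; grind

theorem erase_insert_comm {j k : ℤ} (h : j ≠ k) (S : Maya) :
    (S.insert j).erase k = (S.erase k).insert j := by
  rw [ext_iff_mem]; intro n; simp; grind

open Classical in
theorem numAbove_insert {j : ℤ} (k : ℤ) {S : Maya} (h : j ∉ S.carrier) :
    (S.insert j).numAbove k = S.numAbove k + if k < j then 1 else 0 := by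
  unfold numAbove
  split_ifs with hk
  · rw [← Set.ncard_insert_of_notMem (a := j) (by simp [h]) (finite_above k S)]
    congr 1
    ext n
    simp only [mem_insert, Set.mem_ofPred_eq, Set.mem_insert_iff]
    grind
  · rw [add_zero]
    congr 1
    ext n
    simp only [mem_insert, Set.mem_ofPred_eq]
    grind

open Classical in
theorem numAbove_erase {j : ℤ} (k : ℤ) {S : Maya} (h : j ∈ S.carrier) :
    S.numAbove k = (S.erase j).numAbove k + if k < j then 1 else 0 := by
  conv_lhs => rw [← insert_erase h]
  exact numAbove_insert k (by simp)

end Maya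

theorem single_eq_smul_delta (S : Maya) (c : ℂ) : (Finsupp.single S c : Wedge) = c • delta S := by
  simp [delta]

theorem wedge_ext {A B : Module.End ℂ Wedge} (h : ∀ S, A (delta S) = B (delta S)) : A = B :=
  Finsupp.lhom_ext' fun S => LinearMap.ext_ring (h S)

open Classical in
theorem psi_delta (k : ℤ) (S : Maya) : psi k (delta S) =
    if k ∈ S.carrier then 0 else (-1 : ℂ) ^ S.numAbove k • delta (S.insert k) := by
  simp [psi, delta]

open Classical in
theorem psiStar_delta (k : ℤ) (S : Maya) : psiStar k (delta S) =
    if k ∈ S.carrier then (-1 : ℂ) ^ S.numAbove k • delta (S.erase k) else 0 := by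
  simp [psiStar, delta]

/-- For i ≠ j the two orders give the same set. Inserting the larger index changes the count above
the smaller one by one, but not conversely, so the two signs are opposite. The same comparison gives
the next two relations. -/
theorem psi_anticomm (i j : ℤ) : psi i * psi j + psi j * psi i = 0 := by
  refine wedge_ext fun S => ?_
  by_cases hij : i = j
  · subst hij
    by_cases hi : i ∈ S.carrier <;> simp [psi_delta, hi]
  by_cases hi : i ∈ S.carrier <;> by_cases hj : j ∈ S.carrier <;>
    simp [psi_delta, hi, hj, hij, Ne.symm hij, Maya.numAbove_insert]
  rw [Maya.insert_comm j i, smul_smul, smul_smul, ← add_smul]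
  rcases lt_or_gt_of_ne hij with h | h
  · simp [h, h.not_gt, pow_add]; left; ring
  · simp [h, h.not_gt, pow_add]; left; ring

theorem psiStar_anticomm (i j : ℤ) : psiStar i * psiStar j + psiStar j * psiStar i = 0 := by
  refine wedge_ext fun S => ?_
  by_cases hij : i = j
  · subst hij
    by_cases hi : i ∈ S.carrier <;> simp [psiStar_delta, hi]
  by_cases hi : i ∈ S.carrier <;> by_cases hj : j ∈ S.carrier <;>
    simp [psiStar_delta, hi, hj, hij, Ne.symm hij]
  rw [Maya.erase_comm j i, smul_smul, smul_smul, ← add_smul, Maya.numAbove_erase i hj,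
    Maya.numAbove_erase j hi]
  rcases lt_or_gt_of_ne hij with h | h
  · simp [h, h.not_gt, pow_add]; left; ring
  · simp [h, h.not_gt, pow_add]; left; ring

theorem psi_psiStar_anticomm (i j : ℤ) :
    psi i * psiStar j + psiStar j * psi i = if i = j then 1 else 0 := by
  refine wedge_ext fun S => ?_
  by_cases hij : i = j
  · subst hij
    by_cases hi : i ∈ S.carrier
    · simp [psiStar_delta, psi_delta, hi, Maya.insert_erase, smul_smul]
      rw [Maya.numAbove_erase i hi]
      simp [← pow_add]
    · simp [psiStar_delta, psi_delta, hi, Maya.erase_insert, smul_smul, Maya.numAbove_insert]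
      simp [← pow_add]
  rw [if_neg hij]
  by_cases hi : i ∈ S.carrier <;> by_cases hj : j ∈ S.carrier <;>
    simp [psi_delta, psiStar_delta, hi, hj, hij, Ne.symm hij, Maya.numAbove_insert]
  rw [Maya.erase_insert_comm hij, smul_smul, smul_smul, ← add_smul, Maya.numAbove_erase i hj]
  rcases lt_or_gt_of_ne hij with h | h
  · simp [h, h.not_gt, pow_add]; left; ring
  · simp [h, h.not_gt, pow_add]; left; ring

/-- `ψ_k` and `ψ*_k` are transposes of each other. -/
theorem psi_apply_eq_psiStar_apply (k : ℤ) (S T : Maya) :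
    psi k (delta S) T = psiStar k (delta T) S := by
  classical
  rw [psi_delta, psiStar_delta]
  by_cases hS : k ∈ S.carrier <;> by_cases hT : k ∈ T.carrier
  · have : T.erase k ≠ S := by rintro rfl; simp at hS
    simp [hS, hT, delta, this]
  · simp [hS, hT]
  · by_cases h : T = S.insert k
    · subst h
      simp [hS, delta, Maya.erase_insert, Maya.numAbove_insert]
    · have h' : T.erase k ≠ S := by
        rintro rfl; exact h (Maya.insert_erase hT).symm
      simp [hS, hT, delta, h', Ne.symm h]
  · have : S.insert k ≠ T := by rintro rfl; simp at hT
    simp [hS, hT, delta, this]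

theorem psi_eq_zero_of_vacuum {k : ℤ} (hk : k < 0) : psi k vacuum = 0 := by
  simp [vacuum, psi_delta, hk]

theorem psiStar_eq_zero_of_vacuum {k : ℤ} (hk : 0 ≤ k) : psiStar k vacuum = 0 := by
  simp [vacuum, psiStar_delta, hk]

/-- A linear functional vanishing on the basis vanishes. -/
theorem apply_eq_zero_of_delta {A : Module.End ℂ Wedge} {T : Maya}
    (h : ∀ S, A (delta S) T = 0) (f : Wedge) : A f T = 0 := by
  have : (Finsupp.lapply T : Wedge →ₗ[ℂ] ℂ) ∘ₗ A = 0 :=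
    Finsupp.lhom_ext' fun S => LinearMap.ext_ring (h S)
  exact LinearMap.congr_fun this f

theorem psi_apply_empty {k : ℤ} (hk : 0 ≤ k) (f : Wedge) : psi k f Maya.empty = 0 := by
  refine apply_eq_zero_of_delta (fun S => ?_) f
  rw [psi_apply_eq_psiStar_apply]
  exact congr_arg (fun g : Wedge => g S) (psiStar_eq_zero_of_vacuum hk)

/-- The transpose of a product of two transposable operators. -/
theorem mul_apply_transpose {A A' B B' : Module.End ℂ Wedge}
    (hA : ∀ S T, A (delta S) T = A' (delta T) S) (hB : ∀ S T, B (delta S) T = B' (delta T) S)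
    (S T : Maya) : (A * B) (delta S) T = (B' * A') (delta T) S := by
  have key : ∀ f : Wedge, A f T = f.sum fun R c => c * A' (delta T) R := by
    intro f
    conv_lhs => rw [← Finsupp.sum_single f]
    rw [Finsupp.sum, map_sum, Finsupp.finsetSum_apply]
    refine Finset.sum_congr rfl fun R _ => ?_
    rw [single_eq_smul_delta, map_smul, Finsupp.smul_apply, smul_eq_mul, hA]
  have key' : ∀ f : Wedge, B' f S = f.sum fun R c => c * B (delta S) R := by
    intro f
    conv_lhs => rw [← Finsupp.sum_single f]
    rw [Finsupp.sum, map_sum, Finsupp.finsetSum_apply]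
    refine Finset.sum_congr rfl fun R _ => ?_
    rw [single_eq_smul_delta, map_smul, Finsupp.smul_apply, smul_eq_mul, ← hB]
  simp only [Module.End.mul_apply]
  rw [key, key']
  classical
  -- Both sides are now the same sum over R, but over different supports; both are extended to the
  -- union.
  rw [Finsupp.sum_of_support_subset _
      (Finset.subset_union_left (s₂ := (A' (delta T)).support)) _ (by simp),
    Finsupp.sum_of_support_subset _
      (Finset.subset_union_right (s₁ := (B (delta S)).support)) _ (by simp)]
  exact Finset.sum_congr rfl fun R _ => mul_comm _ _

/-! ### The operators `U` and `D` -/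

theorem opU_delta (z : ℂ) (S : Maya) : opU z (delta S) =
    ∑ᶠ n : ℤ, (z + (n : ℂ) + 1) • psi (n + 1) (psiStar n (delta S)) := by
  simp [opU, delta]

theorem opD_delta (z : ℂ) (S : Maya) : opD z (delta S) =
    ∑ᶠ n : ℤ, (z + (n : ℂ) + 1) • psi n (psiStar (n + 1) (delta S)) := by
  simp [opD, delta]

/-- The part of `U` given by the indices in `I`. -/
def windowU (z : ℂ) (I : Finset ℤ) : Module.End ℂ Wedge :=
  ∑ n ∈ I, (z + (n : ℂ) + 1) • (psi (n + 1) * psiStar n)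

/-- The part of `D` given by the indices in `I`. -/
def windowD (z : ℂ) (I : Finset ℤ) : Module.End ℂ Wedge :=
  ∑ n ∈ I, (z + (n : ℂ) + 1) • (psi n * psiStar (n + 1))

/-- The infinite sums `U` and `D` agree on each vector with every sufficiently large finite
truncation, so algebra with them reduces to finite sums. -/
theorem exists_window {A : Module.End ℂ Wedge} {B : Finset ℤ → Module.End ℂ Wedge}
    (h : ∀ S, ∃ I₀, ∀ I, I₀ ⊆ I → A (delta S) = B I (delta S)) (f : Wedge) :
    ∃ I₀, ∀ I, I₀ ⊆ I → A f = B I f := by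
  classical
  induction f using Finsupp.induction_linear with
  | zero => exact ⟨∅, by simp⟩
  | add f g hf hg =>
    obtain ⟨I, hI⟩ := hf
    obtain ⟨J, hJ⟩ := hg
    refine ⟨I ∪ J, fun K hK => ?_⟩
    rw [map_add, map_add, hI K (Finset.union_subset_left hK), hJ K (Finset.union_subset_right hK)]
  | single S c =>
    obtain ⟨I, hI⟩ := h S
    refine ⟨I, fun K hK => ?_⟩
    rw [single_eq_smul_delta, map_smul, map_smul, hI K hK]

theorem exists_windowU (z : ℂ) (f : Wedge) :
    ∃ I₀, ∀ I, I₀ ⊆ I → opU z f = windowU z I f := by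
  refine exists_window (fun S => ⟨(opU_finite z S).toFinset, fun I hI => ?_⟩) f
  rw [opU_delta, finsum_eq_sum_of_support_subset (s := I)]
  · simp [windowU, LinearMap.sum_apply]
  · intro n hn
    exact hI ((opU_finite z S).mem_toFinset.mpr hn)

theorem exists_windowD (z : ℂ) (f : Wedge) :
    ∃ I₀, ∀ I, I₀ ⊆ I → opD z f = windowD z I f := by
  refine exists_window (fun S => ⟨(opD_finite z S).toFinset, fun I hI => ?_⟩) f
  rw [opD_delta, finsum_eq_sum_of_support_subset (s := I)]
  · simp [windowD, LinearMap.sum_apply]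
  · intro n hn
    exact hI ((opD_finite z S).mem_toFinset.mpr hn)

/-- This is [ab, p] = a{b, p} - {a, p}b: commutators with quadratic expressions are determined by
anticommutators. -/
theorem mul_mul_eq_of_anticomm {A : Type*} [Ring A] {a b p x y : A} (ha : p * a + a * p = x)
    (hb : p * b + b * p = y) : a * b * p = p * (a * b) + (a * y - x * b) := by
  rw [← ha, ← hb]
  noncomm_ring

theorem mul_mul_eq_of_anticomm_left {A : Type*} [Ring A] {a b p : A} {c : Prop} [Decidable c]
    (ha : p * a + a * p = 0) (hb : p * b + b * p = if c then 1 else 0) :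
    a * b * p = p * (a * b) + if c then a else 0 := by
  rw [mul_mul_eq_of_anticomm ha hb]
  split_ifs <;> simp

theorem mul_mul_eq_of_anticomm_right {A : Type*} [Ring A] [Module ℂ A] {a b p : A} {c : Prop}
    [Decidable c] (ha : p * a + a * p = if c then 1 else 0) (hb : p * b + b * p = 0) :
    a * b * p = p * (a * b) + if c then (-1 : ℂ) • b else 0 := by
  rw [mul_mul_eq_of_anticomm ha hb]
  split_ifs <;> simp

theorem mul_mul_psi (a b k : ℤ) : psi a * psiStar b * psi k = psi k * (psi a * psiStar b) +
    if k = b then psi a else 0 :=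
  mul_mul_eq_of_anticomm_left (A := Module.End ℂ Wedge) (psi_anticomm k a)
    (psi_psiStar_anticomm k b)

theorem mul_mul_psiStar (a b k : ℤ) :
    psi a * psiStar b * psiStar k = psiStar k * (psi a * psiStar b) +
    if a = k then (-1 : ℂ) • psiStar b else 0 :=
  mul_mul_eq_of_anticomm_right (A := Module.End ℂ Wedge)
    ((add_comm _ _).trans (psi_psiStar_anticomm a k)) (psiStar_anticomm k b)

/-- It suffices to test on one basis vector δ_S at a time, and there one window can serve both δ_S
and T δ_S. -/
theorem commute_of_window {A T R : Module.End ℂ Wedge} {B : Finset ℤ → Module.End ℂ Wedge}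
    (hB : ∀ f, ∃ I₀, ∀ I, I₀ ⊆ I → A f = B I f) (I₁ : Finset ℤ)
    (h : ∀ I, I₁ ⊆ I → B I * T = T * B I + R) : A * T = T * A + R := by
  classical
  refine wedge_ext fun S => ?_
  obtain ⟨I, hI⟩ := hB (delta S)
  obtain ⟨J, hJ⟩ := hB (T (delta S))
  have hh := congr_arg (fun F : Module.End ℂ Wedge => F (delta S))
    (h (I ∪ J ∪ I₁) Finset.subset_union_right)
  simp only [LinearMap.add_apply, Module.End.mul_apply] at hh ⊢
  rw [hI (I ∪ J ∪ I₁) (by grind), hJ (I ∪ J ∪ I₁) (by grind), hh]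

/-- Only the term n = k fails to commute with ψ_k, so every window containing k yields the exact
commutator. The three lemmas that follow work in the same way. -/
theorem opU_mul_psi (z : ℂ) (k : ℤ) :
    opU z * psi k = psi k * opU z + (z + (k : ℂ) + 1) • psi (k + 1) := by
  refine commute_of_window (exists_windowU z) {k} fun I hI => ?_
  simp only [windowU, Finset.sum_mul, Finset.mul_sum, smul_mul_assoc, mul_smul_comm, mul_mul_psi,
    smul_add, Finset.sum_add_distrib]
  simp [Finset.singleton_subset_iff.mp hI]

theorem opU_mul_psiStar (z : ℂ) (k : ℤ) :
    opU z * psiStar k = psiStar k * opU z + (-(z + (k : ℂ))) • psiStar (k - 1) := by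
  refine commute_of_window (exists_windowU z) {k - 1} fun I hI => ?_
  simp only [windowU, Finset.sum_mul, Finset.mul_sum, smul_mul_assoc, mul_smul_comm,
    mul_mul_psiStar, smul_add, Finset.sum_add_distrib]
  simp only [← sub_eq_iff_eq_add, ← eq_sub_iff_add_eq]
  simp [Finset.singleton_subset_iff.mp hI]
  rw [smul_smul]
  congr 2
  ring

theorem opD_mul_psi (z : ℂ) (k : ℤ) :
    opD z * psi k = psi k * opD z + (z + (k : ℂ)) • psi (k - 1) := by
  refine commute_of_window (exists_windowD z) {k - 1} fun I hI => ?_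
  simp only [windowD, Finset.sum_mul, Finset.mul_sum, smul_mul_assoc, mul_smul_comm, mul_mul_psi,
    smul_add, Finset.sum_add_distrib]
  simp only [← sub_eq_iff_eq_add, ← eq_sub_iff_add_eq]
  simp [Finset.singleton_subset_iff.mp hI]
  congr 2
  ring

theorem opD_mul_psiStar (z : ℂ) (k : ℤ) :
    opD z * psiStar k = psiStar k * opD z + (-(z + (k : ℂ) + 1)) • psiStar (k + 1) := by
  refine commute_of_window (exists_windowD z) {k} fun I hI => ?_
  simp only [windowD, Finset.sum_mul, Finset.mul_sum, smul_mul_assoc, mul_smul_comm,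
    mul_mul_psiStar, smul_add, Finset.sum_add_distrib]
  simp [Finset.singleton_subset_iff.mp hI]
  rw [smul_smul]
  congr 2
  ring

/-- `U` and `D` are transposes of each other. -/
theorem opD_apply_eq_opU_apply (z : ℂ) (S T : Maya) :
    opD z (delta S) T = opU z (delta T) S := by
  classical
  obtain ⟨I, hI⟩ := exists_windowD z (delta S)
  obtain ⟨J, hJ⟩ := exists_windowU z (delta T)
  rw [hI (I ∪ J) Finset.subset_union_left, hJ (I ∪ J) Finset.subset_union_right]
  simp only [windowU, windowD, LinearMap.sum_apply, LinearMap.smul_apply, Finsupp.finsetSum_apply,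
    Finsupp.smul_apply]
  refine Finset.sum_congr rfl fun n _ => ?_
  congr 1
  exact mul_apply_transpose (psi_apply_eq_psiStar_apply n)
    (fun S T => (psi_apply_eq_psiStar_apply (n + 1) T S).symm) S T

end ZMeasure

end

noncomputable section

namespace ZMeasure

/-! ### The vacuum module of the `sl(2)`-triple generated by `U` and `D` -/

/-- The half-integers at which `S` differs from the vacuum. -/
def Maya.defect (S : Maya) : Set ℤ := {n | 0 ≤ n ∧ n ∈ S.carrier} ∪ {n | n < 0 ∧ n ∉ S.carrier}

theorem Maya.defect_finite (S : Maya) : S.defect.Finite := S.finite_pos.union S.finite_neg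

/-- Induction on the number of places where S differs from the vacuum: deleting a particle at n ≥ 0
or filling a hole at n < 0 lowers it by one. -/
theorem Maya.induction {P : Maya → Prop} (h0 : P Maya.empty)
    (hi : ∀ k S, k ∉ S.carrier → P S → P (S.insert k))
    (he : ∀ k S, k ∈ S.carrier → P S → P (S.erase k)) (S : Maya) : P S := by
  induction h : S.defect.ncard using Nat.strong_induction_on generalizing S with
  | _ m ih =>
    rcases S.defect.eq_empty_or_nonempty with hS | ⟨n, hn⟩
    · suffices S = Maya.empty by rwa [this]
      rw [Maya.ext_iff_mem]
      intro n
      have : n ∉ S.defect := by simp [hS]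
      simp only [Maya.defect, Set.mem_union, Set.mem_ofPred_eq] at this
      rw [Maya.mem_empty]
      grind
    · have key : ∀ T : Maya, T.defect = S.defect \ {n} → P T := by
        intro T hT
        refine ih _ ?_ T rfl
        rw [← h, hT]
        exact Set.ncard_sdiff_singleton_lt_of_mem hn S.defect_finite
      rcases hn with ⟨h1, h2⟩ | ⟨h1, h2⟩
      · rw [← Maya.insert_erase h2]
        refine hi _ _ (by simp) (key _ ?_)
        ext m
        simp only [Maya.defect, Set.mem_union, Set.mem_ofPred_eq, Maya.mem_erase, Set.mem_sdiff,
          Set.mem_singleton_iff]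
        grind
      · rw [← Maya.erase_insert h2]
        refine he _ _ (by simp) (key _ ?_)
        ext m
        simp only [Maya.defect, Set.mem_union, Set.mem_ofPred_eq, Maya.mem_insert, Set.mem_sdiff,
          Set.mem_singleton_iff]
        grind

theorem neg_one_pow_smul_self {M : Type*} [AddCommGroup M] [Module ℂ M] (n : ℕ) (v : M) :
    (-1 : ℂ) ^ n • (-1 : ℂ) ^ n • v = v := by
  rw [smul_smul, ← mul_pow]
  simp

/-- The vacuum is cyclic for the algebra generated by the `ψ_k` and `ψ*_k`. -/
theorem eq_zero_of_commute_of_vacuum {F : Module.End ℂ Wedge}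
    (h0 : F vacuum = 0) (h1 : ∀ k, F * psi k = psi k * F)
    (h2 : ∀ k, F * psiStar k = psiStar k * F) : F = 0 := by
  refine wedge_ext fun S => ?_
  induction S using Maya.induction with
  | h0 => exact h0
  | hi k S hk ih =>
    have e : delta (S.insert k) = (-1 : ℂ) ^ S.numAbove k • psi k (delta S) := by
      rw [psi_delta, if_neg hk, neg_one_pow_smul_self]
    have := LinearMap.congr_fun (h1 k) (delta S)
    simp only [Module.End.mul_apply] at this
    rw [e, map_smul, this, ih]
    simp
  | he k S hk ih =>
    have e : delta (S.erase k) = (-1 : ℂ) ^ S.numAbove k • psiStar k (delta S) := by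
      rw [psiStar_delta, if_pos hk, neg_one_pow_smul_self]
    have := LinearMap.congr_fun (h2 k) (delta S)
    simp only [Module.End.mul_apply] at this
    rw [e, map_smul, this, ih]
    simp

theorem opU_vacuum (z : ℂ) : opU z vacuum = z • psi 0 (psiStar (-1) vacuum) := by
  rw [vacuum, opU_delta, finsum_eq_single _ (-1)]
  · simp
  · intro n hn
    by_cases h : n < 0
    · have : n + 1 < 0 := by omega
      simp [psiStar_delta, psi_delta, h, this]
    · simp [psiStar_delta, h]

theorem opD_vacuum (z : ℂ) : opD z vacuum = 0 := by
  rw [vacuum, opD_delta, finsum_eq_zero_of_forall_eq_zero]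
  intro n
  by_cases h : n + 1 < 0
  · have : n < 0 := by omega
    simp [psiStar_delta, psi_delta, h, this]
  · simp [psiStar_delta, h]

/-! ### Ladder operators and sl(2) relations in an abstract algebra -/

section Abstract

variable {A : Type*} [Ring A] [Algebra ℂ A]

/-- Going up and then down multiplies p by αβ, going down and then up by γδ; the mixed terms cancel
in the commutator. -/
theorem commutator_mul_of_ladder {U D p p₀ p₁ : A} {α β γ δ c : ℂ} (h1 : U * p = p * U + α • p₁)
    (h2 : D * p₁ = p₁ * D + β • p) (h3 : D * p = p * D + γ • p₀) (h4 : U * p₀ = p₀ * U + δ • p)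
    (hc : c = α * β - γ * δ) : (D * U - U * D) * p = p * (D * U - U * D) + c • p := by
  have e1 : D * U * p = p * D * U + γ • (p₀ * U) + α • (p₁ * D) + (α * β) • p := by
    rw [mul_assoc, h1, mul_add, ← mul_assoc, h3, mul_smul_comm, h2, add_mul, smul_mul_assoc,
      smul_add, smul_smul, ← add_assoc]
  have e2 : U * D * p = p * U * D + α • (p₁ * D) + γ • (p₀ * U) + (γ * δ) • p := by
    rw [mul_assoc, h3, mul_add, ← mul_assoc, h1, mul_smul_comm, h4, add_mul, smul_mul_assoc,
      smul_add, smul_smul, ← add_assoc]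
  rw [sub_mul, e1, e2, mul_sub, ← mul_assoc, ← mul_assoc, hc, sub_smul]
  abel

/-- U carries p to p₁, whose weight under C is larger by 2. So [C, U] and 2U have the same
commutator with p. -/
theorem weight_commute_of_ladder {C U p p₁ : A} {α c c₁ : ℂ} (h1 : C * p = p * C + c • p)
    (h2 : C * p₁ = p₁ * C + c₁ • p₁) (h3 : U * p = p * U + α • p₁) (hc : c₁ = c + 2) :
    (C * U - U * C - (2 : ℂ) • U) * p = p * (C * U - U * C - (2 : ℂ) • U) := by
  have e1 : C * U * p = p * C * U + c • (p * U) + α • (p₁ * C) + (α * (c + 2)) • p₁ := by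
    rw [mul_assoc, h3, mul_add, ← mul_assoc, h1, mul_smul_comm, h2, add_mul, smul_mul_assoc,
      smul_add, smul_smul, ← add_assoc, hc]
  have e2 : U * C * p = p * U * C + α • (p₁ * C) + c • (p * U) + (c * α) • p₁ := by
    rw [mul_assoc, h1, mul_add, ← mul_assoc, h3, mul_smul_comm, h3, add_mul, smul_mul_assoc,
      smul_add, smul_smul, ← add_assoc]
  rw [sub_mul, sub_mul, e1, e2, smul_mul_assoc, h3, mul_sub, mul_sub, ← mul_assoc, ← mul_assoc,
    mul_smul_comm]
  module

/-- The commutator [D, U] acts on U^n v by t + 2n. The eigenvalue of DU on U^n v is therefore the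
sum t + (t + 2) + ⋯ + (t + 2n). -/
theorem weight_and_lower_pow {V : Type*} [AddCommGroup V] [Module ℂ V] {U D : Module.End ℂ V}
    {v : V} {t : ℂ} (hD : D v = 0) (hDU : D (U v) = t • v)
    (h : (D * U - U * D) * U - U * (D * U - U * D) - (2 : ℂ) • U = 0) (n : ℕ) :
    D (U ((U ^ n) v)) = (((n : ℂ) + 1) * (t + n)) • (U ^ n) v := by
  have hC : ∀ n : ℕ, D (U ((U ^ n) v)) - U (D ((U ^ n) v)) = (t + 2 * n) • (U ^ n) v := by
    intro n
    induction n with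
    | zero => simp [hD, hDU]
    | succ n ih =>
      have := LinearMap.congr_fun h ((U ^ n) v)
      simp only [LinearMap.sub_apply, Module.End.mul_apply, LinearMap.smul_apply,
        LinearMap.zero_apply] at this
      rw [ih, map_smul, sub_sub, sub_eq_zero, ← add_smul] at this
      rw [pow_succ', Module.End.mul_apply, this]
      push_cast
      congr 1
      ring
  induction n with
  | zero => simp [hDU]
  | succ n ih =>
    have := hC (n + 1)
    rw [sub_eq_iff_eq_add, pow_succ', Module.End.mul_apply, ih, map_smul, ← add_smul] at this
    rw [pow_succ', Module.End.mul_apply, this]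
    push_cast
    congr 1
    ring

end Abstract

/-- The commutator `[D, U]`. -/
def opL (z z' : ℂ) : Module.End ℂ Wedge := opD z' * opU z - opU z * opD z'

/-- The weight is (z + k + 1)(z' + k + 1) - (z + k)(z' + k). The terms in k² and zz' cancel, which
leaves weights that grow by exactly 2 with k, as sl(2) demands. -/
theorem opL_mul_psi (z z' : ℂ) (k : ℤ) :
    opL z z' * psi k = psi k * opL z z' + (z + z' + 2 * k + 1) • psi k :=
  commutator_mul_of_ladder (A := Module.End ℂ Wedge) (opU_mul_psi z k)
    (by have := opD_mul_psi z' (k + 1); rwa [add_sub_cancel_right] at this) (opD_mul_psi z' k)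
    (by have := opU_mul_psi z (k - 1); rwa [sub_add_cancel] at this) (by push_cast; ring)

theorem opL_mul_psiStar (z z' : ℂ) (k : ℤ) :
    opL z z' * psiStar k = psiStar k * opL z z' + (-(z + z' + 2 * k + 1)) • psiStar k :=
  commutator_mul_of_ladder (A := Module.End ℂ Wedge) (opU_mul_psiStar z k)
    (by have := opD_mul_psiStar z' (k - 1); rwa [sub_add_cancel] at this) (opD_mul_psiStar z' k)
    (by have := opU_mul_psiStar z (k + 1); rwa [add_sub_cancel_right] at this)
    (by push_cast; ring)

theorem opD_opU_vacuum (z z' : ℂ) : opD z' (opU z vacuum) = (z * z') • vacuum := by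
  have h1 := LinearMap.congr_fun (opD_mul_psi z' 0) (psiStar (-1) vacuum)
  have h2 := LinearMap.congr_fun (opD_mul_psiStar z' (-1)) vacuum
  simp only [LinearMap.add_apply, Module.End.mul_apply, LinearMap.smul_apply, opD_vacuum,
    map_zero, zero_add] at h1 h2
  have h3 : psiStar (-1 + 1) vacuum = 0 := psiStar_eq_zero_of_vacuum le_rfl
  have h4 := LinearMap.congr_fun (psi_psiStar_anticomm (-1) (-1)) vacuum
  simp only [LinearMap.add_apply, Module.End.mul_apply,
    psi_eq_zero_of_vacuum (show (-1 : ℤ) < 0 by norm_num), map_zero, add_zero, if_true,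
    Module.End.one_apply] at h4
  rw [h3, smul_zero] at h2
  rw [h2, map_zero, zero_add, zero_sub, h4] at h1
  rw [opU_vacuum, map_smul, h1, smul_smul]
  simp

theorem opL_vacuum (z z' : ℂ) : opL z z' vacuum = (z * z') • vacuum := by
  simp only [opL, LinearMap.sub_apply, Module.End.mul_apply, opD_vacuum, opD_opU_vacuum, map_zero]
  exact sub_zero _

theorem opL_opU_vacuum (z z' : ℂ) : opL z z' (opU z vacuum) = (z * z' + 2) • opU z vacuum := by
  have h1 := LinearMap.congr_fun (opL_mul_psi z z' 0) (psiStar (-1) vacuum)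
  have h2 := LinearMap.congr_fun (opL_mul_psiStar z z' (-1)) vacuum
  simp only [LinearMap.add_apply, Module.End.mul_apply, LinearMap.smul_apply, opL_vacuum,
    map_smul] at h1 h2
  rw [h2, map_add, map_smul, map_smul, ← add_smul, ← add_smul] at h1
  rw [opU_vacuum, map_smul, h1, smul_smul, smul_smul]
  congr 1
  push_cast
  ring

/-- The difference commutes with every ψ_k and ψ*_k and kills the vacuum, so it is zero because the
vacuum is cyclic. No product of infinite sums has to be expanded. -/
theorem opL_opU_comm (z z' : ℂ) :
    opL z z' * opU z - opU z * opL z z' - (2 : ℂ) • opU z = 0 := by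
  refine eq_zero_of_commute_of_vacuum ?_ (fun k => ?_) fun k => ?_
  · have h : opL z z' (opU z vacuum) = opU z (opL z z' vacuum) + (2 : ℂ) • opU z vacuum := by
      rw [opL_opU_vacuum, opL_vacuum, map_smul, add_smul]
    exact sub_eq_zero.mpr (sub_eq_iff_eq_add'.mpr h)
  · exact weight_commute_of_ladder (A := Module.End ℂ Wedge) (opL_mul_psi z z' k)
      (opL_mul_psi z z' (k + 1)) (opU_mul_psi z k) (by push_cast; ring)
  · exact weight_commute_of_ladder (A := Module.End ℂ Wedge) (opL_mul_psiStar z z' k)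
      (opL_mul_psiStar z z' (k - 1)) (opU_mul_psiStar z k) (by push_cast; ring)

theorem opD_opU_pow_succ_vacuum (z z' : ℂ) (n : ℕ) :
    opD z' ((opU z ^ (n + 1)) vacuum) = (((n : ℂ) + 1) * (z * z' + n)) • (opU z ^ n) vacuum := by
  rw [pow_succ']
  exact weight_and_lower_pow (V := Wedge) (opD_vacuum z') (opD_opU_vacuum z z')
    (opL_opU_comm z z') n

/-- `D^m U^{m+k} v_∅ = (m+k)!/k! (z z' + k)_m U^k v_∅`. -/
theorem opD_pow_opU_pow_vacuum (z z' : ℂ) (k m : ℕ) :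
    (opD z' ^ m) ((opU z ^ (m + k)) vacuum) =
      (((m + k) ! : ℂ) / (k ! : ℂ) * (ascPochhammer ℂ m).eval (z * z' + k)) •
        (opU z ^ k) vacuum := by
  induction m with
  | zero => simp [div_self, Nat.factorial_ne_zero]
  | succ m ih =>
    rw [pow_succ, Module.End.mul_apply, add_right_comm, opD_opU_pow_succ_vacuum, map_smul, ih,
      smul_smul, ascPochhammer_succ_eval, Nat.factorial_succ]
    congr 1
    push_cast
    ring

theorem opD_pow_opU_pow_vacuum_of_lt (z z' : ℂ) {j m : ℕ} (h : j < m) :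
    (opD z' ^ m) ((opU z ^ j) vacuum) = 0 := by
  obtain ⟨d, rfl⟩ := Nat.exists_eq_add_of_lt h
  have := opD_pow_opU_pow_vacuum z z' 0 j
  rw [add_zero] at this
  rw [show j + d + 1 = d + 1 + j by ring, pow_add, Module.End.mul_apply, this, map_smul, pow_zero,
    Module.End.one_apply, pow_succ, Module.End.mul_apply, opD_vacuum, map_zero, smul_zero]

/-- The vacuum coefficient of a vector in the image of `U` vanishes. -/
theorem opU_apply_empty (z : ℂ) (f : Wedge) : opU z f Maya.empty = 0 := by
  refine apply_eq_zero_of_delta (fun S => ?_) f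
  rw [← opD_apply_eq_opU_apply]
  exact congr_arg (fun g : Wedge => g S) (opD_vacuum z)

end ZMeasure

end

noncomputable section

namespace ZMeasure

/-! ### Wick's theorem -/

section Wick

variable {R B : Type*} [CommRing R] [Ring B]

/-- Each factor passed costs a sign, and each stop leaves a scalar. In the reversed product s - j
factors stand to the left of b j, hence the sign (-1)^(s + j). -/
theorem mul_prod_reverse_of_anticomm (ι : R →+* B) (hι : ∀ r x, ι r * x = x * ι r) (p : B) :
    ∀ {s : ℕ} (b : Fin (s + 1) → B) (k : Fin (s + 1) → R)
      (_ : ∀ j, p * b j + b j * p = ι (k j)),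
    p * (List.ofFn b).reverse.prod = ι ((-1) ^ (s + 1)) * (List.ofFn b).reverse.prod * p +
      ∑ j : Fin (s + 1), ι ((-1) ^ (s + (j : ℕ)) * k j) *
        (List.ofFn (b ∘ j.succAbove)).reverse.prod
  | 0, b, k, h => by
    have := h 0
    simp only [List.ofFn_succ, List.ofFn_zero, List.reverse_cons, List.reverse_nil, List.nil_append,
      List.prod_singleton]
    simp [← this]
  | s + 1, b, k, h => by
    have ih := mul_prod_reverse_of_anticomm ι hι p (fun j => b j.succ) (fun j => k j.succ)
      fun j => h j.succ
    have h0 : p * b 0 = ι (k 0) - b 0 * p := eq_sub_of_add_eq (h 0)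
    rw [List.ofFn_succ, List.reverse_cons, List.prod_append, List.prod_singleton, ← mul_assoc, ih,
      add_mul, Finset.sum_mul, Fin.sum_univ_succ (n := s + 1)]
    set L := (List.ofFn fun i => b i.succ).reverse.prod
    have hz : (List.ofFn (b ∘ Fin.succAbove 0)).reverse.prod = L := rfl
    have hs : ∀ j : Fin (s + 1), (List.ofFn (b ∘ Fin.succAbove j.succ)).reverse.prod =
        (List.ofFn ((fun i => b i.succ) ∘ j.succAbove)).reverse.prod * b 0 := by
      intro j
      rw [List.ofFn_succ, List.reverse_cons, List.prod_append, List.prod_singleton]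
      have : (fun i => (b ∘ Fin.succAbove j.succ) (Fin.succ i)) =
          (fun i => b i.succ) ∘ j.succAbove := by
        funext i
        simp
      rw [this]
      simp
    rw [hz, ← add_assoc]
    congr 1
    · rw [mul_assoc _ p, h0, mul_sub, mul_assoc _ L, ← hι (k 0) L, ← mul_assoc, ← map_mul,
        pow_succ _ (s + 1)]
      simp only [Fin.val_zero, add_zero, map_mul, map_neg, map_one]
      noncomm_ring
    · refine Finset.sum_congr rfl fun j _ => ?_
      rw [hs, mul_assoc, Fin.val_succ]
      congr 3
      ring

theorem mul_prod_of_anticomm (ι : R →+* B) (p : B) :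
    ∀ {s : ℕ} (a : Fin s → B) (_ : ∀ j, p * a j + a j * p = 0),
    p * (List.ofFn a).prod = ι ((-1) ^ s) * (List.ofFn a).prod * p
  | 0, a, h => by simp
  | s + 1, a, h => by
    have ih := mul_prod_of_anticomm ι p (fun j => a j.succ) fun j => h j.succ
    have : ∀ x : B, a 0 * ((-1) ^ s * x) = (-1) ^ s * (a 0 * x) := fun x => by
      rw [← mul_assoc, ← mul_assoc, ((Commute.neg_one_left (a 0)).pow_left s).eq]
    rw [List.ofFn_succ, List.prod_cons, ← mul_assoc, eq_neg_of_add_eq_zero_left (h 0), neg_mul,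
      mul_assoc, ih]
    simp only [map_pow, map_neg, map_one, pow_succ, mul_assoc, this, mul_neg, neg_mul, mul_one]

/-- **Wick's theorem** for elements `a i = (a i - p i) + p i` whose annihilation part `p i`
anticommutes with all `a j` and has scalar anticommutators with the `b j`. -/
theorem wick (ι : R →+* B) (hι : ∀ r x, ι r * x = x * ι r) (ω : B →+ R)
    (hω : ∀ r x, ω (ι r * x) = r * ω x) (hω1 : ω 1 = 1) :
    ∀ {s : ℕ} (a p b : Fin s → B) (K : Matrix (Fin s) (Fin s) R)
      (_ : ∀ i x, ω ((a i - p i) * x) = 0) (_ : ∀ i x, ω (x * p i) = 0)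
      (_ : ∀ i j, p i * a j + a j * p i = 0) (_ : ∀ i j, p i * b j + b j * p i = ι (K i j)),
    ω ((List.ofFn a).prod * (List.ofFn b).reverse.prod) = K.det
  | 0, _, _, _, _, _, _, _, _ => by simp [hω1]
  | s + 1, a, p, b, K, h1, h2, h3, h4 => by
    have ih : ∀ j : Fin (s + 1), ω ((List.ofFn fun i => a (Fin.succ i)).prod *
        (List.ofFn (b ∘ j.succAbove)).reverse.prod) = (K.submatrix Fin.succ j.succAbove).det :=
      fun j => wick ι hι ω hω hω1 (fun i => a i.succ) (fun i => p i.succ) (b ∘ j.succAbove)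
        (K.submatrix Fin.succ j.succAbove) (fun i => h1 i.succ) (fun i => h2 i.succ)
        (fun i j => h3 i.succ j.succ) fun i j => h4 _ _
    rw [List.ofFn_succ, List.prod_cons, mul_assoc, Matrix.det_succ_row_zero]
    set L := (List.ofFn fun i => a (Fin.succ i)).prod
    set Q := (List.ofFn b).reverse.prod with hQ
    -- The creation part of a 0 dies at the left end, so a 0 may be replaced by p 0. Moved to the
    -- right end, p 0 dies as well; what remains are its contractions with the b j, which form the
    -- Laplace expansion along the first row.
    have e1 : ω (a 0 * (L * Q)) = ω (p 0 * (L * Q)) := by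
      have := h1 0 (L * Q)
      rwa [sub_mul, map_sub, sub_eq_zero] at this
    have e2 : p 0 * L = ι ((-1) ^ s) * L * p 0 :=
      mul_prod_of_anticomm ι (p 0) (fun i => a i.succ) fun j => h3 0 j.succ
    have e3 := mul_prod_reverse_of_anticomm ι hι (p 0) b (K 0) (h4 0)
    rw [← hQ] at e3
    rw [e1, ← mul_assoc, e2, mul_assoc _ (p 0) Q, e3, mul_add, map_add, ← mul_assoc _ _ (p 0), h2,
      zero_add, Finset.mul_sum, map_sum]
    refine Finset.sum_congr rfl fun j _ => ?_
    rw [← ih, mul_assoc _ L, ← mul_assoc L, ← hι _ L, mul_assoc _ L, hω, hω, pow_add]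
    have : ((-1 : R) ^ s) * (-1) ^ s = 1 := by rw [← mul_pow]; simp
    linear_combination (-1) ^ (j : ℕ) * K 0 j *
      ω (L * (List.ofFn (b ∘ j.succAbove)).reverse.prod) * this

/-- This identifies the scalar anticommutators in Wick's theorem with two-point functions. -/
theorem wick_entry (ι : R →+* B) (ω : B →+ R) (hω : ∀ r x, ω (ι r * x) = r * ω x)
    (hω1 : ω 1 = 1) {a p b : B} {k : R} (h1 : ∀ x, ω ((a - p) * x) = 0) (h2 : ∀ x, ω (x * p) = 0)
    (h4 : p * b + b * p = ι k) : ω (a * b) = k := by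
  have e1 := h1 b
  have e2 := hω k 1
  rw [sub_mul, map_sub, sub_eq_zero] at e1
  rw [mul_one, hω1, mul_one, ← h4, map_add, h2, add_zero] at e2
  rw [e1, e2]

end Wick

/-! ### Power series over an algebra -/

section Series

open PowerSeries

variable {A : Type*} [Ring A] [Algebra ℂ A]

/-- The Euler operator `q d/dq`. -/
def euler (F : A⟦X⟧) : A⟦X⟧ := PowerSeries.mk fun n => (n : ℂ) • coeff n F

@[simp]
theorem coeff_euler (n : ℕ) (F : A⟦X⟧) : coeff n (euler F) = (n : ℂ) • coeff n F :=
  coeff_mk _ _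

theorem euler_mul (F G : A⟦X⟧) : euler (F * G) = euler F * G + F * euler G := by
  ext n
  simp only [coeff_euler, coeff_mul, map_add, Finset.smul_sum, ← Finset.sum_add_distrib]
  refine Finset.sum_congr rfl fun x hx => ?_
  rw [← Finset.HasAntidiagonal.mem_antidiagonal.mp hx, Nat.cast_add, add_smul, smul_mul_assoc, mul_smul_comm]

theorem euler_C (a : A) : euler (C a : A⟦X⟧) = 0 := by
  ext n
  rw [coeff_euler, coeff_C]
  split_ifs with h <;> simp [h]

/-- Used to prove that a product of series is 1: its Euler derivative vanishes and its constant term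
is 1. -/
theorem eq_C_of_euler_eq_zero {F : A⟦X⟧} (h : euler F = 0) : F = C (coeff 0 F) := by
  ext n
  rw [coeff_C]
  split_ifs with hn
  · rw [hn]
  · have := congr_arg (coeff n) h
    rw [coeff_euler, map_zero, smul_eq_zero] at this
    exact this.resolve_left (Nat.cast_ne_zero.mpr hn)

theorem euler_pow (a : ℂ⟦X⟧) (m : ℕ) : euler (a ^ (m + 1)) = ((m : ℂ) + 1) • (a ^ m * euler a) := by
  induction m with
  | zero => simp
  | succ m ih =>
    rw [pow_succ, euler_mul, ih, pow_succ]
    simp only [smul_eq_C_mul]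
    push_cast
    simp only [map_add, map_one]
    ring

theorem euler_neg (a : ℂ⟦X⟧) : euler (-a) = -euler a := by
  ext n
  simp

variable (A) in
/-- Scalar power series as power series over `A`. -/
abbrev scalarSeries : ℂ⟦X⟧ →+* A⟦X⟧ := PowerSeries.map (algebraMap ℂ A)

theorem coeff_scalarSeries_mul (n : ℕ) (a : ℂ⟦X⟧) (F : A⟦X⟧) :
    coeff n (scalarSeries A a * F) =
      ∑ x ∈ Finset.HasAntidiagonal.antidiagonal n, coeff x.1 a • coeff x.2 F := by
  simp [coeff_mul, Algebra.smul_def]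

theorem scalarSeries_comm (a : ℂ⟦X⟧) (F : A⟦X⟧) :
    scalarSeries A a * F = F * scalarSeries A a := by
  ext n
  rw [coeff_mul, coeff_mul, ← Finset.Nat.sum_antidiagonal_swap]
  refine Finset.sum_congr rfl fun x _ => ?_
  simp [Algebra.commutes]

/-- The exponential of `a(q) T`. -/
def expOp (a : ℂ⟦X⟧) (T : A) : A⟦X⟧ :=
  PowerSeries.mk fun n => ∑ m ∈ Finset.range (n + 1), ((m ! : ℂ)⁻¹ * coeff n (a ^ m)) • T ^ m

theorem coeff_pow_eq_zero {a : ℂ⟦X⟧} (ha : constantCoeff a = 0) {n m : ℕ} (h : n < m) :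
    coeff n (a ^ m) = 0 := by
  obtain ⟨b, rfl⟩ := X_dvd_iff.mpr ha
  rw [mul_pow, coeff_X_pow_mul', if_neg (by omega)]

/-- Since a^m starts at q^m, terms with m > n do not contribute. The freedom in N allows
coefficients of different orders to be written over one range. -/
theorem coeff_expOp {a : ℂ⟦X⟧} (ha : constantCoeff a = 0) (T : A) {n N : ℕ} (h : n < N) :
    coeff n (expOp a T) = ∑ m ∈ Finset.range N, ((m ! : ℂ)⁻¹ * coeff n (a ^ m)) • T ^ m := by
  rw [expOp, coeff_mk]
  refine Finset.sum_subset (Finset.range_subset_range.mpr h) fun m _ hm => ?_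
  rw [coeff_pow_eq_zero ha (by simpa using hm)]
  simp

@[simp]
theorem constantCoeff_expOp (a : ℂ⟦X⟧) (T : A) : constantCoeff (expOp a T) = 1 := by
  rw [← coeff_zero_eq_constantCoeff_apply, expOp, coeff_mk]
  simp

theorem C_mul_expOp (a : ℂ⟦X⟧) (T : A) : C T * expOp a T = expOp a T * C T := by
  ext n
  rw [coeff_C_mul, coeff_mul_C, expOp, coeff_mk, Finset.mul_sum, Finset.sum_mul]
  refine Finset.sum_congr rfl fun m _ => ?_
  rw [mul_smul_comm, smul_mul_assoc, ← pow_succ, ← pow_succ']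

theorem euler_expOp {a : ℂ⟦X⟧} (ha : constantCoeff a = 0) (T : A) :
    euler (expOp a T) = scalarSeries A (euler a) * (C T * expOp a T) := by
  ext n
  -- The bound n + 2 leaves a sum over range (n + 1) after the term m = 0 is split off, matching the
  -- range on the right.
  rw [coeff_euler, coeff_expOp ha T (show n < n + 2 by omega), Finset.sum_range_succ',
    coeff_scalarSeries_mul]
  have h1 : ∀ x ∈ Finset.HasAntidiagonal.antidiagonal n, coeff x.1 (euler a) • coeff x.2 (C T * expOp a T) =
      ∑ m ∈ Finset.range (n + 1),
        ((m ! : ℂ)⁻¹ * (coeff x.1 (euler a) * coeff x.2 (a ^ m))) • T ^ (m + 1) := by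
    intro x hx
    rw [coeff_C_mul, coeff_expOp ha T (show x.2 < n + 1 by
      have := Finset.HasAntidiagonal.mem_antidiagonal.mp hx; omega), Finset.mul_sum, Finset.smul_sum]
    refine Finset.sum_congr rfl fun m _ => ?_
    rw [mul_smul_comm, smul_smul, ← pow_succ']
    congr 1
    ring
  rw [Finset.sum_congr rfl h1, Finset.sum_comm, smul_add, Finset.smul_sum]
  have h2 : (n : ℂ) • ((0 ! : ℂ)⁻¹ * coeff n (a ^ 0)) • T ^ 0 = 0 := by
    rw [pow_zero a, coeff_one]
    split_ifs with h <;> simp [h]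
  rw [h2, add_zero]
  refine Finset.sum_congr rfl fun m _ => ?_
  rw [← Finset.sum_smul, ← Finset.mul_sum, ← coeff_mul, smul_smul, mul_comm (euler a)]
  congr 1
  have := congr_arg (coeff n) (euler_pow a m)
  rw [coeff_euler, coeff_smul, smul_eq_mul, smul_eq_mul] at this
  rw [mul_left_comm, this, Nat.factorial_succ, ← mul_assoc]
  push_cast
  congr 1
  field_simp

theorem expOp_mul_expOp_neg {a : ℂ⟦X⟧} (ha : constantCoeff a = 0) (T : A) :
    expOp a T * expOp (-a) T = 1 := by
  have h : euler (expOp a T * expOp (-a) T) = 0 := by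
    rw [euler_mul, euler_expOp ha, euler_expOp (by simp [ha]), euler_neg, map_neg, neg_mul, mul_neg,
      mul_assoc, C_mul_expOp, ← sub_eq_add_neg, sub_eq_zero, ← mul_assoc (expOp a T),
      ← scalarSeries_comm _ (expOp a T), mul_assoc, mul_assoc]
  rw [eq_C_of_euler_eq_zero h]
  simp

theorem expOp_neg_mul_expOp {a : ℂ⟦X⟧} (ha : constantCoeff a = 0) (T : A) :
    expOp (-a) T * expOp a T = 1 := by
  have := expOp_mul_expOp_neg (a := -a) (by simp [ha]) T
  rwa [neg_neg] at this

/-- Conjugation by `exp(a(q) T)` preserves the series with coefficients in `W` if `[T, W] ⊆ W`. -/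
theorem expOp_conj_C_mem {a : ℂ⟦X⟧} (ha : constantCoeff a = 0) {T : A} {W : Submodule ℂ A}
    (hT : ∀ w ∈ W, T * w - w * T ∈ W) {w : A} (hw : w ∈ W) (n : ℕ) :
    coeff n (expOp a T * C w * expOp (-a) T) ∈ W := by
  set Z := expOp a T * C w * expOp (-a) T with hZ
  -- Z solves the equation q Z' = (q a') [T, Z]. As q a' has no constant term, the n-th coefficient
  -- of Z is a combination of commutators of T with earlier coefficients, so it stays in W by
  -- induction.
  have h : euler Z = scalarSeries A (euler a) * (C T * Z - Z * C T) := by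
    rw [hZ, euler_mul, euler_mul, euler_C, mul_zero, add_zero, euler_expOp ha,
      euler_expOp (by simp [ha]), euler_neg, map_neg, C_mul_expOp _ T, neg_mul, mul_neg,
      ← sub_eq_add_neg, mul_sub]
    congr 1
    · rw [← C_mul_expOp]
      simp only [mul_assoc]
    · rw [C_mul_expOp _ T, ← mul_assoc, ← scalarSeries_comm]
      simp only [mul_assoc]
  induction n using Nat.strong_induction_on with
  | _ n ih =>
    rcases Nat.eq_zero_or_pos n with rfl | hn
    · simpa [hZ] using hw
    · have := congr_arg (coeff n) h
      rw [coeff_euler, coeff_scalarSeries_mul] at this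
      have hn' : (n : ℂ) ≠ 0 := Nat.cast_ne_zero.mpr hn.ne'
      rw [← W.smul_mem_iff hn', this]
      refine W.sum_mem fun x hx => ?_
      rcases Nat.eq_zero_or_pos x.1 with h0 | h0
      · rw [h0]
        simp
      · refine W.smul_mem _ ?_
        rw [map_sub, coeff_C_mul, coeff_mul_C]
        exact hT _ (ih _ (by have := Finset.HasAntidiagonal.mem_antidiagonal.mp hx; omega))

/-- The conjugation by G is a composite of two, so the outer exponential conjugates a series rather
than a constant. Splitting off the constant term of Y gains a factor q and lowers n. -/
theorem expOp_conj_mem {a : ℂ⟦X⟧} (ha : constantCoeff a = 0) {T : A} {W : Submodule ℂ A}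
    (hT : ∀ w ∈ W, T * w - w * T ∈ W) (n : ℕ) (Y : A⟦X⟧) (hY : ∀ m, coeff m Y ∈ W) :
    coeff n (expOp a T * Y * expOp (-a) T) ∈ W := by
  induction n generalizing Y with
  | zero => simpa using hY 0
  | succ n ih =>
    have h := eq_X_mul_shift_add_const Y
    set Y' : A⟦X⟧ := PowerSeries.mk fun p => coeff (p + 1) Y
    have e : expOp a T * Y * expOp (-a) T = X * (expOp a T * Y' * expOp (-a) T) +
        expOp a T * C (coeff 0 Y) * expOp (-a) T := by
      rw [h, mul_add, add_mul]
      congr 1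
      · rw [← mul_assoc _ X, ← X_mul]
        simp only [mul_assoc]
      · simp
    rw [e, map_add, coeff_succ_X_mul]
    exact W.add_mem (ih _ fun m => by rw [coeff_mk]; exact hY _)
      (expOp_conj_C_mem ha hT (hY 0) _)

end Series

end ZMeasure

end

noncomputable section

namespace ZMeasure

/-! ### Wick's theorem for series of operators, and the binomial series (1 - q²)^{-t} -/

section Series

open PowerSeries

variable {A : Type*} [Ring A] [Algebra ℂ A]

theorem coeff_scalarSeries_mul_expOp (c : ℂ⟦X⟧) {a : ℂ⟦X⟧} (ha : constantCoeff a = 0) (T : A)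
    (n : ℕ) : coeff n (scalarSeries A c * expOp a T) =
      ∑ m ∈ Finset.range (n + 1), ((m ! : ℂ)⁻¹ * coeff n (c * a ^ m)) • T ^ m := by
  rw [coeff_scalarSeries_mul]
  have h1 : ∀ x ∈ Finset.HasAntidiagonal.antidiagonal n, coeff x.1 c • coeff x.2 (expOp a T) =
      ∑ m ∈ Finset.range (n + 1), ((m ! : ℂ)⁻¹ * (coeff x.1 c * coeff x.2 (a ^ m))) • T ^ m := by
    intro x hx
    rw [coeff_expOp ha T (show x.2 < n + 1 by
      have := Finset.HasAntidiagonal.mem_antidiagonal.mp hx; omega), Finset.smul_sum]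
    refine Finset.sum_congr rfl fun m _ => ?_
    rw [smul_smul]
    congr 1
    ring
  rw [Finset.sum_congr rfl h1, Finset.sum_comm]
  refine Finset.sum_congr rfl fun m _ => ?_
  rw [← Finset.sum_smul, ← Finset.mul_sum, ← coeff_mul]

theorem coeff_expOp_X (T : A) (n : ℕ) : coeff n (expOp X T) = (n ! : ℂ)⁻¹ • T ^ n := by
  rw [expOp, coeff_mk, Finset.sum_eq_single_of_mem n (by simp)]
  · simp
  · intro m _ hm
    rw [coeff_X_pow, if_neg hm.symm]
    simp

theorem coeff_mk_smul_pow (a : ℂ⟦X⟧) (T : A) (m n : ℕ) :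
    coeff n ((PowerSeries.mk fun n => coeff n a • T) ^ m) = coeff n (a ^ m) • T ^ m := by
  induction m generalizing n with
  | zero =>
    rw [pow_zero, pow_zero, pow_zero, coeff_one, coeff_one]
    split_ifs <;> simp
  | succ m ih =>
    rw [pow_succ, coeff_mul, pow_succ a, coeff_mul, Finset.sum_smul]
    refine Finset.sum_congr rfl fun x _ => ?_
    rw [ih, coeff_mk, smul_mul_smul_comm, pow_succ]

/-- The coefficientwise extension of a linear functional. -/
def seriesFunctional (ev : A →ₗ[ℂ] ℂ) : A⟦X⟧ →+ ℂ⟦X⟧ where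
  toFun F := PowerSeries.mk fun n => ev (coeff n F)
  map_zero' := by ext; simp
  map_add' F G := by ext; simp

@[simp]
theorem coeff_seriesFunctional (ev : A →ₗ[ℂ] ℂ) (F : A⟦X⟧) (n : ℕ) :
    coeff n (seriesFunctional ev F) = ev (coeff n F) :=
  coeff_mk n fun n => ev (coeff n F)

theorem seriesFunctional_scalarSeries_mul (ev : A →ₗ[ℂ] ℂ) (r : ℂ⟦X⟧) (F : A⟦X⟧) :
    seriesFunctional ev (scalarSeries A r * F) = r * seriesFunctional ev F := by
  ext n
  rw [coeff_seriesFunctional, coeff_scalarSeries_mul, coeff_mul, map_sum]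
  simp

theorem seriesFunctional_one {ev : A →ₗ[ℂ] ℂ} (h : ev 1 = 1) : seriesFunctional ev 1 = 1 := by
  ext n
  rw [coeff_seriesFunctional, coeff_one, coeff_one]
  split_ifs <;> simp [h]

/-- Wick's theorem for power series whose coefficients are linear combinations of creation
operators (`Wp`) and annihilation operators (`Wm`). -/
theorem wick_series {ev : A →ₗ[ℂ] ℂ} (hev : ev 1 = 1) {Wm Wp W' : Submodule ℂ A}
    (hp : ∀ a ∈ Wp, ∀ x, ev (a * x) = 0) (hm : ∀ a ∈ Wm, ∀ x, ev (x * a) = 0)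
    (haa : ∀ p ∈ Wm, ∀ a ∈ Wm ⊔ Wp, p * a + a * p = 0)
    (hab : ∀ p ∈ Wm, ∀ b ∈ W', ∃ c : ℂ, p * b + b * p = algebraMap ℂ A c)
    {s : ℕ} (a b : Fin s → A⟦X⟧) (ha : ∀ i n, coeff n (a i) ∈ Wm ⊔ Wp)
    (hb : ∀ i n, coeff n (b i) ∈ W') :
    seriesFunctional ev ((List.ofFn a).prod * (List.ofFn b).reverse.prod) =
      (Matrix.of fun i j => seriesFunctional ev (a i * b j)).det := by
  have h : ∀ i n, ∃ p q, p ∈ Wm ∧ q ∈ Wp ∧ p + q = coeff n (a i) := fun i n => by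
    obtain ⟨p, hp, q, hq, e⟩ := Submodule.mem_sup.mp (ha i n)
    exact ⟨p, q, hp, hq, e⟩
  choose p q hpm hqp hpq using h
  -- The annihilation part is chosen coefficient by coefficient; any choice of the decomposition
  -- serves.
  set P : Fin s → A⟦X⟧ := fun i => PowerSeries.mk (p i) with hP
  have hanti : ∀ (x y : A⟦X⟧) (n : ℕ), coeff n (x * y + y * x) =
      ∑ z ∈ Finset.HasAntidiagonal.antidiagonal n,
        (coeff z.1 x * coeff z.2 y + coeff z.2 y * coeff z.1 x) := by
    intro x y n
    rw [map_add, coeff_mul, coeff_mul, ← Finset.Nat.sum_antidiagonal_swap (f := fun z =>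
      coeff z.1 y * coeff z.2 x), ← Finset.sum_add_distrib]
    rfl
  have h1 : ∀ i x, seriesFunctional ev ((a i - P i) * x) = 0 := by
    intro i x
    ext n
    rw [coeff_seriesFunctional, coeff_mul, map_sum, map_zero]
    refine Finset.sum_eq_zero fun z _ => ?_
    rw [map_sub, hP, coeff_mk, ← hpq, add_sub_cancel_left]
    exact hp _ (hqp _ _) _
  have h2 : ∀ i x, seriesFunctional ev (x * P i) = 0 := by
    intro i x
    ext n
    rw [coeff_seriesFunctional, coeff_mul, map_sum, map_zero]
    refine Finset.sum_eq_zero fun z _ => ?_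
    rw [hP, coeff_mk]
    exact hm _ (hpm _ _) _
  have h3 : ∀ i j, P i * a j + a j * P i = 0 := by
    intro i j
    ext n
    rw [hanti, map_zero]
    refine Finset.sum_eq_zero fun z _ => ?_
    rw [hP, coeff_mk]
    exact haa _ (hpm _ _) _ (ha _ _)
  have h4 : ∀ i j, ∃ k, P i * b j + b j * P i = scalarSeries A k := by
    intro i j
    choose c hc using fun z : ℕ × ℕ => hab (p i z.1) (hpm _ _) (coeff z.2 (b j)) (hb _ _)
    refine ⟨PowerSeries.mk fun n => ∑ z ∈ Finset.HasAntidiagonal.antidiagonal n, c z, ?_⟩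
    ext n
    rw [hanti, coeff_map, coeff_mk, map_sum]
    refine Finset.sum_congr rfl fun z _ => ?_
    rw [← hc, hP, coeff_mk]
  choose K hK using h4
  rw [wick (scalarSeries A) scalarSeries_comm (seriesFunctional ev)
    (seriesFunctional_scalarSeries_mul ev) (seriesFunctional_one hev) a P b (Matrix.of K) h1 h2 h3 hK]
  congr 1
  ext1 i j
  exact (wick_entry (scalarSeries A) (seriesFunctional ev) (seriesFunctional_scalarSeries_mul ev)
    (seriesFunctional_one hev) (h1 i) (h2 i) (hK i j)).symm

/-- The expansion `∑ (t)_m / m! q^{2m}` of `(1 - q²)^{-t}`. -/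
def negBinomial (t : ℂ) : ℂ⟦X⟧ := PowerSeries.mk fun n =>
  if Even n then (ascPochhammer ℂ (n / 2)).eval t / ((n / 2) ! : ℂ) else 0

theorem coeff_negBinomial_two_mul (t : ℂ) (m : ℕ) :
    coeff (2 * m) (negBinomial t) = (ascPochhammer ℂ m).eval t / (m ! : ℂ) := by
  simp [negBinomial]

theorem coeff_negBinomial_of_odd (t : ℂ) {n : ℕ} (hn : ¬ Even n) :
    coeff n (negBinomial t) = 0 := by
  simp [negBinomial, hn]

theorem coeff_X_sq_mul_of_odd {f : ℂ⟦X⟧} (hf : ∀ n, ¬ Even n → coeff n f = 0) {n : ℕ}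
    (hn : ¬ Even n) : coeff n (X ^ 2 * f) = 0 := by
  rw [coeff_X_pow_mul']
  split_ifs with h
  · refine hf _ ?_
    rwa [Nat.even_sub h, iff_true_right even_two]
  · rfl

/-- This is the differential equation of (1 - q²)^{-t}, which on even coefficients is the recursion
(t)_{m+1} = (t)_m (t + m). -/
theorem euler_negBinomial (t : ℂ) :
    (1 - X ^ 2) * euler (negBinomial t) = C (2 * t) * (X ^ 2 * negBinomial t) := by
  ext n
  rw [sub_mul, one_mul, map_sub, coeff_C_mul]
  by_cases hn : Even n
  · obtain ⟨m, rfl⟩ := hn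
    rw [← two_mul]
    rcases m with _ | m
    · simp [coeff_X_pow_mul']
    · rw [coeff_X_pow_mul', coeff_X_pow_mul', if_pos (by omega), if_pos (by omega),
        show 2 * (m + 1) - 2 = 2 * m by omega, coeff_euler, coeff_euler,
        coeff_negBinomial_two_mul, coeff_negBinomial_two_mul, ascPochhammer_succ_eval,
        Nat.factorial_succ]
      have : (m ! : ℂ) ≠ 0 := Nat.cast_ne_zero.mpr (Nat.factorial_ne_zero m)
      have : (m : ℂ) + 1 ≠ 0 := Nat.cast_add_one_ne_zero m
      push_cast
      simp only [smul_eq_mul]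
      field_simp
      ring
  · rw [coeff_X_sq_mul_of_odd (fun n => coeff_negBinomial_of_odd t) hn,
      coeff_X_sq_mul_of_odd (fun n h => by rw [coeff_euler, coeff_negBinomial_of_odd t h, smul_zero])
        hn, coeff_euler, coeff_negBinomial_of_odd t hn]
    simp

theorem negBinomial_add_one (t : ℂ) : (1 - X ^ 2) * negBinomial (t + 1) = negBinomial t := by
  ext n
  rw [sub_mul, one_mul, map_sub]
  by_cases hn : Even n
  · obtain ⟨m, rfl⟩ := hn
    rw [← two_mul]
    rcases m with _ | m
    · rw [coeff_negBinomial_two_mul, coeff_negBinomial_two_mul, coeff_X_pow_mul']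
      simp
    · rw [coeff_X_pow_mul', if_pos (by omega), show 2 * (m + 1) - 2 = 2 * m by omega,
        coeff_negBinomial_two_mul, coeff_negBinomial_two_mul, coeff_negBinomial_two_mul,
        Nat.factorial_succ]
      have e1 : (ascPochhammer ℂ (m + 1)).eval t = t * (ascPochhammer ℂ m).eval (t + 1) := by
        rw [ascPochhammer_succ_left]
        simp
      rw [e1, ascPochhammer_succ_eval]
      have : (m ! : ℂ) ≠ 0 := Nat.cast_ne_zero.mpr (Nat.factorial_ne_zero m)
      have : (m : ℂ) + 1 ≠ 0 := Nat.cast_add_one_ne_zero m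
      push_cast
      field_simp
      ring
  · rw [coeff_X_sq_mul_of_odd (fun n => coeff_negBinomial_of_odd _) hn,
      coeff_negBinomial_of_odd _ hn, coeff_negBinomial_of_odd _ hn, sub_zero]

theorem one_sub_X_sq_ne_zero : (1 - X ^ 2 : ℂ⟦X⟧) ≠ 0 := by
  intro h
  simpa using congr_arg constantCoeff h

theorem negBinomial_neg_mul (t : ℂ) : negBinomial (-t) * negBinomial t = 1 := by
  have h : euler (negBinomial (-t) * negBinomial t) = 0 := by
    -- The differential equations are known only after multiplication by 1 - q², which can be
    -- cancelled in the domain of complex power series.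
    refine (mul_eq_zero.mp ?_).resolve_left one_sub_X_sq_ne_zero
    have e1 := euler_negBinomial t
    have e2 := euler_negBinomial (-t)
    rw [mul_neg, map_neg] at e2
    rw [euler_mul]
    linear_combination negBinomial (-t) * e1 + negBinomial t * e2
  have hc : ∀ t, constantCoeff (negBinomial t) = 1 := fun t => by
    rw [← coeff_zero_eq_constantCoeff_apply]
    simpa using coeff_negBinomial_two_mul t 0
  rw [eq_C_of_euler_eq_zero h]
  simp [hc]

theorem neg_X_mul_inv : (-(X * (X ^ 2 - 1)⁻¹) : ℂ⟦X⟧) * (1 - X ^ 2) = X := by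
  have : ((X ^ 2 - 1 : ℂ⟦X⟧)⁻¹) * (X ^ 2 - 1) = 1 := PowerSeries.inv_mul_cancel _ (by simp)
  linear_combination (X : ℂ⟦X⟧) * this

/-- The power is that of q/(1 - q²), and each factor 1/(1 - q²) raises t by one. The shift t + k
matches the factor (zz' + k)_m in `opD_pow_opU_pow_vacuum`. -/
theorem negBinomial_mul_pow (t : ℂ) (k : ℕ) :
    negBinomial t * (-(X * (X ^ 2 - 1)⁻¹)) ^ k = X ^ k * negBinomial (t + k) := by
  induction k generalizing t with
  | zero => simp
  | succ k ih =>
    have h1 := negBinomial_add_one t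
    have h2 := ih (t + 1)
    rw [show t + 1 + (k : ℂ) = t + ((k + 1 : ℕ) : ℂ) by push_cast; ring] at h2
    rw [← h1]
    linear_combination negBinomial (t + 1) * (-(X * (X ^ 2 - 1)⁻¹)) ^ k * neg_X_mul_inv + X * h2

end Series

end ZMeasure

end

noncomputable section

namespace ZMeasure

open PowerSeries

/-! ### The vacuum expectation of conjugated operators -/

/-- The vacuum expectation of an operator. -/
def vacuumFunctional : Module.End ℂ Wedge →ₗ[ℂ] ℂ :=
  Finsupp.lapply Maya.empty ∘ₗ LinearMap.applyₗ vacuum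

theorem vacuumFunctional_apply (F : Module.End ℂ Wedge) :
    vacuumFunctional F = F vacuum Maya.empty := rfl

theorem wedgeInner_vacuum (f : Wedge) : wedgeInner f vacuum = f Maya.empty := by
  classical
  rw [wedgeInner, Finsupp.sum]
  simp only [vacuum, delta, Finsupp.single_apply]
  rw [Finset.sum_eq_single Maya.empty]
  · simp
  · intro S _ hS
    simp [Ne.symm hS]
  · intro h
    simpa using h

theorem vacuumExpectation_eq (F : OpSeries) :
    vacuumExpectation F = seriesFunctional vacuumFunctional F := by
  ext n
  rw [vacuumExpectation, coeff_mk, coeff_seriesFunctional, wedgeInner_vacuum]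
  rfl

theorem vacuumFunctional_one : vacuumFunctional 1 = 1 := by
  simp [vacuumFunctional_apply, vacuum, delta]

/-- The span of the annihilation operators among the `ψ_k`. -/
def psiAnnihilators : Submodule ℂ (Module.End ℂ Wedge) :=
  Submodule.span ℂ (psi '' {k | k < 0})

/-- The span of the creation operators among the `ψ_k`. -/
def psiCreators : Submodule ℂ (Module.End ℂ Wedge) :=
  Submodule.span ℂ (psi '' {k | 0 ≤ k})

/-- The span of the `ψ*_k`. -/
def psiStarSpan : Submodule ℂ (Module.End ℂ Wedge) :=
  Submodule.span ℂ (Set.range psiStar)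

theorem psiSpan_eq : psiAnnihilators ⊔ psiCreators = Submodule.span ℂ (Set.range psi) := by
  rw [psiAnnihilators, psiCreators, ← Submodule.span_union, ← Set.image_union, ← Set.image_univ]
  congr 2
  ext k
  simpa using lt_or_ge k 0

theorem vacuumFunctional_creator_mul {a : Module.End ℂ Wedge} (ha : a ∈ psiCreators)
    (x : Module.End ℂ Wedge) : vacuumFunctional (a * x) = 0 := by
  induction ha using Submodule.span_induction with
  | mem a h =>
    obtain ⟨k, hk, rfl⟩ := h
    exact psi_apply_empty hk _
  | zero => rw [zero_mul, map_zero]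
  | add a b _ _ h1 h2 => rw [add_mul, map_add, h1, h2, add_zero]
  | smul c a _ h => rw [smul_mul_assoc, map_smul, h, smul_zero]

theorem vacuumFunctional_mul_annihilator {a : Module.End ℂ Wedge} (ha : a ∈ psiAnnihilators)
    (x : Module.End ℂ Wedge) : vacuumFunctional (x * a) = 0 := by
  induction ha using Submodule.span_induction with
  | mem a h =>
    obtain ⟨k, hk, rfl⟩ := h
    rw [vacuumFunctional_apply, Module.End.mul_apply, psi_eq_zero_of_vacuum hk, map_zero]
    rfl
  | zero => rw [mul_zero, map_zero]
  | add a b _ _ h1 h2 => rw [mul_add, map_add, h1, h2, add_zero]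
  | smul c a _ h => rw [mul_smul_comm, map_smul, h, smul_zero]

/-- A property of anticommutators that passes from generators to spans. -/
theorem anticomm_mem_of_span {A : Type*} [Ring A] [Algebra ℂ A] {s t : Set A} (N : Submodule ℂ A)
    (h : ∀ a ∈ s, ∀ b ∈ t, a * b + b * a ∈ N) {a b : A} (ha : a ∈ Submodule.span ℂ s)
    (hb : b ∈ Submodule.span ℂ t) : a * b + b * a ∈ N := by
  induction ha, hb using Submodule.span_induction₂ with
  | mem_mem a b ha hb => exact h a ha b hb
  | zero_left b hb => simp
  | zero_right a ha => simp
  | add_left a a' b _ _ _ h1 h2 =>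
    have : (a + a') * b + b * (a + a') = (a * b + b * a) + (a' * b + b * a') := by noncomm_ring
    rw [this]
    exact N.add_mem h1 h2
  | add_right a b b' _ _ _ h1 h2 =>
    have : a * (b + b') + (b + b') * a = (a * b + b * a) + (a * b' + b' * a) := by noncomm_ring
    rw [this]
    exact N.add_mem h1 h2
  | smul_left c a b _ _ h1 =>
    rw [smul_mul_assoc, mul_smul_comm, ← smul_add]
    exact N.smul_mem c h1
  | smul_right c a b _ _ h1 =>
    rw [smul_mul_assoc, mul_smul_comm, ← smul_add]
    exact N.smul_mem c h1

/-- Wick's theorem for series of fermions. -/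
theorem vacuumExpectation_wick {s : ℕ} (a b : Fin s → OpSeries)
    (ha : ∀ i n, coeff n (a i) ∈ Submodule.span ℂ (Set.range psi))
    (hb : ∀ i n, coeff n (b i) ∈ psiStarSpan) :
    vacuumExpectation ((List.ofFn a).prod * (List.ofFn b).reverse.prod) =
      (Matrix.of fun i j => vacuumExpectation (a i * b j)).det := by
  simp only [vacuumExpectation_eq]
  rw [← psiSpan_eq] at ha
  refine wick_series vacuumFunctional_one (fun p hp => vacuumFunctional_creator_mul hp)
    (fun p hp => vacuumFunctional_mul_annihilator hp) (fun p hp c hc => ?_)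
    (fun p hp c hc => ?_) a b ha hb
  · rw [psiSpan_eq] at hc
    have := anticomm_mem_of_span (A := Module.End ℂ Wedge) ⊥ (s := psi '' {k | k < 0})
      (t := Set.range psi) ?_ hp hc
    · exact (Submodule.mem_bot ℂ).mp this
    · rintro _ ⟨i, -, rfl⟩ _ ⟨j, rfl⟩
      exact (Submodule.mem_bot ℂ).mpr (psi_anticomm i j)
  · have := anticomm_mem_of_span (A := Module.End ℂ Wedge) (1 : Submodule ℂ (Module.End ℂ Wedge))
      (s := psi '' {k | k < 0}) (t := Set.range psiStar) ?_ hp hc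
    · obtain ⟨c, hc⟩ := Submodule.mem_one.mp this
      exact ⟨c, hc.symm⟩
    · rintro _ ⟨i, -, rfl⟩ _ ⟨j, rfl⟩
      refine Submodule.mem_one.mpr ⟨if i = j then 1 else 0, ?_⟩
      refine Eq.trans ?_ (psi_psiStar_anticomm i j).symm
      split_ifs
      · exact map_one _
      · exact map_zero _

theorem commutator_mem_of_span {A : Type*} [Ring A] [Algebra ℂ A] {s : Set A} {T : A}
    (h : ∀ a ∈ s, ∃ b ∈ Submodule.span ℂ s, T * a = a * T + b) (a : A)
    (ha : a ∈ Submodule.span ℂ s) : T * a - a * T ∈ Submodule.span ℂ s := by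
  induction ha using Submodule.span_induction with
  | mem a ha =>
    obtain ⟨b, hb, e⟩ := h a ha
    rwa [e, add_sub_cancel_left]
  | zero => simp
  | add a b _ _ h1 h2 =>
    have : T * (a + b) - (a + b) * T = (T * a - a * T) + (T * b - b * T) := by noncomm_ring
    rw [this]
    exact Submodule.add_mem _ h1 h2
  | smul c a _ h1 =>
    rw [smul_mul_assoc, mul_smul_comm, ← smul_sub]
    exact Submodule.smul_mem _ c h1

theorem opU_commutator_psi (z : ℂ) : ∀ w ∈ Submodule.span ℂ (Set.range psi),
    opU z * w - w * opU z ∈ Submodule.span ℂ (Set.range psi) := by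
  refine commutator_mem_of_span (A := Module.End ℂ Wedge) ?_
  rintro _ ⟨k, rfl⟩
  exact ⟨_, Submodule.smul_mem _ _ (Submodule.subset_span ⟨k + 1, rfl⟩), opU_mul_psi z k⟩

theorem opD_commutator_psi (z : ℂ) : ∀ w ∈ Submodule.span ℂ (Set.range psi),
    opD z * w - w * opD z ∈ Submodule.span ℂ (Set.range psi) := by
  refine commutator_mem_of_span (A := Module.End ℂ Wedge) ?_
  rintro _ ⟨k, rfl⟩
  exact ⟨_, Submodule.smul_mem _ _ (Submodule.subset_span ⟨k - 1, rfl⟩), opD_mul_psi z k⟩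

theorem opU_commutator_psiStar (z : ℂ) : ∀ w ∈ psiStarSpan,
    opU z * w - w * opU z ∈ psiStarSpan := by
  refine commutator_mem_of_span (A := Module.End ℂ Wedge) ?_
  rintro _ ⟨k, rfl⟩
  exact ⟨_, Submodule.smul_mem _ _ (Submodule.subset_span ⟨k - 1, rfl⟩), opU_mul_psiStar z k⟩

theorem opD_commutator_psiStar (z : ℂ) : ∀ w ∈ psiStarSpan,
    opD z * w - w * opD z ∈ psiStarSpan := by
  refine commutator_mem_of_span (A := Module.End ℂ Wedge) ?_
  rintro _ ⟨k, rfl⟩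
  exact ⟨_, Submodule.smul_mem _ _ (Submodule.subset_span ⟨k + 1, rfl⟩), opD_mul_psiStar z k⟩

/-! ### The operator `G` -/

/-- The exponent `q / (q² - 1)`. -/
abbrev raiseExponent : ℂ⟦X⟧ := X * (X ^ 2 - 1)⁻¹

theorem expSeries_scaleOp (a : ℂ⟦X⟧) (T : Module.End ℂ Wedge) :
    expSeries (scaleOp a T) = expOp a T := by
  ext1 n
  rw [expSeries, expOp, coeff_mk, coeff_mk]
  refine Finset.sum_congr rfl fun m _ => ?_
  rw [mul_smul]
  congr 1
  exact coeff_mk_smul_pow (A := Module.End ℂ Wedge) a T m n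

theorem opG_eq (z z' : ℂ) : opG z z' = expOp raiseExponent (opU z) * expOp X (opD z') := by
  rw [opG, expSeries_scaleOp, expSeries_scaleOp]

/-- The inverse of `G`. -/
def opGInv (z z' : ℂ) : OpSeries := expOp (-X) (opD z') * expOp (-raiseExponent) (opU z)

theorem constantCoeff_raiseExponent : constantCoeff raiseExponent = 0 := by simp [raiseExponent]

theorem mul_mul_mul_cancel {M : Type*} [Monoid M] {a b c d : M} (h1 : b * c = 1) (h2 : a * d = 1) :
    a * b * (c * d) = 1 := by
  rw [mul_assoc, ← mul_assoc b, h1, one_mul, h2]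

theorem opG_mul_opGInv (z z' : ℂ) : opG z z' * opGInv z z' = 1 := by
  rw [opG_eq, opGInv]
  exact mul_mul_mul_cancel (expOp_mul_expOp_neg (A := Module.End ℂ Wedge) constantCoeff_X _)
    (expOp_mul_expOp_neg (A := Module.End ℂ Wedge) constantCoeff_raiseExponent _)

theorem opGInv_mul_opG (z z' : ℂ) : opGInv z z' * opG z z' = 1 := by
  rw [opG_eq, opGInv]
  exact mul_mul_mul_cancel
    (expOp_neg_mul_expOp (A := Module.End ℂ Wedge) constantCoeff_raiseExponent _)
    (expOp_neg_mul_expOp (A := Module.End ℂ Wedge) constantCoeff_X _)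

theorem inverse_opG (z z' : ℂ) : Ring.inverse (opG z z') = opGInv z z' :=
  Ring.inverse_unit ⟨opG z z', opGInv z z', opG_mul_opGInv z z', opGInv_mul_opG z z'⟩

theorem conj_opG_mem {z z' : ℂ} {W : Submodule ℂ (Module.End ℂ Wedge)}
    (hU : ∀ w ∈ W, opU z * w - w * opU z ∈ W) (hD : ∀ w ∈ W, opD z' * w - w * opD z' ∈ W)
    {w : Module.End ℂ Wedge} (hw : w ∈ W) (n : ℕ) :
    coeff n (opG z z' * PowerSeries.C w * Ring.inverse (opG z z')) ∈ W := by
  have e : opG z z' * PowerSeries.C w * Ring.inverse (opG z z') =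
      expOp raiseExponent (opU z) * (expOp X (opD z') * PowerSeries.C w * expOp (-X) (opD z')) *
        expOp (-raiseExponent) (opU z) := by
    rw [inverse_opG, opGInv, opG_eq]
    simp only [mul_assoc]
  rw [e]
  exact expOp_conj_mem (A := Module.End ℂ Wedge) constantCoeff_raiseExponent hU n _ fun m =>
    expOp_conj_C_mem (A := Module.End ℂ Wedge) constantCoeff_X hD hw m

theorem coeff_Psi_mem (z z' : ℂ) (k : ℤ) (n : ℕ) :
    coeff n (Psi z z' k) ∈ Submodule.span ℂ (Set.range psi) :=
  conj_opG_mem (opU_commutator_psi z) (opD_commutator_psi z') (Submodule.subset_span ⟨k, rfl⟩) n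

theorem coeff_PsiStar_mem (z z' : ℂ) (k : ℤ) (n : ℕ) : coeff n (PsiStar z z' k) ∈ psiStarSpan :=
  conj_opG_mem (opU_commutator_psiStar z) (opD_commutator_psiStar z')
    (Submodule.subset_span ⟨k, rfl⟩) n

/-- Two operator series that agree on the vacuum. -/
def VacuumEq (F G : OpSeries) : Prop := ∀ n, coeff n F vacuum = coeff n G vacuum

/-- Left multiplication is compatible with agreement on the vacuum, whereas a right factor would
move the vacuum first. The exponential identities below are needed only in this weak sense. -/
theorem VacuumEq.mul_left {F G : OpSeries} (h : VacuumEq F G) (H : OpSeries) :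
    VacuumEq (H * F) (H * G) := by
  intro n
  rw [coeff_mul, coeff_mul, LinearMap.sum_apply, LinearMap.sum_apply]
  exact Finset.sum_congr rfl fun x _ => congr_arg _ (h x.2)

theorem VacuumEq.vacuumExpectation_eq {F G : OpSeries} (h : VacuumEq F G) :
    vacuumExpectation F = vacuumExpectation G := by
  ext n
  rw [vacuumExpectation, vacuumExpectation, coeff_mk, coeff_mk, h n]

/-- No vector in the image of `U` has a vacuum component, so only the identity term of the
exponential is seen. -/
theorem vacuumExpectation_expOp_opU_mul (a : ℂ⟦X⟧) (z : ℂ) (F : OpSeries) :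
    vacuumExpectation (expOp a (opU z) * F) = vacuumExpectation F := by
  have h : ∀ (n : ℕ) (f : Wedge), coeff n (expOp a (opU z)) f Maya.empty =
      if n = 0 then f Maya.empty else 0 := by
    intro n f
    rw [expOp, coeff_mk, LinearMap.sum_apply, Finsupp.finsetSum_apply, Finset.sum_range_succ',
      Finset.sum_eq_zero, zero_add, pow_zero a, coeff_one]
    · split_ifs <;> simp
    · intro m _
      rw [LinearMap.smul_apply, Finsupp.smul_apply, pow_succ' (opU z), Module.End.mul_apply,
        opU_apply_empty, smul_zero]
  ext n
  rw [ZMeasure.vacuumExpectation_eq, ZMeasure.vacuumExpectation_eq, coeff_seriesFunctional,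
    coeff_seriesFunctional, coeff_mul, map_sum, Finset.sum_eq_single (0, n)]
  · rw [vacuumFunctional_apply, Module.End.mul_apply, h, if_pos rfl]
    rfl
  · intro x hx hne
    rw [vacuumFunctional_apply, Module.End.mul_apply, h, if_neg]
    intro h0
    have := Finset.HasAntidiagonal.mem_antidiagonal.mp hx
    exact hne (Prod.ext h0 (by simp; omega))
  · intro h
    simp at h

theorem coeff_expOp_X_wedge (T : Module.End ℂ Wedge) (n : ℕ) :
    coeff n (expOp X T : OpSeries) = (n ! : ℂ)⁻¹ • T ^ n :=
  coeff_expOp_X (A := Module.End ℂ Wedge) T n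

/-- By sl(2), D^i U^{i+m} v / (i! (i+m)!) is (zz' + m)_i / (i! m!) times U^m v. For fixed m, summing
these against q^{2i+m} gives q^m (1 - q²)^{-zz'-m} / m!, which is (1 - q²)^{-zz'} (q/(1 - q²))^m /
m!. -/
theorem expOp_opD_mul_expOp_opU_vacuumEq (z z' : ℂ) :
    VacuumEq (expOp X (opD z') * expOp X (opU z))
      (scalarSeries (Module.End ℂ Wedge) (negBinomial (z * z')) *
        expOp (-raiseExponent) (opU z)) := by
  intro n
  have hr := coeff_scalarSeries_mul_expOp (A := Module.End ℂ Wedge) (negBinomial (z * z'))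
    (a := -raiseExponent) (by simp) (opU z) n
  refine Eq.trans ?_ (congr_arg (fun F : Module.End ℂ Wedge => F vacuum) hr).symm
  rw [coeff_mul, LinearMap.sum_apply, LinearMap.sum_apply]
  simp only [negBinomial_mul_pow]
  -- A pair (i, j) with i ≤ j and i + j = n corresponds to m = j - i, which has the parity of n. All
  -- else is zero: for i > j the power D^i kills U^j v, and for m of the other parity a coefficient
  -- of the even series `negBinomial` vanishes.
  rw [← Finset.sum_filter_add_sum_filter_not _ (fun x : ℕ × ℕ => x.1 ≤ x.2),
    ← Finset.sum_filter_add_sum_filter_not (Finset.range (n + 1)) (fun m => Even (n - m))]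
  congr 1
  · refine Finset.sum_nbij' (fun x => x.2 - x.1) (fun m => ((n - m) / 2, (n + m) / 2)) ?_ ?_ ?_ ?_ ?_
    · intro x hx
      simp only [Finset.mem_filter, Finset.HasAntidiagonal.mem_antidiagonal,
        Finset.mem_range] at hx ⊢
      refine ⟨by omega, ⟨x.1, by omega⟩⟩
    · rintro m hm
      simp only [Finset.mem_filter, Finset.HasAntidiagonal.mem_antidiagonal,
        Finset.mem_range] at hm ⊢
      obtain ⟨h, r, hr⟩ := hm
      omega
    · rintro ⟨i, j⟩ hx
      simp only [Finset.mem_filter, Finset.HasAntidiagonal.mem_antidiagonal, Prod.mk.injEq] at hx ⊢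
      omega
    · rintro m hm
      simp only [Finset.mem_filter, Finset.mem_range] at hm ⊢
      obtain ⟨h, r, hr⟩ := hm
      omega
    · rintro ⟨i, j⟩ hx
      simp only [Finset.mem_filter, Finset.HasAntidiagonal.mem_antidiagonal] at hx ⊢
      obtain ⟨rfl, h⟩ := hx
      obtain ⟨m, rfl⟩ := Nat.exists_eq_add_of_le h
      rw [coeff_X_pow_mul', if_pos (by omega), show i + (i + m) - (i + m - i) = 2 * i by omega,
        coeff_negBinomial_two_mul, add_tsub_cancel_left, coeff_expOp_X_wedge, coeff_expOp_X_wedge,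
        smul_mul_smul_comm, LinearMap.smul_apply,
        Module.End.mul_apply, opD_pow_opU_pow_vacuum, LinearMap.smul_apply, smul_smul]
      congr 1
      have h1 : (i ! : ℂ) ≠ 0 := Nat.cast_ne_zero.mpr (Nat.factorial_ne_zero i)
      have h2 : (m ! : ℂ) ≠ 0 := Nat.cast_ne_zero.mpr (Nat.factorial_ne_zero m)
      have h3 : ((i + m) ! : ℂ) ≠ 0 := Nat.cast_ne_zero.mpr (Nat.factorial_ne_zero _)
      field_simp
  · rw [Finset.sum_eq_zero, Finset.sum_eq_zero]
    · intro m hm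
      simp only [Finset.mem_filter, Finset.mem_range] at hm
      rw [coeff_X_pow_mul', if_pos (by omega), coeff_negBinomial_of_odd _ hm.2, mul_zero,
        zero_smul]
      rfl
    · intro x hx
      simp only [Finset.mem_filter, not_le] at hx
      rw [coeff_expOp_X_wedge, coeff_expOp_X_wedge, smul_mul_smul_comm,
        LinearMap.smul_apply, Module.End.mul_apply,
        opD_pow_opU_pow_vacuum_of_lt _ _ hx.2, smul_zero]

/-- Multiply the preceding identity on the left by (1 - q²)^{zz'} e^{-qD}. The exponent q/(q² - 1)
in G is the one for which G⁻¹ v becomes a multiple of e^{qU} v. -/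
theorem opGInv_vacuumEq (z z' : ℂ) : VacuumEq (opGInv z z')
    (scalarSeries (Module.End ℂ Wedge) (negBinomial (-(z * z'))) * expOp X (opU z)) := by
  set ι := scalarSeries (Module.End ℂ Wedge)
  have h := (expOp_opD_mul_expOp_opU_vacuumEq z z').mul_left
    (ι (negBinomial (-(z * z'))) * expOp (-X) (opD z'))
  have e1 : ι (negBinomial (-(z * z'))) * expOp (-X) (opD z') *
      (expOp X (opD z') * expOp X (opU z)) = ι (negBinomial (-(z * z'))) * expOp X (opU z) := by
    have := expOp_neg_mul_expOp (A := Module.End ℂ Wedge) constantCoeff_X (opD z')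
    rw [mul_assoc, ← mul_assoc (expOp (-X) (opD z')), this, one_mul]
  have e2 : ι (negBinomial (-(z * z'))) * expOp (-X) (opD z') *
      (ι (negBinomial (z * z')) * expOp (-raiseExponent) (opU z)) = opGInv z z' := by
    rw [opGInv, mul_assoc, ← mul_assoc (expOp (-X) (opD z')), ← scalarSeries_comm, ← mul_assoc,
      ← mul_assoc, ← map_mul, negBinomial_neg_mul, map_one, one_mul]
  rw [e1, e2] at h
  exact fun n => (h n).symm

/-- Vacuum expectations of operators conjugated by `G`. -/
theorem vacuumExpectation_conj_opG (z z' : ℂ) (F : OpSeries) :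
    vacuumExpectation (opG z z' * F * Ring.inverse (opG z z')) =
      negBinomial (-(z * z')) *
        vacuumExpectation (expOp X (opD z') * F * expOp X (opU z)) := by
  rw [inverse_opG, opG_eq, mul_assoc, mul_assoc,
    vacuumExpectation_expOp_opU_mul, ← mul_assoc,
    ((opGInv_vacuumEq z z').mul_left _).vacuumExpectation_eq, ← mul_assoc, ← scalarSeries_comm,
    mul_assoc, vacuumExpectation_eq, vacuumExpectation_eq]
  exact seriesFunctional_scalarSeries_mul (A := Module.End ℂ Wedge) _ _ _

theorem conj_list_prod {M : Type*} [Monoid M] {g h : M} (hg : g * h = 1) (hh : h * g = 1)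
    (l : List M) : (l.map fun x => g * x * h).prod = g * l.prod * h := by
  induction l with
  | nil => simp [hg]
  | cons x l ih =>
    rw [List.map_cons, List.prod_cons, List.prod_cons, ih]
    simp only [mul_assoc]
    rw [← mul_assoc h g, hh, one_mul]

/-- The operator `ψ_{x₀} ⋯ ψ_{x_{s-1}} ψ*_{x_{s-1}} ⋯ ψ*_{x₀}`. -/
def occupation {s : ℕ} (x : Fin s → ℤ) : Module.End ℂ Wedge :=
  (List.ofFn fun i => psi (x i)).prod * (List.ofFn fun i => psiStar (x i)).reverse.prod

/-- Conjugation by G is multiplicative, so the product of the Ψ and Ψ* in Wick's theorem is the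
conjugate of `occupation x`. -/
theorem det_kernelSeries (z z' : ℂ) {s : ℕ} (x : Fin s → ℤ) :
    (Matrix.of fun i j => kernelSeries z z' (x i) (x j)).det = negBinomial (-(z * z')) *
      vacuumExpectation (expOp X (opD z') * PowerSeries.C (occupation x) * expOp X (opU z)) := by
  have h := vacuumExpectation_wick (fun i => Psi z z' (x i)) (fun i => PsiStar z z' (x i))
    (fun i n => coeff_Psi_mem z z' (x i) n) fun i n => coeff_PsiStar_mem z z' (x i) n
  have e : ∀ l : List (Module.End ℂ Wedge),
      (l.map fun y => opG z z' * PowerSeries.C y * Ring.inverse (opG z z')).prod =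
        opG z z' * PowerSeries.C l.prod * Ring.inverse (opG z z') := by
    intro l
    have := conj_list_prod (M := OpSeries) (opG_mul_opGInv z z') (opGInv_mul_opG z z')
      (l.map PowerSeries.C)
    rw [List.map_map] at this
    rw [inverse_opG, map_list_prod]
    exact this
  have e1 : (List.ofFn fun i => Psi z z' (x i)) = (List.ofFn fun i => psi (x i)).map
      fun y => opG z z' * PowerSeries.C y * Ring.inverse (opG z z') := by
    rw [List.map_ofFn]
    rfl
  have e2 : (List.ofFn fun i => PsiStar z z' (x i)) = (List.ofFn fun i => psiStar (x i)).map
      fun y => opG z z' * PowerSeries.C y * Ring.inverse (opG z z') := by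
    rw [List.map_ofFn]
    rfl
  rw [← vacuumExpectation_conj_opG, occupation]
  refine h.symm.trans ?_
  rw [e1, e2, ← List.map_reverse, e, e, inverse_opG, map_mul]
  congr 1
  have := opGInv_mul_opG z z'
  simp only [mul_assoc]
  rw [← mul_assoc (opGInv z z') (opG z z'), this, one_mul]

theorem kernelSeries_eq (z z' : ℂ) (i j : ℤ) :
    kernelSeries z z' i j = negBinomial (-(z * z')) *
      vacuumExpectation (expOp X (opD z') * PowerSeries.C (psi i * psiStar j) *
        expOp X (opU z)) := by
  rw [← vacuumExpectation_conj_opG, kernelSeries, Psi, PsiStar, inverse_opG, map_mul]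
  congr 1
  have := opGInv_mul_opG z z'
  simp only [mul_assoc]
  rw [← mul_assoc (opGInv z z') (opG z z'), this, one_mul]

theorem coeff_vacuumExpectation_sandwich (z z' : ℂ) (T : Module.End ℂ Wedge) (n : ℕ) :
    coeff n (vacuumExpectation (expOp X (opD z') * PowerSeries.C T * expOp X (opU z))) =
      ∑ x ∈ Finset.HasAntidiagonal.antidiagonal n,
        (x.1 ! : ℂ)⁻¹ * ((opD z' ^ x.1) (T ((x.2 ! : ℂ)⁻¹ • (opU z ^ x.2) vacuum))) Maya.empty := by
  rw [vacuumExpectation_eq, coeff_seriesFunctional, coeff_mul, map_sum]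
  refine Finset.sum_congr rfl fun x _ => ?_
  rw [coeff_mul_C, coeff_expOp_X_wedge, coeff_expOp_X_wedge, smul_mul_assoc, smul_mul_assoc, map_smul,
    smul_eq_mul]
  rfl

end ZMeasure

end

noncomputable section

namespace ZMeasure

/-! ### An interpolation identity -/

section Interpolation

open Polynomial

variable {ι : Type*} [DecidableEq ι]

/-- The difference `X ∏ (X - 1 - vᵢ) - (X - m) ∏ (X - vᵢ)` has degree less than `m`, and its
coefficient at `X^(m-1)` is `m (m - 1) / 2 - ∑ vᵢ`. -/
theorem shifted_nodal_sub (s : Finset ι) (v : ι → ℂ) :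
    ∃ E : ℂ[X], X * ∏ i ∈ s, (X - C (v i + 1)) = (X - C (s.card : ℂ)) * ∏ i ∈ s, (X - C (v i)) + E ∧
      E.degree < s.card ∧
      (X * E).coeff s.card = (s.card : ℂ) * (s.card - 1) / 2 - ∑ i ∈ s, v i := by
  induction s using Finset.induction_on with
  | empty => exact ⟨0, by simp, by simp, by simp⟩
  | insert w s hw ih =>
    obtain ⟨E, h1, h2, h3⟩ := ih
    have hm : (∏ i ∈ s, (X - C (v i))).Monic := monic_prod_of_monic _ _ fun i _ => monic_X_sub_C _
    have hd : (∏ i ∈ s, (X - C (v i))).natDegree = s.card := by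
      rw [natDegree_prod_of_monic _ _ fun i _ => monic_X_sub_C _]
      simp
    -- With m = `s.card`, the witness comes from (X - m)(X - v_w - 1) = (X - m - 1)(X - v_w) + (m -
    -- v_w).
    refine ⟨(X - C (v w + 1)) * E + C ((s.card : ℂ) - v w) * ∏ i ∈ s, (X - C (v i)), ?_, ?_, ?_⟩
    · rw [Finset.prod_insert hw, Finset.prod_insert hw, Finset.card_insert_of_notMem hw]
      push_cast
      simp only [map_sub, map_add, map_one] at h1 ⊢
      linear_combination (X - C (v w) - 1) * h1
    · rw [Finset.card_insert_of_notMem hw]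
      refine (degree_add_le _ _).trans_lt (max_lt ?_ ?_)
      · rw [degree_mul, degree_X_sub_C, Nat.cast_add, Nat.cast_one, add_comm (s.card : WithBot ℕ)]
        exact WithBot.add_lt_add_left (by simp) h2
      · refine (degree_le_of_natDegree_le (natDegree_C_mul_le _ _)).trans_lt ?_
        rw [hd]
        exact_mod_cast Nat.lt_succ_self _
    · rw [Finset.card_insert_of_notMem hw, coeff_X_mul, coeff_add, coeff_C_mul, sub_mul, coeff_sub,
        h3, coeff_C_mul, coeff_eq_zero_of_degree_lt h2, Finset.sum_insert hw]
      have : (∏ i ∈ s, (X - C (v i))).coeff s.card = 1 := by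
        rw [← hd]
        exact hm
      rw [this]
      push_cast
      ring

/-- Lagrange interpolation at the v_i expresses the coefficient of X^(m-1) in E, where m is the
number of nodes, as the sum of E(v_i) / ∏_{j ≠ i} (v_i - v_j). Here E(v_i) = v_i ∏_j (v_i - 1 -
v_j), whose factor j = i is -1. -/
theorem sum_mul_prod_shift (s : Finset ι) {v : ι → ℂ} (hv : Set.InjOn v s) :
    ∑ i ∈ s, v i * ∏ j ∈ s.erase i, (v i - 1 - v j) / (v i - v j) =
      ∑ i ∈ s, v i - (s.card : ℂ) * (s.card - 1) / 2 := by
  rcases s.eq_empty_or_nonempty with rfl | hs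
  · simp
  obtain ⟨E, h1, h2, h3⟩ := shifted_nodal_sub s v
  have h4 := Lagrange.coeff_eq_sum hv h2
  obtain ⟨m, hm⟩ := Nat.exists_eq_succ_of_ne_zero (Finset.card_pos.mpr hs).ne'
  have h5 : E.coeff (s.card - 1) = (X * E).coeff s.card := by
    rw [hm, coeff_X_mul, Nat.succ_sub_one]
  rw [← h5, h4] at h3
  rw [← neg_inj, neg_sub, ← h3, ← Finset.sum_neg_distrib]
  refine Finset.sum_congr rfl fun i hi => ?_
  have h6 := congr_arg (eval (v i)) h1
  have h7 : ∏ j ∈ s, eval (v i) (X - C (v j)) = 0 := Finset.prod_eq_zero hi (by simp)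
  rw [eval_mul, eval_add, eval_mul, eval_prod, eval_prod, h7, mul_zero, zero_add] at h6
  rw [← h6, ← Finset.mul_prod_erase _ _ hi, Finset.prod_div_distrib]
  simp only [eval_sub, eval_X, eval_C]
  have : ∀ j, v i - (v j + 1) = v i - 1 - v j := fun j => by ring
  simp only [this]
  ring

end Interpolation

/-! ### Young diagrams as sets of half-integers -/

section Young

variable (lam : YoungDiagram)

/-- The element of `𝔖(lam)` that corresponds to row `i`. -/
def rowPos (i : ℕ) : ℤ := (lam.rowLen i : ℤ) - (i : ℤ) - 1

/-- The element of the complement of `𝔖(lam)` that corresponds to column `j`. -/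
def colPos (j : ℕ) : ℤ := (j : ℤ) - (lam.colLen j : ℤ)

theorem rowPos_strictAnti : StrictAnti (rowPos lam) := fun i k h => by
  have := lam.rowLen_anti i k h.le
  simp only [rowPos]
  omega

theorem colPos_strictMono : StrictMono (colPos lam) := fun i k h => by
  have := lam.colLen_anti i k h.le
  simp only [colPos]
  omega

theorem lt_rowLen_iff (i j : ℕ) : j < lam.rowLen i ↔ i < lam.colLen j := by
  rw [← YoungDiagram.mem_iff_lt_rowLen, YoungDiagram.mem_iff_lt_colLen]

theorem colPos_lt_rowPos_iff (i j : ℕ) : colPos lam j < rowPos lam i ↔ (i, j) ∈ lam := by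
  have h := lt_rowLen_iff lam i j
  rw [YoungDiagram.mem_iff_lt_rowLen]
  simp only [rowPos, colPos]
  omega

theorem rowPos_ne_colPos (i j : ℕ) : rowPos lam i ≠ colPos lam j := by
  have h := lt_rowLen_iff lam i j
  simp only [rowPos, colPos]
  omega

/-- Each unit step of the boundary path of the diagram ends a row or a column, and the steps are
indexed by the half-integers. -/
theorem exists_rowPos_or_colPos (n : ℤ) : (∃ i, rowPos lam i = n) ∨ ∃ j, colPos lam j = n := by
  have hex : ∃ i, rowPos lam i ≤ n := by
    refine ⟨(lam.rowLen 0 + n.natAbs : ℕ), ?_⟩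
    have := lam.rowLen_anti 0 (lam.rowLen 0 + n.natAbs) (Nat.zero_le _)
    simp only [rowPos]
    omega
  classical
  have h1 := Nat.find_spec hex
  have h2 : ∀ k, k < Nat.find hex → ¬ rowPos lam k ≤ n := fun k hk => Nat.find_min hex hk
  set i := Nat.find hex
  rcases h1.eq_or_lt with h | h
  · exact Or.inl ⟨i, h⟩
  right
  have h3 : (lam.rowLen i : ℤ) ≤ n + i := by
    simp only [rowPos] at h
    omega
  -- Rows before i reach beyond column n + i and row i does not, so this column has exactly i boxes.
  obtain ⟨j, hj⟩ : ∃ j : ℕ, (j : ℤ) = n + i := ⟨(n + i).toNat, by omega⟩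
  refine ⟨j, ?_⟩
  have h4 := lt_rowLen_iff lam i j
  have h5 : i = 0 ∨ i - 1 < lam.colLen j := by
    rcases Nat.eq_zero_or_pos i with h0 | h0
    · exact Or.inl h0
    · right
      rw [← lt_rowLen_iff]
      have := h2 (i - 1) (by omega)
      simp only [rowPos] at this
      omega
  simp only [colPos]
  omega

theorem rowLen_eq_zero_of_le {i : ℕ} (h : lam.colLen 0 ≤ i) : lam.rowLen i = 0 := by
  have := lt_rowLen_iff lam i 0
  omega

theorem rowPos_ge (i : ℕ) : -(i : ℤ) - 1 ≤ rowPos lam i := by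
  simp only [rowPos]
  omega

theorem colPos_ge (j : ℕ) : -(lam.colLen 0 : ℤ) ≤ colPos lam j := by
  have := lam.colLen_anti 0 j (Nat.zero_le _)
  simp only [colPos]
  omega

theorem hookLength_eq (i j : ℕ) : hookLength lam (i, j) = rowPos lam i - colPos lam j := by
  simp only [hookLength, rowPos, colPos]
  ring

theorem hookLength_pos {s : ℕ × ℕ} (hs : s ∈ lam) : 0 < hookLength lam s := by
  obtain ⟨i, j⟩ := s
  rw [hookLength_eq]
  exact sub_pos.mpr ((colPos_lt_rowPos_iff lam i j).mpr hs)

/-- The product of the hook lengths. -/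
def hookProd : ℂ := ∏ s ∈ lam.cells, (hookLength lam s : ℂ)

theorem hookProd_ne_zero : hookProd lam ≠ 0 :=
  Finset.prod_ne_zero_iff.mpr fun _ hs => Int.cast_ne_zero.mpr (hookLength_pos lam hs).ne'

/-- The elements below `rowPos i` are the complement elements hooked to row `i` and the
`rowPos k`, `k > i`. -/
theorem prod_hook_row {N : ℕ} (hN : lam.colLen 0 ≤ N) (i : ℕ) :
    ∏ t ∈ Finset.Ico (-(N : ℤ)) (rowPos lam i), ((rowPos lam i : ℂ) - (t : ℂ)) =
      (∏ j ∈ Finset.range (lam.rowLen i), (hookLength lam (i, j) : ℂ)) *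
        ∏ k ∈ Finset.Ioo i N, ((rowPos lam i : ℂ) - (rowPos lam k : ℂ)) := by
  have hU : Finset.Ico (-(N : ℤ)) (rowPos lam i) =
      (Finset.range (lam.rowLen i)).image (colPos lam) ∪ (Finset.Ioo i N).image (rowPos lam) := by
    ext t
    simp only [Finset.mem_Ico, Finset.mem_union, Finset.mem_image, Finset.mem_range,
      Finset.mem_Ioo]
    constructor
    · rintro ⟨h1, h2⟩
      rcases exists_rowPos_or_colPos lam t with ⟨k, rfl⟩ | ⟨j, rfl⟩
      · right
        refine ⟨k, ⟨(rowPos_strictAnti lam).lt_iff_gt.mp h2, ?_⟩, rfl⟩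
        by_contra hk
        have := rowLen_eq_zero_of_le lam (hN.trans (not_lt.mp hk))
        simp only [rowPos] at h1
        omega
      · left
        exact ⟨j, YoungDiagram.mem_iff_lt_rowLen.mp ((colPos_lt_rowPos_iff lam i j).mp h2), rfl⟩
    · rintro (⟨j, hj, rfl⟩ | ⟨k, hk, rfl⟩)
      · refine ⟨?_, (colPos_lt_rowPos_iff lam i j).mpr (YoungDiagram.mem_iff_lt_rowLen.mpr hj)⟩
        have := colPos_ge lam j
        omega
      · refine ⟨?_, rowPos_strictAnti lam hk.1⟩
        have := rowPos_ge lam k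
        omega
  have hdisj : Disjoint ((Finset.range (lam.rowLen i)).image (colPos lam))
      ((Finset.Ioo i N).image (rowPos lam)) := by
    rw [Finset.disjoint_left]
    intro t h1 h2
    obtain ⟨j, -, rfl⟩ := Finset.mem_image.mp h1
    obtain ⟨k, -, h⟩ := Finset.mem_image.mp h2
    exact rowPos_ne_colPos lam k j h
  rw [hU, Finset.prod_union hdisj,
    Finset.prod_image (colPos_strictMono lam).injective.injOn,
    Finset.prod_image (rowPos_strictAnti lam).injective.injOn]
  congr 1
  refine Finset.prod_congr rfl fun j _ => ?_
  rw [hookLength_eq]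
  push_cast
  rfl

theorem prod_cells {N : ℕ} (hN : lam.colLen 0 ≤ N) (f : ℕ × ℕ → ℂ) :
    ∏ s ∈ lam.cells, f s = ∏ i ∈ Finset.range N, ∏ j ∈ Finset.range (lam.rowLen i), f (i, j) := by
  refine Finset.prod_finset_product _ _ _ fun p => ?_
  obtain ⟨i, j⟩ := p
  rw [YoungDiagram.mem_cells, YoungDiagram.mem_iff_lt_rowLen, Finset.mem_range, Finset.mem_range]
  refine ⟨fun h => ⟨?_, h⟩, fun h => h.2⟩
  by_contra hi
  change ¬ i < N at hi
  have := rowLen_eq_zero_of_le lam (hN.trans (not_lt.mp hi))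
  omega

theorem prod_Ico_sub (a : ℤ) (n : ℕ) :
    ∏ t ∈ Finset.Ico a (a + n), (((a + n : ℤ) : ℂ) - (t : ℂ)) = (n ! : ℂ) := by
  have hU : Finset.Ico a (a + n) = (Finset.range n).image fun m : ℕ => a + n - 1 - (m : ℤ) := by
    ext t
    simp only [Finset.mem_Ico, Finset.mem_image, Finset.mem_range]
    constructor
    · rintro ⟨h1, h2⟩
      exact ⟨(a + n - 1 - t).toNat, by omega, by omega⟩
    · rintro ⟨m, hm, rfl⟩
      omega
  rw [hU, Finset.prod_image fun x _ y _ h => by simpa using h, ← Finset.prod_range_add_one_eq_factorial]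
  push_cast
  refine Finset.prod_congr rfl fun m _ => ?_
  ring

/-- The product over the pairs of rows that enters the hook length formula. -/
def rowVandermonde (N : ℕ) : ℂ :=
  ∏ i ∈ Finset.range N, ∏ k ∈ Finset.Ioo i N, ((rowPos lam i : ℂ) - (rowPos lam k : ℂ))

theorem rowPos_sub_ne_zero {i k : ℕ} (h : i ≠ k) : (rowPos lam i : ℂ) - (rowPos lam k : ℂ) ≠ 0 :=
  sub_ne_zero.mpr fun e => h ((rowPos_strictAnti lam).injective (Int.cast_injective e))

theorem rowVandermonde_ne_zero (N : ℕ) : rowVandermonde lam N ≠ 0 :=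
  Finset.prod_ne_zero_iff.mpr fun _ _ => Finset.prod_ne_zero_iff.mpr fun _ hk =>
    rowPos_sub_ne_zero lam (Finset.mem_Ioo.mp hk).1.ne

/-- With l_i = `rowPos lam i + N`, the numbers 1, …, l_i are the hooks of row i together with the
differences l_i - l_k for i < k < N. This is the classical ∏ l_i! = H · ∏_{i<k} (l_i - l_k). -/
theorem prod_factorial_eq {N : ℕ} (hN : lam.colLen 0 ≤ N) :
    ∏ i ∈ Finset.range N, (((rowPos lam i + N).toNat ! : ℕ) : ℂ) =
      hookProd lam * rowVandermonde lam N := by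
  rw [hookProd, prod_cells lam hN, rowVandermonde, ← Finset.prod_mul_distrib]
  refine Finset.prod_congr rfl fun i hi => ?_
  have hi' := Finset.mem_range.mp hi
  rw [← prod_hook_row lam hN i]
  have h1 := rowPos_ge lam i
  have h2 := prod_Ico_sub (-(N : ℤ)) (rowPos lam i + N).toNat
  rw [show -(N : ℤ) + ((rowPos lam i + N).toNat : ℤ) = rowPos lam i by omega] at h2
  exact h2.symm

end Young

/-! ### Adding and removing boxes -/

section Boxes

/-- `lam` is obtained from `mu` by adding a box at the end of row `i`. -/
def BoxStep (mu lam : YoungDiagram) (i : ℕ) : Prop :=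
  lam.rowLen = Function.update mu.rowLen i (mu.rowLen i + 1)

theorem rowLen_injective : Function.Injective YoungDiagram.rowLen := by
  intro mu lam h
  ext ⟨i, j⟩
  rw [YoungDiagram.mem_cells, YoungDiagram.mem_cells, YoungDiagram.mem_iff_lt_rowLen,
    YoungDiagram.mem_iff_lt_rowLen, h]

/-- The diagram with row lengths `r`, if `r` is antitone and `r N = 0`. -/
def ofRows (r : ℕ → ℕ) (N : ℕ) : YoungDiagram where
  cells := (Finset.range N ×ˢ Finset.range (r 0)).filter fun c => ∀ a ≤ c.1, c.2 < r a
  isLowerSet := by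
    rintro ⟨a, b⟩ ⟨a', b'⟩ ⟨h1, h2⟩ h
    simp only [Finset.coe_filter, Finset.mem_product, Finset.mem_range, Set.mem_ofPred_eq] at h ⊢
    simp only at h1 h2
    exact ⟨⟨by omega, by omega⟩, fun c hc => by have := h.2 c (by omega); omega⟩

theorem rowLen_ofRows {r : ℕ → ℕ} (hr : Antitone r) {N : ℕ} (hN : r N = 0) :
    (ofRows r N).rowLen = r := by
  funext i
  refine eq_of_forall_lt_iff fun j => ?_
  rw [← YoungDiagram.mem_iff_lt_rowLen]
  change (i, j) ∈ Finset.filter _ _ ↔ _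
  simp only [Finset.mem_filter, Finset.mem_product, Finset.mem_range]
  constructor
  · exact fun h => h.2 i le_rfl
  · intro h
    refine ⟨⟨?_, h.trans_le (hr (Nat.zero_le _))⟩, fun a ha => h.trans_le (hr ha)⟩
    by_contra hi
    have := hr (not_lt.mp hi)
    omega

theorem exists_add_box (mu : YoungDiagram) {i : ℕ}
    (h : ∀ k < i, mu.rowLen i < mu.rowLen k) : ∃ lam, BoxStep mu lam i := by
  refine ⟨ofRows (Function.update mu.rowLen i (mu.rowLen i + 1)) (mu.colLen 0 + i + 1),
    rowLen_ofRows ?_ ?_⟩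
  · intro a b hab
    have h1 := mu.rowLen_anti a b hab
    have h2 := h a
    simp only [Function.update_apply]
    split_ifs with hb ha ha
    · rfl
    · subst hb
      have := h2 (by omega)
      omega
    · subst ha
      omega
    · exact h1
  · rw [Function.update_of_ne (by omega)]
    exact rowLen_eq_zero_of_le mu (by omega)

theorem exists_remove_box (lam : YoungDiagram) {i : ℕ} (h : lam.rowLen (i + 1) < lam.rowLen i) :
    ∃ mu, BoxStep mu lam i := by
  refine ⟨ofRows (Function.update lam.rowLen i (lam.rowLen i - 1)) (lam.colLen 0 + i + 1), ?_⟩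
  rw [BoxStep, rowLen_ofRows]
  · funext k
    by_cases hk : k = i
    · subst hk
      simp only [Function.update_self]
      omega
    · simp [Function.update_of_ne hk]
  · intro a b hab
    have h1 := lam.rowLen_anti a b hab
    have h2 : i < b → lam.rowLen b ≤ lam.rowLen (i + 1) := fun hb => lam.rowLen_anti _ _ hb
    simp only [Function.update_apply]
    split_ifs with hb ha ha
    · rfl
    · subst hb
      omega
    · subst ha
      have := h2 (by omega)
      omega
    · exact h1
  · rw [Function.update_of_ne (by omega)]
    exact rowLen_eq_zero_of_le lam (by omega)

variable {mu lam : YoungDiagram} {i : ℕ}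

theorem BoxStep.rowLen_self (h : BoxStep mu lam i) : lam.rowLen i = mu.rowLen i + 1 := by
  rw [h, Function.update_self]

theorem BoxStep.rowLen_of_ne (h : BoxStep mu lam i) {k : ℕ} (hk : k ≠ i) :
    lam.rowLen k = mu.rowLen k := by
  rw [h, Function.update_of_ne hk]

theorem BoxStep.rowPos_self (h : BoxStep mu lam i) : rowPos lam i = rowPos mu i + 1 := by
  simp only [rowPos, h.rowLen_self]
  push_cast
  ring

theorem BoxStep.rowPos_of_ne (h : BoxStep mu lam i) {k : ℕ} (hk : k ≠ i) :
    rowPos lam k = rowPos mu k := by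
  simp only [rowPos, h.rowLen_of_ne hk]

theorem BoxStep.cells_eq (h : BoxStep mu lam i) : lam.cells = insert (i, mu.rowLen i) mu.cells := by
  ext ⟨a, b⟩
  rw [Finset.mem_insert, YoungDiagram.mem_cells, YoungDiagram.mem_cells,
    YoungDiagram.mem_iff_lt_rowLen, YoungDiagram.mem_iff_lt_rowLen, Prod.mk.injEq]
  by_cases ha : a = i
  · subst ha
    rw [h.rowLen_self]
    omega
  · rw [h.rowLen_of_ne ha]
    simp [ha]

theorem notMem_cells_rowLen (mu : YoungDiagram) (i : ℕ) : (i, mu.rowLen i) ∉ mu.cells := by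
  rw [YoungDiagram.mem_cells, YoungDiagram.mem_iff_lt_rowLen]
  exact lt_irrefl _

theorem BoxStep.card_eq (h : BoxStep mu lam i) : lam.card = mu.card + 1 := by
  rw [YoungDiagram.card, h.cells_eq, Finset.card_insert_of_notMem (notMem_cells_rowLen mu i)]

theorem BoxStep.lt_colLen (h : BoxStep mu lam i) : i < lam.colLen 0 := by
  rw [← lt_rowLen_iff, h.rowLen_self]
  omega

theorem BoxStep.colLen_le (h : BoxStep mu lam i) : mu.colLen 0 ≤ lam.colLen 0 := by
  by_contra hc
  have h1 := lt_rowLen_iff mu (lam.colLen 0) 0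
  have h2 := rowLen_eq_zero_of_le lam le_rfl
  rw [h.rowLen_of_ne h.lt_colLen.ne'] at h2
  omega

/-- The ratio of hook products when a box is added. -/
theorem BoxStep.inv_hookProd (h : BoxStep mu lam i) {N : ℕ} (hN : lam.colLen 0 ≤ N) :
    (hookProd mu)⁻¹ = (hookProd lam)⁻¹ * (((rowPos lam i : ℂ) + N) *
      ∏ k ∈ (Finset.range N).erase i, (((rowPos lam i : ℂ) - 1 - (rowPos lam k : ℂ)) /
        ((rowPos lam i : ℂ) - (rowPos lam k : ℂ)))) := by
  have hiN : i < N := h.lt_colLen.trans_le hN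
  have e1 := prod_factorial_eq lam hN
  have e2 := prod_factorial_eq mu (h.colLen_le.trans hN)
  -- factorials
  have e3 : ∏ k ∈ Finset.range N, (((rowPos lam k + N).toNat ! : ℕ) : ℂ) =
      ((rowPos lam i : ℂ) + N) * ∏ k ∈ Finset.range N, (((rowPos mu k + N).toNat ! : ℕ) : ℂ) := by
    rw [← Finset.mul_prod_erase _ _ (Finset.mem_range.mpr hiN),
      ← Finset.mul_prod_erase (Finset.range N) (fun k => (((rowPos mu k + N).toNat ! : ℕ) : ℂ))
        (Finset.mem_range.mpr hiN), ← mul_assoc]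
    congr 1
    · have h1 := rowPos_ge mu i
      rw [h.rowPos_self, show (rowPos mu i + 1 + N).toNat = (rowPos mu i + N).toNat + 1 by omega,
        Nat.factorial_succ, Nat.cast_mul]
      congr 1
      have h2 : (((rowPos mu i + N).toNat : ℤ) : ℂ) = ((rowPos mu i + N : ℤ) : ℂ) := by
        congr 1
        omega
      push_cast at h2 ⊢
      rw [h2]
      ring
    · refine Finset.prod_congr rfl fun k hk => ?_
      rw [h.rowPos_of_ne (Finset.ne_of_mem_erase hk)]
  -- Vandermonde products
  have e4 : rowVandermonde mu N = rowVandermonde lam N *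
      ∏ k ∈ (Finset.range N).erase i, (((rowPos lam i : ℂ) - 1 - (rowPos lam k : ℂ)) /
        ((rowPos lam i : ℂ) - (rowPos lam k : ℂ))) := by
    set R : ℕ → ℂ := fun k => ((rowPos lam i : ℂ) - 1 - (rowPos lam k : ℂ)) /
        ((rowPos lam i : ℂ) - (rowPos lam k : ℂ)) with hR
    -- Only the position of row i moves: row i changes in every factor, a row a < i only in its
    -- factor with i, and later rows not at all. The ratio for the pair {i, k} is R k on either
    -- side.
    have hrow : ∀ a ∈ Finset.range N,
        ∏ k ∈ Finset.Ioo a N, ((rowPos mu a : ℂ) - (rowPos mu k : ℂ)) =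
        (∏ k ∈ Finset.Ioo a N, ((rowPos lam a : ℂ) - (rowPos lam k : ℂ))) *
          (if a = i then ∏ k ∈ Finset.Ioo i N, R k else if a < i then R a else 1) := by
      intro a ha
      split_ifs with h1 h2
      · subst h1
        rw [← Finset.prod_mul_distrib]
        refine Finset.prod_congr rfl fun k hk => ?_
        have hk := (Finset.mem_Ioo.mp hk).1
        rw [hR, mul_div_cancel₀ _ (rowPos_sub_ne_zero lam hk.ne), h.rowPos_self,
          h.rowPos_of_ne hk.ne']
        push_cast
        ring
      · have hi : i ∈ Finset.Ioo a N := Finset.mem_Ioo.mpr ⟨h2, hiN⟩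
        rw [← Finset.mul_prod_erase _ _ hi, ← Finset.mul_prod_erase (Finset.Ioo a N)
          (fun k => (rowPos lam a : ℂ) - (rowPos lam k : ℂ)) hi, mul_right_comm]
        congr 1
        · have e1 := rowPos_sub_ne_zero lam h2.ne
          have e2 := rowPos_sub_ne_zero lam h2.ne'
          have e3 : (rowPos mu i : ℂ) = rowPos lam i - 1 := by
            rw [h.rowPos_self]
            push_cast
            ring
          rw [← h.rowPos_of_ne h2.ne, e3]
          simp only [hR]
          field_simp
          ring
        · refine Finset.prod_congr rfl fun k hk => ?_
          rw [h.rowPos_of_ne h1, h.rowPos_of_ne (Finset.ne_of_mem_erase hk)]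
      · rw [mul_one]
        refine Finset.prod_congr rfl fun k hk => ?_
        have hk := (Finset.mem_Ioo.mp hk).1
        rw [h.rowPos_of_ne h1, h.rowPos_of_ne (by omega)]
    rw [rowVandermonde, Finset.prod_congr rfl hrow, Finset.prod_mul_distrib, rowVandermonde]
    congr 1
    rw [← Finset.mul_prod_erase _ _ (Finset.mem_range.mpr hiN), if_pos rfl]
    have hsplit : (Finset.range N).erase i = Finset.Ioo i N ∪ Finset.range i := by
      ext k
      simp only [Finset.mem_erase, Finset.mem_range, Finset.mem_union, Finset.mem_Ioo]
      omega
    have hdisj : Disjoint (Finset.Ioo i N) (Finset.range i) := by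
      rw [Finset.disjoint_left]
      intro k hk hk'
      have := (Finset.mem_Ioo.mp hk).1
      have := Finset.mem_range.mp hk'
      omega
    rw [hsplit, Finset.prod_union hdisj, Finset.prod_union hdisj]
    have hone : ∏ x ∈ Finset.Ioo i N,
        (if x = i then ∏ k ∈ Finset.Ioo i N, R k else if x < i then R x else 1) = 1 := by
      refine Finset.prod_eq_one fun x hx => ?_
      have := (Finset.mem_Ioo.mp hx).1
      rw [if_neg (by omega), if_neg (by omega)]
    rw [hone, one_mul]
    congr 1
    refine Finset.prod_congr rfl fun x hx => ?_
    have := Finset.mem_range.mp hx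
    rw [if_neg (by omega), if_pos this]
  set Q := ∏ k ∈ (Finset.range N).erase i, (((rowPos lam i : ℂ) - 1 - (rowPos lam k : ℂ)) /
        ((rowPos lam i : ℂ) - (rowPos lam k : ℂ)))
  rw [e1, e2, e4] at e3
  have h1 := hookProd_ne_zero lam
  have h2 := hookProd_ne_zero mu
  have h3 := rowVandermonde_ne_zero lam N
  have e5 : hookProd lam = ((rowPos lam i : ℂ) + N) * (hookProd mu * Q) := by
    refine mul_right_cancel₀ h3 ?_
    rw [e3]
    ring
  field_simp
  rw [e5]
  ring

theorem sum_rowLen {lam : YoungDiagram} {N : ℕ} (hN : lam.colLen 0 ≤ N) :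
    ∑ i ∈ Finset.range N, lam.rowLen i = lam.card := by
  have h : lam.card = ∑ s ∈ lam.cells, 1 := by simp
  rw [h, Finset.sum_finset_product lam.cells (Finset.range N) fun i => Finset.range (lam.rowLen i)]
  · simp
  · rintro ⟨i, j⟩
    rw [YoungDiagram.mem_cells, YoungDiagram.mem_iff_lt_rowLen, Finset.mem_range, Finset.mem_range]
    refine ⟨fun h => ⟨?_, h⟩, fun h => h.2⟩
    by_contra hi
    change ¬ i < N at hi
    have := rowLen_eq_zero_of_le lam (hN.trans (not_lt.mp hi))
    omega

/-- The recursion `∑_{mu ↗ lam} 1 / H(mu) = |lam| / H(lam)` behind the hook length formula. -/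
theorem sum_inv_hookProd (lam : YoungDiagram) {N : ℕ} (hN : lam.colLen 0 ≤ N)
    (rem : ℕ → YoungDiagram)
    (hrem : ∀ i, lam.rowLen (i + 1) < lam.rowLen i → BoxStep (rem i) lam i) :
    ∑ i ∈ Finset.range N, (if lam.rowLen (i + 1) < lam.rowLen i then (hookProd (rem i))⁻¹ else 0) =
      (lam.card : ℂ) * (hookProd lam)⁻¹ := by
  -- Adding N does not change differences, and it makes the sum of the v i equal to |lam| + N(N -
  -- 1)/2, so the interpolation identity leaves |lam|.
  set v : ℕ → ℂ := fun i => (rowPos lam i : ℂ) + N with hv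
  have hinj : Set.InjOn v (Finset.range N : Finset ℕ) := fun i _ k _ h => by
    have : (rowPos lam i : ℂ) = rowPos lam k := add_right_cancel h
    exact (rowPos_strictAnti lam).injective (Int.cast_injective this)
  have hterm : ∀ i ∈ Finset.range N,
      (if lam.rowLen (i + 1) < lam.rowLen i then (hookProd (rem i))⁻¹ else 0) =
      (hookProd lam)⁻¹ * (v i * ∏ k ∈ (Finset.range N).erase i,
        (v i - 1 - v k) / (v i - v k)) := by
    intro i hi
    have hi' := Finset.mem_range.mp hi
    split_ifs with h
    · rw [(hrem i h).inv_hookProd hN]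
      congr 2
      refine Finset.prod_congr rfl fun k _ => ?_
      congr 1 <;> simp only [hv] <;> ring
    -- A row that cannot be shortened contributes zero to the full sum: the factor k = i + 1
    -- vanishes since v (i + 1) = v i - 1, or, if i is the last index, row i is empty and v i = 0.
    · have h' : lam.rowLen (i + 1) = lam.rowLen i :=
        le_antisymm (lam.rowLen_anti _ _ (Nat.le_succ i)) (not_lt.mp h)
      symm
      rw [mul_eq_zero]
      right
      by_cases hlast : i + 1 = N
      · have h0 : lam.rowLen (i + 1) = 0 := rowLen_eq_zero_of_le lam (hlast ▸ hN)
        rw [mul_eq_zero]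
        left
        simp only [hv, rowPos, ← h', h0, ← hlast]
        push_cast
        ring
      · rw [mul_eq_zero]
        right
        refine Finset.prod_eq_zero (i := i + 1) (by simp; omega) ?_
        rw [div_eq_zero_iff]
        left
        simp only [hv, rowPos, h']
        push_cast
        ring
  rw [Finset.sum_congr rfl hterm, ← Finset.mul_sum, sum_mul_prod_shift _ hinj, mul_comm]
  congr 1
  have hsum : ∑ i ∈ Finset.range N, v i = (lam.card : ℂ) + ∑ i ∈ Finset.range N, ((N : ℂ) - 1 - i) := by
    rw [← sum_rowLen hN, Nat.cast_sum, ← Finset.sum_add_distrib]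
    refine Finset.sum_congr rfl fun i _ => ?_
    simp only [hv, rowPos]
    push_cast
    ring
  have hgauss : ∀ N : ℕ, ∑ i ∈ Finset.range N, (i : ℂ) = (N : ℂ) * (N - 1) / 2 := by
    intro N
    induction N with
    | zero => simp
    | succ N ih =>
      rw [Finset.sum_range_succ, ih]
      push_cast
      ring
  rw [hsum, Finset.sum_sub_distrib, hgauss, Finset.card_range]
  simp
  ring

end Boxes

end ZMeasure

end

noncomputable section

namespace ZMeasure

/-! ### Diagrams in the infinite wedge -/

/-- `𝔖(lam)` as an element of the index set of the basis of the infinite wedge. -/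
def toMaya (lam : YoungDiagram) : Maya where
  carrier := frakS lam
  finite_pos := by
    refine ((Finset.range (lam.colLen 0)).image (rowPos lam)).finite_toSet.subset ?_
    rintro _ ⟨h, i, rfl⟩
    rw [Finset.mem_coe, Finset.mem_image]
    refine ⟨i, Finset.mem_range.mpr ?_, rfl⟩
    by_contra hi
    have := rowLen_eq_zero_of_le lam (not_lt.mp hi)
    simp only [this] at h
    omega
  finite_neg := by
    refine (Set.finite_Ico (-(lam.colLen 0 : ℤ)) 0).subset ?_
    rintro n ⟨h, hn⟩
    rcases exists_rowPos_or_colPos lam n with ⟨i, rfl⟩ | ⟨j, rfl⟩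
    · exact absurd ⟨i, rfl⟩ hn
    · exact ⟨colPos_ge lam j, h⟩

theorem mem_toMaya {lam : YoungDiagram} {n : ℤ} :
    n ∈ (toMaya lam).carrier ↔ ∃ i, rowPos lam i = n := Iff.rfl

theorem toMaya_injective : Function.Injective toMaya := by
  intro mu lam h
  have hr : Set.range (OrderDual.toDual ∘ rowPos mu) = Set.range (OrderDual.toDual ∘ rowPos lam) := by
    ext n
    have := Maya.ext_iff_mem.mp h (OrderDual.ofDual n)
    exact this
  have := ((rowPos_strictAnti mu).dual_right.range_inj (rowPos_strictAnti lam).dual_right).mp hr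
  refine rowLen_injective (funext fun i => ?_)
  have h2 : rowPos mu i = rowPos lam i := congr_fun this i
  simp only [rowPos] at h2
  omega

theorem BoxStep.toMaya_eq {mu lam : YoungDiagram} {i : ℕ} (h : BoxStep mu lam i) :
    toMaya mu = ((toMaya lam).erase (rowPos lam i)).insert (rowPos lam i - 1) := by
  rw [Maya.ext_iff_mem]
  intro n
  rw [Maya.mem_insert, Maya.mem_erase, mem_toMaya, mem_toMaya]
  constructor
  · rintro ⟨k, rfl⟩
    by_cases hk : k = i
    · subst hk
      left
      rw [h.rowPos_self]
      ring
    · right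
      rw [← h.rowPos_of_ne hk]
      exact ⟨⟨k, rfl⟩, (rowPos_strictAnti lam).injective.ne hk⟩
  · rintro (rfl | ⟨⟨k, rfl⟩, hk⟩)
    · exact ⟨i, by rw [h.rowPos_self]; ring⟩
    · exact ⟨k, (h.rowPos_of_ne fun e => hk (by rw [e])).symm⟩

theorem BoxStep.toMaya_eq' {mu lam : YoungDiagram} {i : ℕ} (h : BoxStep mu lam i) :
    toMaya lam = ((toMaya mu).erase (rowPos mu i)).insert (rowPos mu i + 1) := by
  rw [Maya.ext_iff_mem]
  intro n
  rw [Maya.mem_insert, Maya.mem_erase, mem_toMaya, mem_toMaya]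
  constructor
  · rintro ⟨k, rfl⟩
    by_cases hk : k = i
    · subst hk
      exact Or.inl h.rowPos_self
    · right
      rw [h.rowPos_of_ne hk]
      exact ⟨⟨k, rfl⟩, (rowPos_strictAnti mu).injective.ne hk⟩
  · rintro (rfl | ⟨⟨k, rfl⟩, hk⟩)
    · exact ⟨i, h.rowPos_self⟩
    · exact ⟨k, h.rowPos_of_ne fun e => hk (by rw [e])⟩

theorem removable_iff {lam : YoungDiagram} {i : ℕ} :
    lam.rowLen (i + 1) < lam.rowLen i ↔ rowPos lam i - 1 ∉ (toMaya lam).carrier := by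
  rw [mem_toMaya]
  constructor
  · rintro h ⟨k, hk⟩
    have h1 : i < k := (rowPos_strictAnti lam).lt_iff_gt.mp (by omega)
    have h2 := (rowPos_strictAnti lam).antitone (show i + 1 ≤ k from h1)
    simp only [rowPos] at h2 hk
    omega
  · intro h
    by_contra hi
    refine h ⟨i + 1, ?_⟩
    have := lam.rowLen_anti i (i + 1) (Nat.le_succ i)
    simp only [rowPos]
    omega

/-- If an earlier row were no longer than row i, row i - 1 would have the same length and would
occupy `rowPos mu i + 1`. -/
theorem addable_of_notMem {mu : YoungDiagram} {i : ℕ}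
    (h : rowPos mu i + 1 ∉ (toMaya mu).carrier) : ∀ k < i, mu.rowLen i < mu.rowLen k := by
  intro k hk
  have h1 := mu.rowLen_anti k (i - 1) (by omega)
  have h2 := mu.rowLen_anti (i - 1) i (by omega)
  by_contra hc
  refine h ⟨i - 1, ?_⟩
  simp only [rowPos]
  omega

/-- Moving a particle down by one. -/
theorem psi_psiStar_succ_delta (n : ℤ) {S : Maya} (h1 : n + 1 ∈ S.carrier) (h2 : n ∉ S.carrier) :
    psi n (psiStar (n + 1) (delta S)) = delta ((S.erase (n + 1)).insert n) := by
  classical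
  have h3 : n ∉ (S.erase (n + 1)).carrier := fun h => h2 h.1
  rw [psiStar_delta, if_pos h1, map_smul, psi_delta, if_neg h3]
  have h4 : (S.erase (n + 1)).numAbove n = S.numAbove (n + 1) := by
    unfold Maya.numAbove
    congr 1
    ext m
    simp only [Maya.mem_erase, Set.mem_ofPred_eq]
    constructor
    · rintro ⟨⟨h, h'⟩, h''⟩
      exact ⟨h, by omega⟩
    · rintro ⟨h, h'⟩
      exact ⟨⟨h, by omega⟩, by omega⟩
  rw [h4, neg_one_pow_smul_self]

theorem psi_psiStar_delta_eq_zero {m n : ℤ} {S : Maya} (hmn : m ≠ n)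
    (h : ¬ (n ∈ S.carrier ∧ m ∉ S.carrier)) : psi m (psiStar n (delta S)) = 0 := by
  by_cases h1 : n ∈ S.carrier
  · have h2 : m ∈ S.carrier := by
      by_contra h2
      exact h ⟨h1, h2⟩
    simp [psiStar_delta, psi_delta, h1, h2, hmn]
  · simp [psiStar_delta, h1]

theorem delta_apply_comm (S T : Maya) : delta S T = delta T S := by
  classical
  simp only [delta, Finsupp.single_apply, eq_comm]

open Classical in
/-- A diagram from which the last box of row `i` has been removed, if this is possible. -/
def removeBox (lam : YoungDiagram) (i : ℕ) : YoungDiagram :=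
  if h : lam.rowLen (i + 1) < lam.rowLen i then (exists_remove_box lam h).choose else lam

theorem boxStep_removeBox {lam : YoungDiagram} {i : ℕ} (h : lam.rowLen (i + 1) < lam.rowLen i) :
    BoxStep (removeBox lam i) lam i := by
  rw [removeBox, dif_pos h]
  exact (exists_remove_box lam h).choose_spec

/-- `D` lets one particle hop down to a vacant site, which removes the last box of a row. The
coefficient is z plus the content of that box. -/
theorem opD_delta_toMaya (z : ℂ) (lam : YoungDiagram) : opD z (delta (toMaya lam)) =
    ∑ i ∈ Finset.range (lam.colLen 0), if lam.rowLen (i + 1) < lam.rowLen i then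
      (z + (rowPos lam i : ℂ)) • delta (toMaya (removeBox lam i)) else 0 := by
  classical
  rw [opD_delta, finsum_eq_sum_of_support_subset
    (s := (Finset.range (lam.colLen 0)).image fun i => rowPos lam i - 1)]
  · rw [Finset.sum_image fun a _ b _ h =>
      (rowPos_strictAnti lam).injective (sub_left_injective (b := (1 : ℤ)) h)]
    refine Finset.sum_congr rfl fun i _ => ?_
    split_ifs with h
    · have h1 : rowPos lam i - 1 + 1 ∈ (toMaya lam).carrier := ⟨i, by simp [rowPos]⟩
      rw [psi_psiStar_succ_delta _ h1 (removable_iff.mp h), (boxStep_removeBox h).toMaya_eq,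
        sub_add_cancel]
      congr 1
      push_cast
      ring
    · rw [psi_psiStar_delta_eq_zero (m := rowPos lam i - 1) (n := rowPos lam i - 1 + 1) (by omega)
        fun hc => h (removable_iff.mpr hc.2), smul_zero]
  · intro n hn
    rw [Function.mem_support] at hn
    by_cases hc : n + 1 ∈ (toMaya lam).carrier ∧ n ∉ (toMaya lam).carrier
    · obtain ⟨⟨i, hi⟩, h2⟩ := hc
      have hi' : rowPos lam i = n + 1 := hi
      rw [Finset.mem_coe, Finset.mem_image]
      refine ⟨i, Finset.mem_range.mpr (boxStep_removeBox (removable_iff.mpr ?_)).lt_colLen, ?_⟩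
      · rw [hi']
        simpa using h2
      · rw [hi']
        ring
    · exact absurd (by rw [psi_psiStar_delta_eq_zero (by omega) hc, smul_zero]) hn

/-- A particle hopping up adds a box to a diagram, so `U` preserves the span of the diagrams. -/
theorem exists_toMaya_of_opU_apply_ne_zero {z : ℂ} {mu : YoungDiagram} {S : Maya}
    (h : opU z (delta (toMaya mu)) S ≠ 0) : ∃ lam, S = toMaya lam := by
  classical
  obtain ⟨I, hI⟩ := exists_windowU z (delta (toMaya mu))
  rw [hI I subset_rfl, windowU, LinearMap.sum_apply, Finsupp.finsetSum_apply] at h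
  obtain ⟨n, -, hn⟩ := Finset.exists_ne_zero_of_sum_ne_zero h
  rw [LinearMap.smul_apply, Module.End.mul_apply, Finsupp.smul_apply] at hn
  have hn' : psi (n + 1) (psiStar n (delta (toMaya mu))) S ≠ 0 := right_ne_zero_of_smul hn
  by_cases hc : n ∈ (toMaya mu).carrier ∧ n + 1 ∉ (toMaya mu).carrier
  · obtain ⟨⟨i, hi⟩, h2⟩ := hc
    have hi' : rowPos mu i = n := hi
    subst hi'
    obtain ⟨lam, hlam⟩ := exists_add_box mu (addable_of_notMem h2)
    refine ⟨lam, ?_⟩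
    rw [hlam.toMaya_eq']
    have h3 : rowPos mu i + 1 ∉ ((toMaya mu).erase (rowPos mu i)).carrier := fun h => h2 h.1
    rw [psiStar_delta, if_pos ⟨i, rfl⟩, map_smul, psi_delta, if_neg h3, smul_smul,
      Finsupp.smul_apply] at hn'
    by_contra hS
    refine hn' ?_
    rw [delta, Finsupp.single_apply, if_neg (Ne.symm hS), smul_zero]
  · exact absurd (by rw [psi_psiStar_delta_eq_zero (by omega) hc]; rfl) hn'

/-! ### The vectors `U^k v_∅` -/

/-- `∏ (z + c(□)) / h(□)`. -/
def weight (z : ℂ) (lam : YoungDiagram) : ℂ :=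
  (∏ s ∈ lam.cells, (z + (content s : ℂ))) * (hookProd lam)⁻¹

/-- A box (i, j) forces i + 1 boxes in its column and j + 1 in its row, so the diagram fits into a k
× k square. -/
theorem finite_diagrams (k : ℕ) : {lam : YoungDiagram | lam.card = k}.Finite := by
  refine Set.Finite.of_injOn (f := YoungDiagram.cells)
    (t := ((Finset.range k ×ˢ Finset.range k).powerset : Set (Finset (ℕ × ℕ)))) ?_
    (fun _ _ _ _ h => YoungDiagram.ext h) (Finset.finite_toSet _)
  rintro lam rfl
  rw [Finset.mem_coe, Finset.mem_powerset]
  rintro ⟨i, j⟩ h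
  rw [YoungDiagram.mem_cells] at h
  rw [Finset.mem_product, Finset.mem_range, Finset.mem_range]
  constructor
  · have : ((Finset.range (i + 1)).image fun a => (a, j)).card ≤ lam.card := by
      refine Finset.card_le_card fun s hs => ?_
      obtain ⟨a, ha, rfl⟩ := Finset.mem_image.mp hs
      have := Finset.mem_range.mp ha
      exact lam.up_left_mem (by omega) le_rfl h
    rw [Finset.card_image_of_injective _ fun a b h => (Prod.mk.inj h).1, Finset.card_range] at this
    exact this
  · have : ((Finset.range (j + 1)).image fun a => (i, a)).card ≤ lam.card := by
      refine Finset.card_le_card fun s hs => ?_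
      obtain ⟨a, ha, rfl⟩ := Finset.mem_image.mp hs
      have := Finset.mem_range.mp ha
      exact lam.up_left_mem le_rfl (by omega) h
    rw [Finset.card_image_of_injective _ fun a b h => (Prod.mk.inj h).2, Finset.card_range] at this
    exact this

/-- The diagrams with `k` boxes. -/
def diagrams (k : ℕ) : Finset YoungDiagram := (finite_diagrams k).toFinset

@[simp]
theorem mem_diagrams {k : ℕ} {lam : YoungDiagram} : lam ∈ diagrams k ↔ lam.card = k := by
  simp [diagrams]

/-- `U^k v_∅ / k!`, see `opU_pow_vacuum`. -/
def diagramVector (z : ℂ) (k : ℕ) : Wedge :=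
  ∑ lam ∈ diagrams k, weight z lam • delta (toMaya lam)

open Classical in
theorem diagramVector_apply_toMaya (z : ℂ) (k : ℕ) (lam : YoungDiagram) :
    diagramVector z k (toMaya lam) = if lam.card = k then weight z lam else 0 := by
  rw [diagramVector, Finsupp.finsetSum_apply]
  have h : ∀ mu, (weight z mu • delta (toMaya mu)) (toMaya lam) =
      if mu = lam then weight z mu else 0 := by
    intro mu
    rw [Finsupp.smul_apply, delta, Finsupp.single_apply, toMaya_injective.eq_iff]
    split_ifs <;> simp
  simp only [h, Finset.sum_ite_eq', mem_diagrams]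

theorem diagramVector_apply_of_notMem {z : ℂ} {k : ℕ} {S : Maya} (hS : ∀ lam, S ≠ toMaya lam) :
    diagramVector z k S = 0 := by
  classical
  rw [diagramVector, Finsupp.finsetSum_apply]
  refine Finset.sum_eq_zero fun lam _ => ?_
  rw [Finsupp.smul_apply, delta, Finsupp.single_apply, if_neg (hS lam).symm, smul_zero]

/-- The new box has content `rowPos lam i`, so this factor completes the content product of mu to
that of lam. -/
theorem BoxStep.weight_eq {mu lam : YoungDiagram} {i : ℕ} (h : BoxStep mu lam i) (z : ℂ) :
    (z + (rowPos lam i : ℂ)) * weight z mu =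
      (∏ s ∈ lam.cells, (z + (content s : ℂ))) * (hookProd mu)⁻¹ := by
  rw [h.cells_eq, Finset.prod_insert (notMem_cells_rowLen mu i), weight, ← mul_assoc]
  congr 3
  rw [h.rowPos_self, rowPos, content]
  push_cast
  ring

/-- Read through the transpose `D`, the coefficient at lam is a sum over the diagrams mu with one
box less. The content factors all become those of lam, and ∑ 1 / H(mu) = |lam| / H(lam) does the
rest. -/
theorem opU_diagramVector (z : ℂ) (k : ℕ) :
    opU z (diagramVector z k) = ((k : ℂ) + 1) • diagramVector z (k + 1) := by
  classical
  ext S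
  by_cases hS : ∃ lam, S = toMaya lam
  · obtain ⟨lam, rfl⟩ := hS
    have h1 : opU z (diagramVector z k) (toMaya lam) =
        ∑ i ∈ Finset.range (lam.colLen 0), if lam.rowLen (i + 1) < lam.rowLen i then
          (z + (rowPos lam i : ℂ)) * diagramVector z k (toMaya (removeBox lam i)) else 0 := by
      have h2 : ∀ mu, opU z (delta (toMaya mu)) (toMaya lam) =
          ∑ i ∈ Finset.range (lam.colLen 0), if lam.rowLen (i + 1) < lam.rowLen i then
            (z + (rowPos lam i : ℂ)) * delta (toMaya mu) (toMaya (removeBox lam i)) else 0 := by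
        intro mu
        rw [← opD_apply_eq_opU_apply, opD_delta_toMaya, Finsupp.finsetSum_apply]
        refine Finset.sum_congr rfl fun i _ => ?_
        split_ifs
        · rw [Finsupp.smul_apply, smul_eq_mul, delta_apply_comm]
        · rfl
      simp only [diagramVector, map_sum, map_smul, Finsupp.finsetSum_apply, Finsupp.smul_apply, h2]
      simp only [Finset.smul_sum]
      rw [Finset.sum_comm]
      refine Finset.sum_congr rfl fun i _ => ?_
      split_ifs
      · rw [Finset.mul_sum]
        refine Finset.sum_congr rfl fun mu _ => ?_
        simp only [smul_eq_mul]
        ring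
      · simp
    rw [h1, Finsupp.smul_apply, diagramVector_apply_toMaya, smul_eq_mul]
    by_cases hk : lam.card = k + 1
    · rw [if_pos hk]
      have h3 : ∀ i ∈ Finset.range (lam.colLen 0), (if lam.rowLen (i + 1) < lam.rowLen i then
          (z + (rowPos lam i : ℂ)) * diagramVector z k (toMaya (removeBox lam i)) else 0) =
          (∏ s ∈ lam.cells, (z + (content s : ℂ))) * (if lam.rowLen (i + 1) < lam.rowLen i then
            (hookProd (removeBox lam i))⁻¹ else 0) := by
        intro i _
        split_ifs with h
        · have hb := boxStep_removeBox h
          rw [diagramVector_apply_toMaya, if_pos (by have := hb.card_eq; omega), hb.weight_eq]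
        · rw [mul_zero]
      rw [Finset.sum_congr rfl h3, ← Finset.mul_sum,
        sum_inv_hookProd lam le_rfl (removeBox lam) fun i h => boxStep_removeBox h, hk, weight]
      push_cast
      ring
    · rw [if_neg hk, mul_zero]
      refine Finset.sum_eq_zero fun i _ => ?_
      split_ifs with h
      · have hb := boxStep_removeBox h
        rw [diagramVector_apply_toMaya, if_neg (by have := hb.card_eq; omega), mul_zero]
      · rfl
  · have hS' : ∀ lam, S ≠ toMaya lam := fun lam h => hS ⟨lam, h⟩
    rw [Finsupp.smul_apply, diagramVector_apply_of_notMem hS', smul_zero]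
    simp only [diagramVector, map_sum, map_smul, Finsupp.finsetSum_apply, Finsupp.smul_apply]
    refine Finset.sum_eq_zero fun mu _ => ?_
    by_contra hc
    exact hS (exists_toMaya_of_opU_apply_ne_zero (right_ne_zero_of_smul hc))

theorem card_eq_zero_iff {lam : YoungDiagram} : lam.card = 0 ↔ lam = ⊥ := by
  rw [YoungDiagram.card, Finset.card_eq_zero]
  exact ⟨fun h => YoungDiagram.ext h, fun h => by rw [h]; rfl⟩

theorem toMaya_bot : toMaya ⊥ = Maya.empty := by
  have h : ∀ i, (⊥ : YoungDiagram).rowLen i = 0 := by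
    intro i
    by_contra hi
    exact YoungDiagram.notMem_bot (i, 0) (YoungDiagram.mem_iff_lt_rowLen.mpr (by omega))
  rw [Maya.ext_iff_mem]
  intro n
  rw [mem_toMaya, Maya.mem_empty]
  simp only [rowPos, h]
  constructor
  · rintro ⟨i, rfl⟩
    push_cast
    omega
  · intro hn
    exact ⟨(-n - 1).toNat, by push_cast; omega⟩

theorem diagramVector_zero (z : ℂ) : diagramVector z 0 = vacuum := by
  have : diagrams 0 = {⊥} := by
    ext lam
    rw [mem_diagrams, Finset.mem_singleton, card_eq_zero_iff]
  rw [diagramVector, this, Finset.sum_singleton, toMaya_bot, weight, hookProd]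
  simp [vacuum]

theorem opU_pow_vacuum (z : ℂ) (k : ℕ) :
    (opU z ^ k) vacuum = (k ! : ℂ) • diagramVector z k := by
  induction k with
  | zero => simp [diagramVector_zero]
  | succ k ih =>
    rw [pow_succ', Module.End.mul_apply, ih, map_smul, opU_diagramVector, smul_smul,
      Nat.factorial_succ]
    congr 1
    push_cast
    ring

/-- `D^m f / m!` paired with the vacuum. -/
theorem opD_pow_apply_empty (z : ℂ) (m : ℕ) (f : Wedge) :
    (opD z ^ m) f Maya.empty = (m ! : ℂ) * ∑ lam ∈ diagrams m, weight z lam * f (toMaya lam) := by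
  have key : ∀ m S, (opD z ^ m) (delta S) Maya.empty = (opU z ^ m) vacuum S := by
    intro m
    have : ∀ S T, (opD z ^ m) (delta S) T = (opU z ^ m) (delta T) S := by
      induction m with
      | zero =>
        intro S T
        exact delta_apply_comm S T
      | succ m ih =>
        intro S T
        rw [pow_succ, pow_succ']
        exact mul_apply_transpose ih (opD_apply_eq_opU_apply z) S T
    exact fun S => this S _
  induction f using Finsupp.induction_linear with
  | zero => simp
  | add f g hf hg =>
    rw [map_add, Finsupp.add_apply, hf, hg, ← mul_add, ← Finset.sum_add_distrib]
    simp only [Finsupp.add_apply, mul_add]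
  | single S c =>
    rw [single_eq_smul_delta, map_smul, Finsupp.smul_apply, key, opU_pow_vacuum, diagramVector,
      Finsupp.smul_apply, Finsupp.finsetSum_apply, smul_eq_mul, smul_eq_mul, mul_left_comm,
      Finset.mul_sum]
    congr 1
    refine Finset.sum_congr rfl fun lam _ => ?_
    rw [Finsupp.smul_apply, Finsupp.smul_apply, delta_apply_comm S, smul_eq_mul, smul_eq_mul]
    ring

/-- The identity `∑_{|lam| = n} ∏ (z + c)(z' + c) / h² = (z z')_n / n!`. -/
theorem sum_weight_mul_weight (z z' : ℂ) (n : ℕ) :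
    ∑ lam ∈ diagrams n, weight z' lam * weight z lam =
      (ascPochhammer ℂ n).eval (z * z') / (n ! : ℂ) := by
  classical
  -- The vacuum coefficient of D^n U^n v is computed in two ways: by sl(2) and by expanding over
  -- diagrams.
  have h1 := congr_arg (fun f : Wedge => f Maya.empty) (opD_pow_opU_pow_vacuum z z' 0 n)
  simp only [add_zero, opD_pow_apply_empty, opU_pow_vacuum, Finsupp.smul_apply, smul_eq_mul,
    diagramVector_apply_toMaya] at h1
  have h2 : ∑ lam ∈ diagrams n, weight z' lam * ((n ! : ℂ) * if lam.card = n then weight z lam else 0)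
      = (n ! : ℂ) * ∑ lam ∈ diagrams n, weight z' lam * weight z lam := by
    rw [Finset.mul_sum]
    refine Finset.sum_congr rfl fun lam hlam => ?_
    rw [if_pos (mem_diagrams.mp hlam)]
    ring
  have h3 : diagramVector z 0 Maya.empty = 1 := by
    rw [diagramVector_zero, vacuum, delta, Finsupp.single_eq_same]
  rw [h2, h3] at h1
  have h4 : (n ! : ℂ) ≠ 0 := Nat.cast_ne_zero.mpr (Nat.factorial_ne_zero n)
  simp only [Nat.factorial_zero, Nat.cast_one, div_one, mul_one, Nat.cast_zero, add_zero] at h1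
  field_simp
  refine mul_left_cancel₀ h4 ?_
  rw [← h1]
  ring

end ZMeasure

end

noncomputable section

namespace ZMeasure

open PowerSeries

/-! ### Evaluation of power series -/

section Evaluation

theorem coeff_mul_mul_pow (f g : ℂ⟦X⟧) (q : ℂ) (n : ℕ) : coeff n (f * g) * q ^ n =
    ∑ x ∈ Finset.HasAntidiagonal.antidiagonal n,
      (coeff x.1 f * q ^ x.1) * (coeff x.2 g * q ^ x.2) := by
  rw [coeff_mul, Finset.sum_mul]
  refine Finset.sum_congr rfl fun x hx => ?_
  rw [← Finset.HasAntidiagonal.mem_antidiagonal.mp hx, pow_add]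
  ring

/-- Absolute convergence of a power series at `q`. -/
def ConvergesAt (f : ℂ⟦X⟧) (q : ℂ) : Prop :=
  Summable fun n => coeff n f * q ^ n

namespace ConvergesAt

theorem one (q : ℂ) : ConvergesAt 1 q := by
  refine summable_of_ne_finset_zero (s := {0}) fun n hn => ?_
  rw [coeff_one, if_neg (by simpa using hn), zero_mul]

theorem zero (q : ℂ) : ConvergesAt 0 q := by
  unfold ConvergesAt
  simp only [map_zero, zero_mul]
  exact summable_zero

theorem add {f g : ℂ⟦X⟧} {q : ℂ} (hf : ConvergesAt f q) (hg : ConvergesAt g q) :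
    ConvergesAt (f + g) q := by
  unfold ConvergesAt
  simp only [map_add, add_mul]
  exact Summable.add hf hg

theorem neg {f : ℂ⟦X⟧} {q : ℂ} (hf : ConvergesAt f q) : ConvergesAt (-f) q := by
  unfold ConvergesAt
  simp only [map_neg, neg_mul]
  exact Summable.neg hf

theorem mul {f g : ℂ⟦X⟧} {q : ℂ} (hf : ConvergesAt f q) (hg : ConvergesAt g q) :
    ConvergesAt (f * g) q := by
  have hf' : Summable fun n => ‖coeff n f * q ^ n‖ := Summable.norm hf
  have hg' : Summable fun n => ‖coeff n g * q ^ n‖ := Summable.norm hg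
  have h := (summable_norm_sum_mul_antidiagonal_of_summable_norm hf' hg').of_norm
  exact h.congr fun n => (coeff_mul_mul_pow f g q n).symm

theorem tsum_add {f g : ℂ⟦X⟧} {q : ℂ} (hf : ConvergesAt f q) (hg : ConvergesAt g q) :
    ∑' n, coeff n (f + g) * q ^ n = ∑' n, coeff n f * q ^ n + ∑' n, coeff n g * q ^ n := by
  simp only [map_add, add_mul]
  exact Summable.tsum_add hf hg

theorem tsum_mul {f g : ℂ⟦X⟧} {q : ℂ} (hf : ConvergesAt f q) (hg : ConvergesAt g q) :
    ∑' n, coeff n (f * g) * q ^ n = (∑' n, coeff n f * q ^ n) * ∑' n, coeff n g * q ^ n := by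
  have hf' : Summable fun n => ‖coeff n f * q ^ n‖ := Summable.norm hf
  have hg' : Summable fun n => ‖coeff n g * q ^ n‖ := Summable.norm hg
  rw [tsum_mul_tsum_eq_tsum_sum_antidiagonal_of_summable_norm hf' hg']
  exact tsum_congr fun n => coeff_mul_mul_pow _ _ _ _

end ConvergesAt

/-- The power series that converge absolutely at `q`. -/
def convergentSeries (q : ℂ) : Subring ℂ⟦X⟧ where
  carrier := {f | ConvergesAt f q}
  mul_mem' hf hg := hf.mul hg
  one_mem' := ConvergesAt.one q
  add_mem' hf hg := hf.add hg
  zero_mem' := ConvergesAt.zero q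
  neg_mem' hf := hf.neg

/-- Evaluation of convergent power series. -/
def evalSeries (q : ℂ) : convergentSeries q →+* ℂ where
  toFun f := ∑' n, coeff n (f : ℂ⟦X⟧) * q ^ n
  map_one' := by
    rw [tsum_eq_single 0]
    · rw [Subring.coe_one, coeff_one, if_pos rfl, pow_zero, one_mul]
    · intro n hn
      rw [Subring.coe_one, coeff_one, if_neg hn, zero_mul]
  map_mul' f g := ConvergesAt.tsum_mul f.2 g.2
  map_zero' := by
    simp only [Subring.coe_zero, map_zero, zero_mul, tsum_zero]
  map_add' f g := ConvergesAt.tsum_add f.2 g.2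

theorem hasSum_ascPochhammer (t : ℂ) {x : ℂ} (hx : ‖x‖ < 1) :
    HasSum (fun n : ℕ => (ascPochhammer ℂ n).eval t / (n ! : ℂ) * x ^ n) ((1 - x) ^ (-t)) := by
  have hc : ∀ n : ℕ, Ring.choose (t + n - 1) n = (ascPochhammer ℂ n).eval t / (n ! : ℂ) := by
    intro n
    have h := Ring.factorial_nsmul_multichoose_eq_ascPochhammer t n
    rw [Polynomial.ascPochhammer_smeval_eq_eval] at h
    rw [Ring.choose, show t + n - 1 - n + 1 = t by ring, ← h, nsmul_eq_mul,
      mul_div_cancel_left₀ _ (Nat.cast_ne_zero.mpr (Nat.factorial_ne_zero n))]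
  have h := Complex.one_div_one_sub_cpow_hasFPowerSeriesOnBall_zero t
  have h2 := h.hasSum (y := x) (by
    rw [Metric.mem_eball, edist_zero_right, ← ofReal_norm]
    exact ENNReal.ofReal_lt_one.mpr hx)
  have e : (fun n => (FormalMultilinearSeries.ofScalars ℂ
      (fun n : ℕ => Ring.choose (t + n - 1) n)) n fun _ : Fin n => x) =
      fun n : ℕ => (ascPochhammer ℂ n).eval t / (n ! : ℂ) * x ^ n := by
    funext n
    rw [← hc, FormalMultilinearSeries.ofScalars_apply_eq]
    simp
  rwa [e, zero_add, one_div, ← Complex.cpow_neg] at h2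

theorem hasSum_negBinomial (t : ℂ) {q : ℂ} (hq : ‖q‖ < 1) :
    HasSum (fun n => coeff n (negBinomial t) * q ^ n) ((1 - q ^ 2) ^ (-t)) := by
  have hinj : Function.Injective fun m : ℕ => 2 * m := fun a b h => by
    simpa using h
  rw [← hinj.hasSum_iff]
  · have := hasSum_ascPochhammer t (x := q ^ 2) (by
      rw [norm_pow]
      exact pow_lt_one₀ (norm_nonneg _) hq two_ne_zero)
    refine this.congr_fun ?_
    intro m
    simp only [Function.comp_apply, coeff_negBinomial_two_mul, pow_mul]
  · intro n hn
    rw [coeff_negBinomial_of_odd, zero_mul]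
    rintro ⟨m, rfl⟩
    exact hn ⟨m, by simp; ring⟩

end Evaluation

/-! ### Summability of the weights -/

section Summability

theorem conj_weight (z : ℂ) (lam : YoungDiagram) :
    weight (starRingEnd ℂ z) lam = starRingEnd ℂ (weight z lam) := by
  simp only [weight, hookProd, map_mul, map_inv₀, map_prod, map_add, map_intCast]

/-- For z' the conjugate of z the products of weights are squared absolute values, since contents
and hooks are integers. -/
theorem sum_norm_weight_sq (z : ℂ) (n : ℕ) :
    ∑ lam ∈ diagrams n, ‖weight z lam‖ ^ 2 =
      ‖(ascPochhammer ℂ n).eval (z * starRingEnd ℂ z) / (n ! : ℂ)‖ := by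
  rw [← sum_weight_mul_weight]
  have h : ∀ lam, weight (starRingEnd ℂ z) lam * weight z lam = ((‖weight z lam‖ ^ 2 : ℝ) : ℂ) := by
    intro lam
    rw [conj_weight, Complex.conj_mul']
    push_cast
    rfl
  simp only [h]
  rw [← Complex.ofReal_sum, Complex.norm_real, Real.norm_of_nonneg]
  exact Finset.sum_nonneg fun _ _ => sq_nonneg _

/-- A finite set of diagrams meets finitely many levels, and the level sums are the terms of the
binomial series of (1 - q²)^{-|z|²}. -/
theorem summable_norm_weight_sq (z : ℂ) {q : ℝ} (hq0 : 0 ≤ q) (hq1 : q < 1) :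
    Summable fun lam : YoungDiagram => (‖weight z lam‖ * q ^ lam.card) ^ 2 := by
  have hq2 : ‖((q ^ 2 : ℝ) : ℂ)‖ < 1 := by
    rw [Complex.norm_real, Real.norm_of_nonneg (by positivity)]
    exact pow_lt_one₀ hq0 hq1 two_ne_zero
  have hs := (hasSum_ascPochhammer (z * starRingEnd ℂ z) hq2).summable.norm
  refine summable_of_sum_le (c := ∑' n : ℕ,
    ‖(ascPochhammer ℂ n).eval (z * starRingEnd ℂ z) / (n ! : ℂ) * ((q ^ 2 : ℝ) : ℂ) ^ n‖)
    (fun _ => sq_nonneg _) fun u => ?_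
  classical
  set N := u.sup YoungDiagram.card + 1
  have hsub : u ⊆ (Finset.range N).biUnion diagrams := by
    intro lam hlam
    rw [Finset.mem_biUnion]
    exact ⟨lam.card, Finset.mem_range.mpr (Nat.lt_succ_of_le (Finset.le_sup hlam)), by simp⟩
  refine (Finset.sum_le_sum_of_subset_of_nonneg hsub fun _ _ _ => sq_nonneg _).trans ?_
  rw [Finset.sum_biUnion]
  · refine le_trans (le_of_eq ?_) (hs.sum_le_tsum (Finset.range N) fun _ _ => norm_nonneg _)
    refine Finset.sum_congr rfl fun n _ => ?_
    rw [norm_mul, ← sum_norm_weight_sq, Finset.sum_mul]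
    refine Finset.sum_congr rfl fun lam hlam => ?_
    rw [mem_diagrams.mp hlam, norm_pow, Complex.norm_real, Real.norm_of_nonneg (by positivity)]
    ring
  · intro a _ b _ hab
    rw [Function.onFun, Finset.disjoint_left]
    intro lam h1 h2
    exact hab ((mem_diagrams.mp h1).symm.trans (mem_diagrams.mp h2))

/-- Matrix coefficients of a partial injection between diagrams. -/
structure IsPartialInjection (ε : YoungDiagram × YoungDiagram → ℂ) : Prop where
  norm_le : ∀ p, ‖ε p‖ ≤ 1
  left_unique : ∀ p p', ε p ≠ 0 → ε p' ≠ 0 → p.1 = p'.1 → p = p'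
  right_unique : ∀ p p', ε p ≠ 0 → ε p' ≠ 0 → p.2 = p'.2 → p = p'

/-- The terms of a matrix element of an operator with matrix `ε` in the basis of diagrams. -/
def pairTerm (z z' q : ℂ) (ε : YoungDiagram × YoungDiagram → ℂ)
    (p : YoungDiagram × YoungDiagram) : ℂ :=
  weight z' p.2 * (weight z p.1 * ε p) * q ^ (p.2.card + p.1.card)

/-- By xy ≤ x² + y², a term is bounded by a square depending on the first diagram plus one depending
on the second. In a partial injection each diagram occurs at most once in either place, so both sums
of squares converge. -/
theorem summable_pairTerm (z z' : ℂ) {q : ℝ} (hq0 : 0 ≤ q) (hq1 : q < 1)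
    {ε : YoungDiagram × YoungDiagram → ℂ} (hε : IsPartialInjection ε) :
    Summable (pairTerm z z' q ε) := by
  set a := fun lam : YoungDiagram => (‖weight z lam‖ * q ^ lam.card) ^ 2
  set b := fun lam : YoungDiagram => (‖weight z' lam‖ * q ^ lam.card) ^ 2
  have h1 : Summable ((a ∘ Prod.fst) ∘ (Subtype.val : {p | ε p ≠ 0} → _)) :=
    (summable_norm_weight_sq z hq0 hq1).comp_injective
      (i := Prod.fst ∘ (Subtype.val : {p | ε p ≠ 0} → _)) fun p p' h =>
        Subtype.ext (hε.left_unique p p' p.2 p'.2 h)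
  have h2 : Summable ((b ∘ Prod.snd) ∘ (Subtype.val : {p | ε p ≠ 0} → _)) :=
    (summable_norm_weight_sq z' hq0 hq1).comp_injective
      (i := Prod.snd ∘ (Subtype.val : {p | ε p ≠ 0} → _)) fun p p' h =>
        Subtype.ext (hε.right_unique p p' p.2 p'.2 h)
  rw [summable_subtype_iff_indicator] at h1 h2
  refine Summable.of_norm_bounded (h1.add h2) fun p => ?_
  by_cases hp : ε p = 0
  · simp [pairTerm, hp]
  · rw [Set.indicator_of_mem (show p ∈ {p | ε p ≠ 0} from hp),
      Set.indicator_of_mem (show p ∈ {p | ε p ≠ 0} from hp), pairTerm]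
    simp only [Function.comp_apply, a, b]
    rw [norm_mul, norm_mul, norm_mul, norm_pow, Complex.norm_real, Real.norm_of_nonneg hq0, pow_add]
    set x := ‖weight z p.1‖ * q ^ p.1.card with hx
    set y := ‖weight z' p.2‖ * q ^ p.2.card with hy
    have hx0 : 0 ≤ x := by positivity
    have hy0 : 0 ≤ y := by positivity
    have e : ‖weight z' p.2‖ * (‖weight z p.1‖ * ‖ε p‖) * (q ^ p.2.card * q ^ p.1.card) =
        x * y * ‖ε p‖ := by
      rw [hx, hy]
      ring
    rw [e]
    have := mul_le_mul_of_nonneg_left (hε.norm_le p) (mul_nonneg hx0 hy0)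
    nlinarith [sq_nonneg (x - y), mul_nonneg hx0 hy0]

theorem hasSum_sum_fiber {β : Type*} {f : β → ℂ} (hf : Summable f) {g : β → ℕ}
    {s : ℕ → Finset β} (hs : ∀ n b, b ∈ s n ↔ g b = n) :
    HasSum (fun n => ∑ b ∈ s n, f b) (∑' b, f b) := by
  have h1 : HasSum (f ∘ Equiv.sigmaFiberEquiv g) (∑' b, f b) :=
    (Equiv.sigmaFiberEquiv g).hasSum_iff.mpr hf.hasSum
  refine h1.sigma fun n => ?_
  have h2 := (s n).hasSum f
  let e : {b // g b = n} ≃ (s n) := Equiv.subtypeEquivRight fun b => (hs n b).symm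
  exact e.hasSum_iff.mpr h2

end Summability

/-! ### Matrix elements -/

/-- The matrix of an operator in the basis of diagrams. -/
def diagramMatrix (T : Module.End ℂ Wedge) (p : YoungDiagram × YoungDiagram) : ℂ :=
  T (delta (toMaya p.1)) (toMaya p.2)

theorem coeff_sandwich_eq (z z' : ℂ) (T : Module.End ℂ Wedge) (n : ℕ) :
    coeff n (vacuumExpectation (expOp X (opD z') * PowerSeries.C T * expOp X (opU z))) =
      ∑ x ∈ Finset.HasAntidiagonal.antidiagonal n, ∑ p ∈ diagrams x.2 ×ˢ diagrams x.1,
        weight z' p.2 * (weight z p.1 * diagramMatrix T p) := by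
  rw [coeff_vacuumExpectation_sandwich]
  refine Finset.sum_congr rfl fun x _ => ?_
  have h : ∀ m : ℕ, (m ! : ℂ) ≠ 0 := fun m => Nat.cast_ne_zero.mpr (Nat.factorial_ne_zero m)
  rw [opU_pow_vacuum, smul_smul, inv_mul_cancel₀ (h _), one_smul, opD_pow_apply_empty, ← mul_assoc,
    inv_mul_cancel₀ (h _), one_mul, Finset.sum_product_right]
  refine Finset.sum_congr rfl fun mu _ => ?_
  rw [diagramVector, map_sum, Finsupp.finsetSum_apply, Finset.mul_sum]
  refine Finset.sum_congr rfl fun lam _ => ?_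
  rw [map_smul, Finsupp.smul_apply, smul_eq_mul, diagramMatrix]

/-- The coefficient of q^n collects the pairs with n boxes in total. Absolute summability over pairs
permits this regrouping and gives convergence of the power series. -/
theorem hasSum_sandwich (z z' : ℂ) {q : ℝ} (hq0 : 0 ≤ q) (hq1 : q < 1) {T : Module.End ℂ Wedge}
    (hT : IsPartialInjection (diagramMatrix T)) :
    HasSum (fun n => coeff n (vacuumExpectation
      (expOp X (opD z') * PowerSeries.C T * expOp X (opU z))) * (q : ℂ) ^ n)
      (∑' p, pairTerm z z' q (diagramMatrix T) p) := by
  classical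
  set s : ℕ → Finset (YoungDiagram × YoungDiagram) := fun n =>
    (Finset.HasAntidiagonal.antidiagonal n).biUnion fun x => diagrams x.2 ×ˢ diagrams x.1 with hs
  have h := hasSum_sum_fiber (summable_pairTerm z z' hq0 hq1 hT) (g := fun p => p.2.card + p.1.card)
    (s := s) (by
      intro n p
      simp only [hs, Finset.mem_biUnion, Finset.HasAntidiagonal.mem_antidiagonal,
        Finset.mem_product, mem_diagrams]
      constructor
      · rintro ⟨x, h1, h2, h3⟩
        omega
      · intro h
        exact ⟨(p.2.card, p.1.card), h, rfl, rfl⟩)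
  refine h.congr_fun fun n => ?_
  rw [coeff_sandwich_eq, hs, Finset.sum_biUnion, Finset.sum_mul]
  · refine Finset.sum_congr rfl fun x hx => ?_
    rw [Finset.sum_mul]
    refine Finset.sum_congr rfl fun p hp => ?_
    rw [Finset.mem_product, mem_diagrams, mem_diagrams] at hp
    rw [pairTerm, hp.1, hp.2, Finset.HasAntidiagonal.mem_antidiagonal.mp hx]
  · intro x _ y _ hxy
    rw [Function.onFun, Finset.disjoint_left]
    intro p h1 h2
    rw [Finset.mem_product, mem_diagrams, mem_diagrams] at h1 h2
    exact hxy (Prod.ext (h1.2.symm.trans h2.2) (h1.1.symm.trans h2.1))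

theorem psi_mul_psiStar_apply (i j : ℤ) (S T : Maya) :
    ‖(psi i * psiStar j) (delta S) T‖ ≤ 1 ∧
      ((psi i * psiStar j) (delta S) T ≠ 0 → T = (S.erase j).insert i) := by
  classical
  rw [Module.End.mul_apply, psiStar_delta]
  split_ifs with h1
  · rw [map_smul, psi_delta]
    split_ifs with h2
    · simp
    · rw [Finsupp.smul_apply, Finsupp.smul_apply, delta, Finsupp.single_apply]
      split_ifs with h3
      · exact ⟨by simp, fun _ => h3.symm⟩
      · simp
  · simp

theorem psi_mul_psiStar_transpose (i j : ℤ) (S T : Maya) :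
    (psi i * psiStar j) (delta S) T = (psi j * psiStar i) (delta T) S :=
  mul_apply_transpose (psi_apply_eq_psiStar_apply i)
    (fun S T => (psi_apply_eq_psiStar_apply j T S).symm) S T

/-- The first diagram determines the second by moving one particle from j to i. Transposition
exchanges i and j, which gives the other direction. -/
theorem isPartialInjection_psi_mul_psiStar (i j : ℤ) :
    IsPartialInjection (diagramMatrix (psi i * psiStar j)) where
  norm_le p := (psi_mul_psiStar_apply i j _ _).1
  left_unique := by
    rintro ⟨lam, mu⟩ ⟨lam', mu'⟩ h h' (rfl : lam = lam')
    have e1 := (psi_mul_psiStar_apply i j _ _).2 h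
    have e2 := (psi_mul_psiStar_apply i j _ _).2 h'
    exact Prod.ext rfl (toMaya_injective (e1.trans e2.symm))
  right_unique := by
    rintro ⟨lam, mu⟩ ⟨lam', mu'⟩ h h' (rfl : mu = mu')
    rw [diagramMatrix, psi_mul_psiStar_transpose] at h h'
    have e1 := (psi_mul_psiStar_apply j i _ _).2 h
    have e2 := (psi_mul_psiStar_apply j i _ _).2 h'
    exact Prod.ext (toMaya_injective (e1.trans e2.symm)) rfl

-- Peel off the outermost pair ψ_{x 0}, ψ*_{x 0}, whose signs cancel. Injectivity ensures that
-- vacating x 0 does not affect the remaining sites.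
open Classical in
theorem occupation_delta : ∀ {s : ℕ} {x : Fin s → ℤ} (_ : Function.Injective x) (S : Maya),
    occupation x (delta S) = if ∀ k, x k ∈ S.carrier then delta S else 0
  | 0, x, hx, S => by simp [occupation]
  | s + 1, x, hx, S => by
    have e : occupation x = psi (x 0) * occupation (fun k => x k.succ) * psiStar (x 0) := by
      rw [occupation, occupation, List.ofFn_succ, List.ofFn_succ, List.prod_cons,
        List.reverse_cons, List.prod_append, List.prod_singleton]
      simp only [mul_assoc]
    have hx' : Function.Injective fun k : Fin s => x k.succ :=
      fun a b h => Fin.succ_injective _ (hx h)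
    rw [e, Module.End.mul_apply, Module.End.mul_apply, psiStar_delta]
    by_cases h0 : x 0 ∈ S.carrier
    · rw [if_pos h0, map_smul, occupation_delta hx']
      have hiff : (∀ k : Fin s, x k.succ ∈ (S.erase (x 0)).carrier) ↔ ∀ k, x k ∈ S.carrier := by
        rw [Fin.forall_fin_succ]
        simp only [Maya.mem_erase]
        exact ⟨fun h => ⟨h0, fun k => (h k).1⟩,
          fun h k => ⟨h.2 k, hx.ne (Fin.succ_ne_zero k)⟩⟩
      rw [if_congr hiff rfl rfl]
      split_ifs
      · rw [map_smul, psi_delta, if_neg (by simp), Maya.insert_erase h0,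
          Maya.numAbove_erase (x 0) h0, if_neg (lt_irrefl _), add_zero, neg_one_pow_smul_self]
      · simp
    · rw [if_neg h0, map_zero, map_zero, if_neg fun h => h0 (h 0)]

end ZMeasure

end

/-! ### Correlation functions as evaluated determinants -/

noncomputable section

namespace ZMeasure

open PowerSeries

theorem diagramMatrix_occupation {s : ℕ} {x : Fin s → ℤ} (hx : Function.Injective x)
    (p : YoungDiagram × YoungDiagram) [Decidable ((∀ k, x k ∈ frakS p.1) ∧ p.1 = p.2)] :
    diagramMatrix (occupation x) p = if (∀ k, x k ∈ frakS p.1) ∧ p.1 = p.2 then 1 else 0 := by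
  classical
  rw [diagramMatrix, occupation_delta hx]
  change (if ∀ k, x k ∈ frakS p.1 then delta (toMaya p.1) else 0) (toMaya p.2) = _
  by_cases h : ∀ k, x k ∈ frakS p.1
  · rw [if_pos h, delta, Finsupp.single_apply]
    exact if_congr (by simp [h, toMaya_injective.eq_iff]) rfl rfl
  · rw [if_neg h, if_neg fun h' => h h'.1]
    rfl

theorem diagramMatrix_occupation_ne_zero {s : ℕ} {x : Fin s → ℤ} (hx : Function.Injective x)
    {p : YoungDiagram × YoungDiagram} (hp : diagramMatrix (occupation x) p ≠ 0) : p.1 = p.2 := by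
  classical
  rw [diagramMatrix_occupation hx] at hp
  by_contra h
  exact hp (if_neg fun h' => h h'.2)

theorem isPartialInjection_occupation {s : ℕ} {x : Fin s → ℤ} (hx : Function.Injective x) :
    IsPartialInjection (diagramMatrix (occupation x)) where
  norm_le p := by
    classical
    rw [diagramMatrix_occupation hx]
    split_ifs <;> simp
  left_unique p p' hp hp' h := by
    have h1 := diagramMatrix_occupation_ne_zero hx hp
    have h2 := diagramMatrix_occupation_ne_zero hx hp'
    exact Prod.ext h (h1.symm.trans (h.trans h2))
  right_unique p p' hp hp' h := by
    have h1 := diagramMatrix_occupation_ne_zero hx hp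
    have h2 := diagramMatrix_occupation_ne_zero hx hp'
    exact Prod.ext (h1.trans (h.trans h2.symm)) h

theorem diag_injective : Function.Injective fun lam : YoungDiagram => (lam, lam) :=
  fun _ _ h => congrArg Prod.fst h

theorem pairTerm_occupation_diag (z z' q : ℂ) {s : ℕ} {x : Fin s → ℤ} (hx : Function.Injective x)
    (lam : YoungDiagram) :
    pairTerm z z' q (diagramMatrix (occupation x)) (lam, lam) =
      Set.indicator {lam | ∀ k, x k ∈ frakS lam}
        (fun lam => (q ^ 2) ^ lam.card * (weight z lam * weight z' lam)) lam := by
  classical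
  rw [pairTerm, diagramMatrix_occupation hx, Set.indicator_apply]
  simp only [Set.mem_ofPred_eq, and_true]
  split_ifs
  · rw [← pow_mul, two_mul]
    ring
  · ring

theorem tsum_pairTerm_occupation (z z' q : ℂ) {s : ℕ} {x : Fin s → ℤ}
    (hx : Function.Injective x) :
    ∑' p, pairTerm z z' q (diagramMatrix (occupation x)) p =
      ∑' lam : {lam | ∀ k, x k ∈ frakS lam},
        (q ^ 2) ^ lam.1.card * (weight z lam.1 * weight z' lam.1) := by
  rw [tsum_subtype {lam | ∀ k, x k ∈ frakS lam}
    fun lam => (q ^ 2) ^ lam.card * (weight z lam * weight z' lam)]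
  have h := diag_injective.tsum_eq (f := pairTerm z z' q (diagramMatrix (occupation x))) (by
    rintro ⟨lam, mu⟩ hp
    have h0 : diagramMatrix (occupation x) (lam, mu) ≠ 0 := by
      intro h0
      rw [Function.mem_support, pairTerm, h0, mul_zero, mul_zero, zero_mul] at hp
      exact hp rfl
    have h1 : lam = mu := diagramMatrix_occupation_ne_zero hx h0
    exact ⟨lam, by rw [h1]⟩)
  rw [← h]
  exact tsum_congr fun lam => pairTerm_occupation_diag z z' q hx lam

/-- This is the diagonal of `summable_pairTerm` for the occupation operator of no points, which is
the identity. -/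
theorem summable_weight_mul_weight (z z' : ℂ) {q : ℝ} (hq0 : 0 ≤ q) (hq1 : q < 1) :
    Summable fun lam : YoungDiagram =>
      ((q : ℂ) ^ 2) ^ lam.card * (weight z lam * weight z' lam) := by
  have hx : Function.Injective (Fin.elim0 : Fin 0 → ℤ) := fun i => i.elim0
  have h := (summable_pairTerm z z' hq0 hq1 (isPartialInjection_occupation hx)).comp_injective
    diag_injective
  refine h.congr fun lam => ?_
  rw [Function.comp_apply, pairTerm_occupation_diag z z' q hx,
    Set.indicator_of_mem (show lam ∈ {lam | ∀ k : Fin 0, Fin.elim0 k ∈ frakS lam} from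
      fun k => k.elim0)]

/-- The condition on zz' enters here: it makes (zz')_n nonzero, so that this factor of the mixture
cancels the denominator of the z-measure. -/
theorem mixedWeight_eq {z z' : ℂ} (hz : ∀ n : ℕ, z * z' ≠ -(n : ℂ)) (ξ : ℝ) (lam : YoungDiagram) :
    mixedWeight z z' ξ lam = ((1 - ξ : ℝ) : ℂ) ^ (z * z') *
      ((ξ : ℂ) ^ lam.card * (weight z lam * weight z' lam)) := by
  have h1 : (ascPochhammer ℂ lam.card).eval (z * z') ≠ 0 := by
    rw [Ne, ascPochhammer_eval_eq_zero_iff]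
    rintro ⟨k, _, hk⟩
    exact hz k (by rw [hk, neg_neg])
  have h2 : (lam.card ! : ℂ) ≠ 0 := Nat.cast_ne_zero.mpr (Nat.factorial_ne_zero _)
  have h3 : ∏ s ∈ lam.cells,
      (z + (content s : ℂ)) * (z' + (content s : ℂ)) / ((hookLength lam s : ℂ)) ^ 2 =
      weight z lam * weight z' lam := by
    rw [Finset.prod_div_distrib, Finset.prod_mul_distrib, Finset.prod_pow, weight, weight, hookProd]
    field_simp
  rw [mixedWeight, levelWeight, h3]
  field_simp

theorem hasSum_negBinomial_sqrt (t : ℂ) {ξ : ℝ} (hξ0 : 0 ≤ ξ) (hξ1 : ξ < 1) :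
    HasSum (fun n => coeff n (negBinomial (-t)) * ((√ξ : ℝ) : ℂ) ^ n)
      (((1 - ξ : ℝ) : ℂ) ^ t) := by
  have hq : ‖((√ξ : ℝ) : ℂ)‖ < 1 := by
    rw [Complex.norm_real, Real.norm_of_nonneg (Real.sqrt_nonneg _)]
    rwa [Real.sqrt_lt' one_pos, one_pow]
  have h := hasSum_negBinomial (-t) hq
  rwa [neg_neg, ← Complex.ofReal_pow, Real.sq_sqrt hξ0, ← Complex.ofReal_one,
    ← Complex.ofReal_sub] at h

theorem convergesAt_kernelSeries (z z' : ℂ) {ξ : ℝ} (hξ0 : 0 ≤ ξ) (hξ1 : ξ < 1) (i j : ℤ) :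
    ConvergesAt (kernelSeries z z' i j) ((√ξ : ℝ) : ℂ) := by
  have hq1 : √ξ < 1 := by rwa [Real.sqrt_lt' one_pos, one_pow]
  rw [kernelSeries_eq]
  exact ConvergesAt.mul (hasSum_negBinomial_sqrt _ hξ0 hξ1).summable
    (hasSum_sandwich z z' (Real.sqrt_nonneg ξ) hq1
      (isPartialInjection_psi_mul_psiStar i j)).summable

/-- The determinant is taken in the subring of absolutely convergent series, where evaluation is a
ring homomorphism. -/
theorem det_kernel_eq_tsum (z z' : ℂ) {ξ : ℝ} (hξ0 : 0 ≤ ξ) (hξ1 : ξ < 1) {s : ℕ}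
    (x : Fin s → ℤ) :
    (Matrix.of fun i j => kernel z z' ξ (x i) (x j)).det =
      ∑' n, coeff n (Matrix.of fun i j => kernelSeries z z' (x i) (x j)).det *
        ((√ξ : ℝ) : ℂ) ^ n := by
  set q : ℂ := ((√ξ : ℝ) : ℂ)
  let M : Matrix (Fin s) (Fin s) (convergentSeries q) := Matrix.of fun i j =>
    ⟨kernelSeries z z' (x i) (x j), convergesAt_kernelSeries z z' hξ0 hξ1 (x i) (x j)⟩
  have h1 : (Matrix.of fun i j => kernel z z' ξ (x i) (x j)).det = evalSeries q M.det := by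
    rw [RingHom.map_det]
    rfl
  have h2 : (Matrix.of fun i j => kernelSeries z z' (x i) (x j)).det =
      (convergentSeries q).subtype M.det := by
    rw [RingHom.map_det]
    rfl
  rw [h1, h2]
  rfl

/-- At q = √ξ the binomial prefactor becomes (1 - ξ)^{zz'}, and the sandwiched occupation operator,
being diagonal, leaves the sum of the weights over the diagrams that contain all the points. -/
theorem det_kernel_eq_mixedMeasure {z z' : ℂ} (hz : ∀ n : ℕ, z * z' ≠ -(n : ℂ)) {ξ : ℝ}
    (hξ0 : 0 ≤ ξ) (hξ1 : ξ < 1) {s : ℕ} {x : Fin s → ℤ} (hx : Function.Injective x) :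
    (Matrix.of fun i j => kernel z z' ξ (x i) (x j)).det =
      mixedMeasure z z' ξ {lam | ∀ k, x k ∈ frakS lam} := by
  have hq1 : √ξ < 1 := by rwa [Real.sqrt_lt' one_pos, one_pow]
  have h1 := hasSum_negBinomial_sqrt (z * z') hξ0 hξ1
  have h2 := hasSum_sandwich z z' (Real.sqrt_nonneg ξ) hq1 (isPartialInjection_occupation hx)
  rw [det_kernel_eq_tsum z z' hξ0 hξ1, det_kernelSeries,
    ConvergesAt.tsum_mul h1.summable h2.summable, h1.tsum_eq, h2.tsum_eq,
    tsum_pairTerm_occupation z z' _ hx, mixedMeasure, ← tsum_mul_left,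
    ← Complex.ofReal_pow, Real.sq_sqrt hξ0]
  exact tsum_congr fun lam => (mixedWeight_eq hz ξ lam.1).symm

theorem summable_mixedWeight {z z' : ℂ} (hz : ∀ n : ℕ, z * z' ≠ -(n : ℂ)) {ξ : ℝ}
    (hξ0 : 0 ≤ ξ) (hξ1 : ξ < 1) : Summable fun lam => mixedWeight z z' ξ lam := by
  have hq1 : √ξ < 1 := by rwa [Real.sqrt_lt' one_pos, one_pow]
  have h := (summable_weight_mul_weight z z' (Real.sqrt_nonneg ξ) hq1).mul_left
    (((1 - ξ : ℝ) : ℂ) ^ (z * z'))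
  rw [← Complex.ofReal_pow, Real.sq_sqrt hξ0] at h
  exact h.congr fun lam => (mixedWeight_eq hz ξ lam).symm

end ZMeasure

end

theorem theorem1 (z z' : ℂ) (hz : ∀ n : ℕ, z * z' ≠ -(n : ℂ))
    (ξ : ℝ) (hξ0 : 0 ≤ ξ) (hξ1 : ξ < 1) :
    (Summable fun lam : YoungDiagram => ZMeasure.mixedWeight z z' ξ lam) ∧
    (∀ i j : ℤ, Summable fun n : ℕ =>
      PowerSeries.coeff n (ZMeasure.kernelSeries z z' i j) * ((√ξ : ℝ) : ℂ) ^ n) ∧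
    ∀ X : Finset ℤ,
      ZMeasure.correlation z z' ξ X =
        Matrix.det (Matrix.of fun i j : X => ZMeasure.kernel z z' ξ i j) := by
  refine ⟨ZMeasure.summable_mixedWeight hz hξ0 hξ1,
    fun i j => ZMeasure.convergesAt_kernelSeries z z' hξ0 hξ1 i j, fun X => ?_⟩
  -- Wick's theorem needs ordered products, so X is enumerated; the determinant does not depend on
  -- the enumeration, since rows and columns are reindexed together.
  have hx : Function.Injective fun k : Fin X.card => ((X.equivFin.symm k : X) : ℤ) :=
    Subtype.val_injective.comp X.equivFin.symm.injective
  rw [← Matrix.det_submatrix_equiv_self X.equivFin.symm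
    (Matrix.of fun i j : X => ZMeasure.kernel z z' ξ i j)]
  refine Eq.trans ?_ (ZMeasure.det_kernel_eq_mixedMeasure hz hξ0 hξ1 hx).symm
  have hX : {lam | (X : Set ℤ) ⊆ ZMeasure.frakS lam} =
      {lam | ∀ k : Fin X.card, ((X.equivFin.symm k : X) : ℤ) ∈ ZMeasure.frakS lam} := by
    ext lam
    refine ⟨fun h k => h (X.equivFin.symm k).2, fun h n hn => ?_⟩
    have := h (X.equivFin ⟨n, hn⟩)
    rwa [Equiv.symm_apply_apply] at this
  rw [ZMeasure.correlation, hX]
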